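/- Let $\mathcal A=(\Sigma,Q,q_0,\delta,F)$ denote a deterministic finite automaton with $|Q|=n$ states over the alphabet $\Sigma=\{1,\dots,\sigma\}$. A state $q$ is recurrent if $\delta(q,x)=q$ for some non-empty string $x$; $\mathcal A$ is acyclic if it has a unique recurrent state $d$ (the dead state; the other $n-1$ states are called transient), and initially-connected if every state is reachable from $q_0$. (a) In every initially-connected acyclic $\mathcal A$ one has $\delta(d,a)=d$ for all $a\in\Sigma$, and the edges $\{q,\delta(q,\sigma)\}$ with $q\neq d$ form a spanning tree of the state set; rooted at $d$, the parent of $q\ne d$ is $\delta(q,\sigma)$. (b) There is an encoding of initially-connected acyclic automata by bit strings, which determines $\mathcal A$ up to renaming its states when $n$ and $\sigma$ are given, of length at most $$(\sigma-1)(n-1)\log_2 n+3n+O(\log^2\sigma)+o(n)$$ bits (the constant in $O(\cdot)$ is absolute, and the $o(n)$ term is a function of $n$ only), together with a single word-RAM program with the following property. When the encoding of $\mathcal A$ is in read-only memory (any block of at most $w$ consecutive bits is read in one step) and words have $w\ge c\lceil\log_2(n\sigma+1)\rceil$ bits, where $c$ is an absolute constant, the program decides for every string $x$ over $\Sigma$,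 given as a read-only one-way input, whether $\mathcal A$ accepts $x$, in $O(|x|+1)$ time and with $O(1)$ words of working space, with absolute constants. The encoding does not depend on $w$ or $x$, and the program depends on none of $\mathcal A$, $n$, $\sigma$, $w$, $x$. -/

import Mathlib

/-! ### Acyclic automata -/

/-- A state `q` is recurrent if `δ(q, x) = q` for some non-empty string `x`. -/
def DFA.IsRecurrent {α Q : Type*} (A : DFA α Q) (q : Q) : Prop :=
  ∃ x : List α, x ≠ [] ∧ A.evalFrom q x = q

/-- An automaton is acyclic if it has a unique recurrent state (its dead state). -/
def DFA.IsAcyclic {α Q : Type*} (A : DFA α Q) : Prop :=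
  ∃! q : Q, A.IsRecurrent q

/-- All states are reachable from the initial state. -/
def DFA.IsInitiallyConnected {α Q : Type*} (A : DFA α Q) : Prop :=
  ∀ q : Q, ∃ x : List α, A.eval x = q

/-- The undirected graph formed by the transitions on the letter `a`, self-loops being dropped. -/
def DFA.letterGraph {α Q : Type*} (A : DFA α Q) (a : α) : SimpleGraph Q :=
  SimpleGraph.fromRel (fun p q => A.step p a = q)

/-! ### A word RAM with a read-only memory, a one-way read-only input and `k` working registers

All registers hold words of `w` bits, and every instruction costs one unit of time. A program is a
finite list of instructions that does not mention `w`, the contents of the memory, or the input, so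
that one and the same program runs for all of them. There is no writable memory besides the `k`
registers: the working space is `k` words. -/

namespace WordRAM

/-- The arithmetic and bitwise operations on words (all of them unsigned, modulo `2 ^ w`). -/
inductive BinOp where
  | add | sub | mul | div | mod | and | or | xor | shl | shr

/-- Value of an operation on words of `w` bits. -/
def BinOp.eval {w : ℕ} : BinOp → BitVec w → BitVec w → BitVec w
  | .add, a, b => a + b
  | .sub, a, b => a - b
  | .mul, a, b => a * b
  | .div, a, b => a.udiv b
  | .mod, a, b => a.umod b
  | .and, a, b => a &&& b
  | .or, a, b => a ||| b
  | .xor, a, b => a ^^^ b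
  | .shl, a, b => a <<< b.toNat
  | .shr, a, b => a >>> b.toNat

/-- The instructions of a machine with `k` registers; `tgt` is the index of an instruction. -/
inductive Instr (k : ℕ) where
  /-- `dst := v` -/
  | const (dst : Fin k) (v : ℕ)
  /-- `dst := src` -/
  | copy (dst src : Fin k)
  /-- `dst := o a b` -/
  | op (o : BinOp) (dst a b : Fin k)
  /-- Read `len` consecutive bits of the memory (at most `w` of them), starting with bit number
  `addr`, into `dst`. -/
  | load (dst addr len : Fin k)
  /-- Read the next letter of the input into `dst`; at the end of the input jump to `tgt`. -/
  | next (dst : Fin k) (tgt : ℕ)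
  /-- Jump to `tgt`. -/
  | jump (tgt : ℕ)
  /-- Jump to `tgt` if `a < b`. -/
  | jumpLt (a b : Fin k) (tgt : ℕ)
  /-- Jump to `tgt` if `a = b`. -/
  | jumpEq (a b : Fin k) (tgt : ℕ)
  /-- Halt and answer yes. -/
  | accept
  /-- Halt and answer no. -/
  | reject

/-- A program is a finite list of instructions. -/
abbrev Program (k : ℕ) := List (Instr k)

/-- A configuration: the program counter, the registers, and the part of the input that has not yet
been read. -/
structure Config (k w σ : ℕ) where
  pc : ℕ
  reg : Fin k → BitVec w
  input : List (Fin σ)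

/-- The word made of the bits `p, p + 1, …, p + min l w - 1` of the memory, the first one being the
least significant one; bits beyond the end of the memory are zero. -/
def readBits (w : ℕ) (mem : List Bool) (p l : ℕ) : BitVec w :=
  BitVec.ofNat w (∑ i ∈ Finset.range (min l w), if mem.getD (p + i) false then 2 ^ i else 0)

/-- Go to the next instruction after assigning `v` to the register `dst`. -/
def Config.assign {k w σ : ℕ} (c : Config k w σ) (dst : Fin k) (v : BitVec w) : Config k w σ :=
  { c with pc := c.pc + 1, reg := Function.update c.reg dst v }

/-- The effect of one instruction (`accept` and `reject` are treated in `run`). -/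
def Instr.exec {k w σ : ℕ} (mem : List Bool) (c : Config k w σ) : Instr k → Config k w σ
  | .const dst v => c.assign dst (BitVec.ofNat w v)
  | .copy dst src => c.assign dst (c.reg src)
  | .op o dst a b => c.assign dst (o.eval (c.reg a) (c.reg b))
  | .load dst addr len =>
      c.assign dst (readBits w mem (c.reg addr).toNat (c.reg len).toNat)
  | .next dst tgt =>
      match c.input with
      | [] => { c with pc := tgt }
      | a :: x => { c.assign dst (BitVec.ofNat w a.val) with input := x }
  | .jump tgt => { c with pc := tgt }
  | .jumpLt a b tgt =>
      { c with pc := if (c.reg a).toNat < (c.reg b).toNat then tgt else c.pc + 1 }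
  | .jumpEq a b tgt => { c with pc := if c.reg a = c.reg b then tgt else c.pc + 1 }
  | .accept => c
  | .reject => c

/-- Run `P` for at most `t` steps: `some b` if it halts within `t` steps with the answer `b`, and
`none` if it does not (or leaves the program). -/
def run {k w σ : ℕ} (P : Program k) (mem : List Bool) : ℕ → Config k w σ → Option Bool
  | 0, _ => none
  | t + 1, c =>
      match P[c.pc]? with
      | none => none
      | some .accept => some true
      | some .reject => some false
      | some i => run P mem t (i.exec mem c)

/-- The initial configuration on the input `x`: all registers are zero. -/
def start {k σ : ℕ} (w : ℕ) (x : List (Fin σ)) : Config k w σ :=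
  ⟨0, fun _ => 0, x⟩

/-- With word size `w`, memory `mem` and input `x`, the program `P` halts within `t` steps, and its
answer is yes if and only if `p` holds. -/
def DecidesWithin {k σ : ℕ} (P : Program k) (w : ℕ) (mem : List Bool) (x : List (Fin σ)) (t : ℕ)
    (p : Prop) : Prop :=
  ∃ b : Bool, run P mem t (start w x) = some b ∧ (b = true ↔ p)

end WordRAM

/-!
In an automaton with a unique recurrent state `d`, the path of any single letter runs into a cycle,
hence into `d`. This makes `d` a fixed point of every letter (`DFA.step_dead`) and the transitions
on a letter a tree rooted at `d` (`DFA.letterGraph_isTree`).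

For the encoding, let the height of a state be the length of the longest path to `d`, and choose for
each state `q` a letter `fl q` that decreases the height by exactly one. Following these letters and
comparing the paths as numbers in base `n` sorts the states so that every transition decreases and
the transitions on the letters `fl q` are monotone (`DFA.exists_isSorted`). Then

* the monotone transitions are stored in `2 n + o(n)` bits, each as a high part in unary and a low
  part in binary, relative to the beginning of a block of `R` rows;
* the accepting states take `n` bits;
* the other `σ - 1` targets of row `i` are less than `i`, and are stored as digits in a base that is
  the number of the last row of the block, four to a number. Up to lower order terms they take
  `log₂ n! = n log₂ n - 1.44 n` bits per letter, plus `n / 4` bits for the rounding. The gain of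
  `1.19 n` bits for each of the `σ - 1` letters pays for writing down the letters `fl q`, for which
  `log₂ σ` rounded up is at most `σ - 1`, and for a directory of the blocks
  (`Code.aBlock_le_of_large`).

The blocks have `R = 2 ^ 17 * s` rows, where `s` is about a quarter of `log₂ n`. So the directory is
small, while the unary code of a block, of at most `3 R` bits, is scanned with constantly many
lookups in a table that is indexed by `s` bits, and that takes only `O(n ^ (3 / 4))` bits. For the
finitely many `n` below a threshold the blocks are single rows, and what exceeds the bound is of the
order of `log₂ σ` (`Code.aBlock_le_of_small`). An automaton with a single letter is a path, and only
its accepting bits are stored.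

The program (`Code.exists_program`) is written in expressions over a fixed number of variables, and
compiled to instructions (`WordRAM.exists_streamProgram`): a block of assignments that reads the
header of the code, a block that carries out one transition, and a block that reads the accepting
bit. All of them are free of jumps and hence run in constant time. As the program recovers the
tables from the bits alone, codes with equal bits belong to the same sorted automaton
(`Code.eq_of_bits_eq`).
-/

namespace WordRAM

/-! ### Straight-line code and expressions -/

/-- The instructions that assign a register and go on to the next instruction. -/
def Instr.IsStraight {k : ℕ} : Instr k → Prop
  | .const _ _ | .copy _ _ | .op _ _ _ _ | .load _ _ _ => True
  | _ => False

/-- The configuration reached by executing a list of instructions in turn. -/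
def execList {k w σ : ℕ} (mem : List Bool) (is : List (Instr k)) (c : Config k w σ) :
    Config k w σ :=
  is.foldl (fun c i => i.exec mem c) c

theorem execList_append {k w σ : ℕ} (mem : List Bool) (is js : List (Instr k))
    (c : Config k w σ) : execList mem (is ++ js) c = execList mem js (execList mem is c) := by
  simp [execList]

theorem Instr.IsStraight.exec_pc {k w σ : ℕ} {i : Instr k} (h : i.IsStraight) (mem : List Bool)
    (c : Config k w σ) : (i.exec mem c).pc = c.pc + 1 := by
  cases i <;> simp_all [Instr.IsStraight, Instr.exec, Config.assign]

theorem Instr.IsStraight.exec_input {k w σ : ℕ} {i : Instr k} (h : i.IsStraight)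
    (mem : List Bool) (c : Config k w σ) : (i.exec mem c).input = c.input := by
  cases i <;> simp_all [Instr.IsStraight, Instr.exec, Config.assign]

theorem execList_pc {k w σ : ℕ} (mem : List Bool) (is : List (Instr k))
    (h : ∀ i ∈ is, i.IsStraight) (c : Config k w σ) :
    (execList mem is c).pc = c.pc + is.length := by
  induction is generalizing c with
  | nil => rfl
  | cons i is ih =>
    have h1 := (h i (by simp)).exec_pc mem c
    have h2 := ih (fun j hj => h j (by simp [hj])) (i.exec mem c)
    simp only [execList, List.foldl_cons, List.length_cons] at h2 ⊢
    omega

theorem execList_input {k w σ : ℕ} (mem : List Bool) (is : List (Instr k))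
    (h : ∀ i ∈ is, i.IsStraight) (c : Config k w σ) :
    (execList mem is c).input = c.input := by
  induction is generalizing c with
  | nil => rfl
  | cons i is ih =>
    have h1 := (h i (by simp)).exec_input mem c
    have h2 := ih (fun j hj => h j (by simp [hj])) (i.exec mem c)
    simp only [execList, List.foldl_cons] at h2 ⊢
    rw [h2, h1]

theorem run_step {k w σ : ℕ} {P : Program k} (mem : List Bool) (t : ℕ) {c : Config k w σ}
    {i : Instr k} (hi : P[c.pc]? = some i) (h1 : i ≠ .accept) (h2 : i ≠ .reject) :
    run P mem (t + 1) c = run P mem t (i.exec mem c) := by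
  rw [run, hi]
  cases i <;> simp_all

theorem run_straight {k w σ : ℕ} (mem : List Bool) (t : ℕ) (is pre post : List (Instr k))
    (h : ∀ i ∈ is, i.IsStraight) (c : Config k w σ) (hc : c.pc = pre.length) :
    run (pre ++ (is ++ post)) mem (t + is.length) c =
      run (pre ++ (is ++ post)) mem t (execList mem is c) := by
  induction is generalizing c pre with
  | nil => rfl
  | cons i is ih =>
    have hi := h i (by simp)
    have hget : (pre ++ ((i :: is) ++ post))[c.pc]? = some i := by simp [hc]
    rw [List.length_cons, ← add_assoc, run_step mem _ hget
      (by rintro rfl; exact hi) (by rintro rfl; exact hi)]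
    have := ih (pre ++ [i]) (fun j hj => h j (by simp [hj])) (i.exec mem c)
      (by rw [hi.exec_pc, hc]; simp)
    simpa [execList] using this

theorem run_mono {k w σ : ℕ} {P : Program k} {mem : List Bool} {t : ℕ} {c : Config k w σ}
    {b : Bool} (h : run P mem t c = some b) (s : ℕ) : run P mem (t + s) c = some b := by
  induction t generalizing c with
  | zero => simp [run] at h
  | succ t ih =>
    rw [show t + 1 + s = (t + s) + 1 by omega]
    rw [run] at h ⊢
    cases hP : P[c.pc]? with
    | none => simp [hP] at h
    | some i => cases i <;> simp_all

/-- Expressions over the variables `Fin V`: constants, variables, operations, and loads of at most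
`w` bits from the memory. -/
inductive Expr (V : ℕ) where
  | lit (v : ℕ)
  | var (i : Fin V)
  | op (o : BinOp) (a b : Expr V)
  | load (addr len : Expr V)

/-- The value of an expression in words of `w` bits. -/
def Expr.eval {V w : ℕ} (mem : List Bool) (ρ : Fin V → BitVec w) : Expr V → BitVec w
  | .lit v => BitVec.ofNat w v
  | .var i => ρ i
  | .op o a b => o.eval (a.eval mem ρ) (b.eval mem ρ)
  | .load a l => readBits w mem (a.eval mem ρ).toNat (l.eval mem ρ).toNat

/-- The number of registers needed to evaluate an expression. -/
def Expr.depth {V : ℕ} : Expr V → ℕ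
  | .lit _ => 1
  | .var _ => 1
  | .op _ a b => max a.depth (b.depth + 1)
  | .load a b => max a.depth (b.depth + 1)

/-- The register of a variable; the first `V` registers hold the variables. -/
def vreg {V : ℕ} (D : ℕ) (i : Fin V) : Fin (V + (D + 1)) := Fin.castAdd (D + 1) i

/-- The registers behind those of the variables form a stack for intermediate results. -/
def treg (V D d : ℕ) : Fin (V + (D + 1)) := Fin.natAdd V (Fin.ofNat (D + 1) d)

theorem vreg_ne_treg {V D : ℕ} (i : Fin V) (d : ℕ) : vreg D i ≠ treg V D d := by
  intro h
  have := congrArg Fin.val h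
  simp [vreg, treg] at this
  omega

theorem vreg_injective {V : ℕ} (D : ℕ) : Function.Injective (vreg D : Fin V → _) :=
  Fin.castAdd_injective V (D + 1)

theorem treg_ne_treg {V D d e : ℕ} (hd : d ≤ D) (he : e ≤ D) (h : d ≠ e) :
    treg V D d ≠ treg V D e := by
  intro h'
  have := congrArg Fin.val h'
  simp [treg, Nat.mod_eq_of_lt (Nat.lt_succ_of_le hd), Nat.mod_eq_of_lt (Nat.lt_succ_of_le he)]
    at this
  exact h this

/-- Code that leaves the value of an expression in the stack register `d`, without changing the
registers below. -/
def Expr.compile {V : ℕ} (D : ℕ) : Expr V → ℕ → List (Instr (V + (D + 1)))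
  | .lit v, d => [.const (treg V D d) v]
  | .var i, d => [.copy (treg V D d) (vreg D i)]
  | .op o a b, d =>
      a.compile D d ++ (b.compile D (d + 1) ++ [.op o (treg V D d) (treg V D d) (treg V D (d + 1))])
  | .load a b, d =>
      a.compile D d ++ (b.compile D (d + 1) ++ [.load (treg V D d) (treg V D d) (treg V D (d + 1))])

theorem Expr.compile_isStraight {V D : ℕ} (e : Expr V) (d : ℕ) :
    ∀ i ∈ e.compile D d, i.IsStraight := by
  induction e generalizing d with
  | lit | var => simp [Expr.compile, Instr.IsStraight]
  | op o a b iha ihb | load a b iha ihb =>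
    intro i hi
    simp only [Expr.compile, List.mem_append, List.mem_singleton] at hi
    rcases hi with hi | hi | rfl
    · exact iha d i hi
    · exact ihb (d + 1) i hi
    · simp [Instr.IsStraight]

theorem Expr.depth_pos {V : ℕ} (e : Expr V) : 0 < e.depth := by
  induction e <;> simp_all [Expr.depth]

theorem Expr.compile_spec {V D w σ : ℕ} (mem : List Bool) (e : Expr V) (d : ℕ)
    (hd : d + e.depth ≤ D + 1) (c : Config (V + (D + 1)) w σ) :
    (execList mem (e.compile D d) c).reg (treg V D d) =
        e.eval mem (fun i => c.reg (vreg D i)) ∧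
      (∀ i, (execList mem (e.compile D d) c).reg (vreg D i) = c.reg (vreg D i)) ∧
      ∀ f < d, (execList mem (e.compile D d) c).reg (treg V D f) = c.reg (treg V D f) := by
  induction e generalizing d c with
  | lit v =>
    simp only [Expr.depth] at hd
    refine ⟨by simp [Expr.compile, execList, Instr.exec, Config.assign, Expr.eval],
      fun i => ?_, fun f hf => ?_⟩
    · simp [Expr.compile, execList, Instr.exec, Config.assign, vreg_ne_treg]
    · simp only [Expr.compile, execList, List.foldl, Instr.exec, Config.assign]
      rw [Function.update_of_ne (treg_ne_treg (by omega) (by omega) (by omega))]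
  | var v =>
    simp only [Expr.depth] at hd
    refine ⟨by simp [Expr.compile, execList, Instr.exec, Config.assign, Expr.eval],
      fun i => ?_, fun f hf => ?_⟩
    · simp [Expr.compile, execList, Instr.exec, Config.assign, vreg_ne_treg]
    · simp only [Expr.compile, execList, List.foldl, Instr.exec, Config.assign]
      rw [Function.update_of_ne (treg_ne_treg (by omega) (by omega) (by omega))]
  | op o a b iha ihb | load a b iha ihb =>
    have hb := b.depth_pos
    simp only [Expr.depth] at hd
    obtain ⟨a1, a2, a3⟩ := iha d (by omega) c
    obtain ⟨b1, b2, b3⟩ := ihb (d + 1) (by omega) (execList mem (a.compile D d) c)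
    have key := fun (f : ℕ) (hf : f < d) => (b3 f (by omega)).trans (a3 f hf)
    have b3' := (b3 d (by omega)).trans a1
    have b1' : (execList mem (b.compile D (d + 1)) (execList mem (a.compile D d) c)).reg
        (treg V D (d + 1)) = b.eval mem (fun i => c.reg (vreg D i)) := by
      rw [b1]; congr 1; funext i; exact a2 i
    simp only [Expr.compile, execList_append]
    set c2 := execList mem (b.compile D (d + 1)) (execList mem (a.compile D d) c)
    refine ⟨?_, fun i => ?_, fun f hf => ?_⟩
    · simp [execList, Instr.exec, Config.assign, Expr.eval, b3', b1']
    · simp only [execList, List.foldl, Instr.exec, Config.assign]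
      rw [Function.update_of_ne (vreg_ne_treg _ _)]
      exact (b2 i).trans (a2 i)
    · simp only [execList, List.foldl, Instr.exec, Config.assign]
      rw [Function.update_of_ne (treg_ne_treg (by omega) (by omega) (by omega))]
      exact key f hf

/-! ### Programs that process the input letter by letter -/

/-- A block is a list of assignments of expressions to variables. -/
abbrev Block (V : ℕ) := List (Fin V × Expr V)

/-- The effect of a block on the values of the variables. -/
def Block.eval {V w : ℕ} (mem : List Bool) (ss : Block V) (ρ : Fin V → BitVec w) :
    Fin V → BitVec w :=
  ss.foldl (fun ρ s => Function.update ρ s.1 (s.2.eval mem ρ)) ρ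

theorem Block.eval_append {V w : ℕ} (mem : List Bool) (ss ts : Block V) (ρ : Fin V → BitVec w) :
    Block.eval mem (ss ++ ts) ρ = Block.eval mem ts (Block.eval mem ss ρ) := by
  simp [Block.eval]

theorem Block.eval_cons {V w : ℕ} (mem : List Bool) (s : Fin V × Expr V) (ss : Block V)
    (ρ : Fin V → BitVec w) :
    Block.eval mem (s :: ss) ρ =
      Block.eval mem ss (Function.update ρ s.1 (s.2.eval mem ρ)) := by
  simp [Block.eval]

/-- A bound on the number of stack registers that a block needs. -/
def Block.depth {V : ℕ} (ss : Block V) : ℕ := (ss.map fun s => s.2.depth).sum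

/-- The code of a block. -/
def Block.compile {V : ℕ} (D : ℕ) (ss : Block V) : List (Instr (V + (D + 1))) :=
  ss.flatMap fun s => s.2.compile D 0 ++ [.copy (vreg D s.1) (treg V D 0)]

theorem Block.compile_isStraight {V D : ℕ} (ss : Block V) :
    ∀ i ∈ ss.compile D, i.IsStraight := by
  intro i hi
  simp only [Block.compile, List.mem_flatMap, List.mem_append, List.mem_singleton] at hi
  obtain ⟨s, -, hi | rfl⟩ := hi
  · exact s.2.compile_isStraight 0 i hi
  · simp [Instr.IsStraight]

theorem Block.compile_spec {V D w σ : ℕ} (mem : List Bool) (ss : Block V)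
    (hD : ss.depth ≤ D + 1) (c : Config (V + (D + 1)) w σ) :
    (fun i => (execList mem (ss.compile D) c).reg (vreg D i)) =
      ss.eval mem (fun i => c.reg (vreg D i)) := by
  induction ss generalizing c with
  | nil => rfl
  | cons s ss ih =>
    simp only [Block.depth, List.map_cons, List.sum_cons] at hD
    obtain ⟨h1, h2, -⟩ := s.2.compile_spec (D := D) mem 0 (by omega) c
    have := ih (by simp only [Block.depth]; omega)
      (execList mem (s.2.compile D 0 ++ [.copy (vreg D s.1) (treg V D 0)]) c)
    rw [Block.eval_cons, show Block.compile D (s :: ss) =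
      (s.2.compile D 0 ++ [.copy (vreg D s.1) (treg V D 0)]) ++ Block.compile D ss by
        simp [Block.compile], execList_append, this]
    congr 1
    funext i
    rw [execList_append]
    by_cases hi : i = s.1
    · subst hi
      rw [Function.update_self, ← h1]
      simp [execList, Instr.exec, Config.assign]
    · rw [Function.update_of_ne hi, ← h2 i]
      exact Function.update_of_ne (fun h => hi (vreg_injective D h)) _ _

/-- The program that executes the block `pre`, then the block `body` for every letter of the
input, the letter being assigned to the variable `l`, then the block `fin`, and that accepts if
the variable `r` is not zero in the end. -/
def streamProgram {V : ℕ} (D : ℕ) (pre body fin : Block V) (l r : Fin V) :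
    Program (V + (D + 1)) :=
  pre.compile D ++
    ([.next (vreg D l) ((pre.compile D).length + (body.compile D).length + 2)] ++
      (body.compile D ++ ([.jump (pre.compile D).length] ++
        ((fin.compile D ++ [.const (treg V D 0) 0]) ++
          [.jumpEq (vreg D r) (treg V D 0) ((pre.compile D).length + (body.compile D).length + 2 +
            (fin.compile D).length + 3), .accept, .reject]))))

theorem streamProgram_loop {V D w σ : ℕ} (mem : List Bool) (pre body fin : Block V) (l r : Fin V)
    (hbody : body.depth ≤ D + 1) (hfin : fin.depth ≤ D + 1) (x : List (Fin σ))
    (c : Config (V + (D + 1)) w σ) (hc : c.pc = (pre.compile D).length) (hx : c.input = x) :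
    run (streamProgram D pre body fin l r) mem
        (x.length * ((body.compile D).length + 2) + ((fin.compile D).length + 4)) c =
      some (fin.eval mem (x.foldl (fun ρ a => body.eval mem
        (Function.update ρ l (BitVec.ofNat w a.val))) (fun i => c.reg (vreg D i))) r != 0) := by
  induction x generalizing c with
  | nil =>
    set P := streamProgram D pre body fin l r with hP
    have hnext : P[c.pc]? =
        some (.next (vreg D l) ((pre.compile D).length + (body.compile D).length + 2)) := by
      simp [hP, streamProgram, hc]
    rw [List.length_nil, zero_mul, zero_add, show (fin.compile D).length + 4 =
      (2 + (fin.compile D ++ [Instr.const (treg V D 0) 0]).length) + 1 by simp; omega,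
      run_step mem _ hnext (by simp) (by simp)]
    set c1 : Config (V + (D + 1)) w σ :=
      { c with pc := (pre.compile D).length + (body.compile D).length + 2 } with hc1
    have e1 : Instr.exec mem c
        (.next (vreg D l) ((pre.compile D).length + (body.compile D).length + 2)) = c1 := by
      simp [Instr.exec, hx, hc1]
    rw [e1]
    have hst : ∀ i ∈ fin.compile D ++ [Instr.const (treg V D 0) 0], i.IsStraight := by
      intro i hi
      rcases List.mem_append.1 hi with hi | hi
      · exact fin.compile_isStraight i hi
      · rw [List.mem_singleton.1 hi]; simp [Instr.IsStraight]
    have hdecomp : P = (pre.compile D ++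
        ([.next (vreg D l) ((pre.compile D).length + (body.compile D).length + 2)] ++
        (body.compile D ++ [.jump (pre.compile D).length]))) ++
        ((fin.compile D ++ [Instr.const (treg V D 0) 0]) ++
        [.jumpEq (vreg D r) (treg V D 0) ((pre.compile D).length + (body.compile D).length + 2 +
            (fin.compile D).length + 3), .accept, .reject]) := by
      simp [hP, streamProgram]
    have hrun := run_straight mem 2 (fin.compile D ++ [Instr.const (treg V D 0) 0])
      (pre.compile D ++
        ([.next (vreg D l) ((pre.compile D).length + (body.compile D).length + 2)] ++
        (body.compile D ++ [.jump (pre.compile D).length])))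
      [.jumpEq (vreg D r) (treg V D 0) ((pre.compile D).length + (body.compile D).length + 2 +
            (fin.compile D).length + 3), .accept, .reject] hst c1 (by simp [hc1]; omega)
    rw [← hdecomp] at hrun
    rw [hrun]
    set c2 := execList mem (fin.compile D ++ [Instr.const (treg V D 0) 0]) c1 with hc2
    have hpc2 : c2.pc = (pre.compile D).length + (body.compile D).length + 2 +
        (fin.compile D).length + 1 := by
      rw [hc2, execList_pc mem _ hst]; simp [hc1]; omega
    have hz : c2.reg (treg V D 0) = 0 := by
      rw [hc2, execList_append]; simp [execList, Instr.exec, Config.assign]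
    have hr : c2.reg (vreg D r) = fin.eval mem (fun i => c.reg (vreg D i)) r := by
      have h3 := congrFun (fin.compile_spec (D := D) mem hfin c1) r
      rw [hc2, execList_append]
      simp only [execList, List.foldl_cons, List.foldl_nil, Instr.exec, Config.assign]
      rw [Function.update_of_ne (vreg_ne_treg _ _)]
      exact h3
    have hget : ∀ j, P[(pre.compile D).length + (body.compile D).length + 2 +
        (fin.compile D).length + 1 + j]? =
        [Instr.jumpEq (vreg D r) (treg V D 0) ((pre.compile D).length + (body.compile D).length + 2 +
            (fin.compile D).length + 3), .accept, .reject][j]? := by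
      intro j
      rw [hdecomp, ← List.append_assoc, List.getElem?_append_right (by simp; omega)]
      congr 1
      simp; omega
    have g0 := hget 0
    have g1 := hget 1
    have g2 := hget 2
    simp only [List.getElem?_cons_zero, List.getElem?_cons_succ, add_zero] at g0 g1 g2
    rw [run_step (t := 1) mem (by rw [hpc2]; exact g0) (by simp) (by simp)]
    simp only [Instr.exec, hz, hr, List.foldl_nil, run, hpc2]
    by_cases hv : fin.eval mem (fun i => c.reg (vreg D i)) r = 0
    · rw [if_pos hv, g2]; simp [hv]
    · rw [if_neg hv, g1]; simpa using hv
  | cons a x ih =>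
    set P := streamProgram D pre body fin l r with hP
    have hnext : P[c.pc]? =
        some (.next (vreg D l) ((pre.compile D).length + (body.compile D).length + 2)) := by
      simp [hP, streamProgram, hc]
    rw [show (a :: x).length * ((body.compile D).length + 2) + ((fin.compile D).length + 4) =
      ((x.length * ((body.compile D).length + 2) + ((fin.compile D).length + 4)) + 1 +
        (body.compile D).length) + 1 by rw [List.length_cons]; ring,
      run_step mem _ hnext (by simp) (by simp)]
    set c1 := Instr.exec mem c
      (.next (vreg D l) ((pre.compile D).length + (body.compile D).length + 2)) with hc1
    have hc1' : c1 = { c.assign (vreg D l) (BitVec.ofNat w a.val) with input := x } := by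
      rw [hc1, Instr.exec, hx]
    have hdecomp : P = (pre.compile D ++
        [.next (vreg D l) ((pre.compile D).length + (body.compile D).length + 2)]) ++
        (body.compile D ++ ([.jump (pre.compile D).length] ++
        ((fin.compile D ++ [.const (treg V D 0) 0]) ++
          [.jumpEq (vreg D r) (treg V D 0) ((pre.compile D).length + (body.compile D).length + 2 +
            (fin.compile D).length + 3), .accept, .reject]))) := by
      simp [hP, streamProgram]
    have hrun := run_straight mem
      ((x.length * ((body.compile D).length + 2) + ((fin.compile D).length + 4)) + 1)
      (body.compile D) (pre.compile D ++
        [.next (vreg D l) ((pre.compile D).length + (body.compile D).length + 2)])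
      ([.jump (pre.compile D).length] ++
        ((fin.compile D ++ [.const (treg V D 0) 0]) ++
          [.jumpEq (vreg D r) (treg V D 0) ((pre.compile D).length + (body.compile D).length + 2 +
            (fin.compile D).length + 3), .accept, .reject]))
      body.compile_isStraight c1 (by simp [hc1', Config.assign, hc])
    rw [← hdecomp] at hrun
    rw [hrun]
    have hpc : (execList mem (body.compile D) c1).pc =
        (pre.compile D).length + 1 + (body.compile D).length := by
      rw [execList_pc mem _ body.compile_isStraight]; simp [hc1', Config.assign, hc]
    have hjump : P[(execList mem (body.compile D) c1).pc]? =
        some (.jump (pre.compile D).length) := by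
      rw [hpc, hdecomp, ← List.append_assoc, List.getElem?_append_right (by simp; omega),
        show (pre.compile D).length + 1 + (body.compile D).length - (pre.compile D ++ [Instr.next
          (vreg D l) ((pre.compile D).length + (body.compile D).length + 2)] ++
          body.compile D).length = 0 by simp; omega]
      rfl
    rw [run_step mem _ hjump (by simp) (by simp)]
    have hin : (execList mem (body.compile D) c1).input = x := by
      rw [execList_input mem _ body.compile_isStraight, hc1']
    rw [ih _ (by simp [Instr.exec]) (by simp [Instr.exec, hin])]
    have hvars : (fun i => (Instr.exec mem (execList mem (body.compile D) c1)
        (.jump (pre.compile D).length)).reg (vreg D i)) = body.eval mem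
          (Function.update (fun i => c.reg (vreg D i)) l (BitVec.ofNat w a.val)) := by
      refine (body.compile_spec (D := D) mem hbody c1).trans ?_
      congr 1
      funext i
      rw [hc1']
      simp only [Config.assign]
      by_cases hi : i = l
      · subst hi; simp
      · rw [Function.update_of_ne hi, Function.update_of_ne (fun h => hi (vreg_injective D h))]
    rw [hvars, List.foldl_cons]

/-- Blocks yield a program that runs in linear time, with time and space bounds that depend on the
blocks only. -/
theorem exists_streamProgram {V : ℕ} (pre body fin : Block V) (l r : Fin V) :
    ∃ (k : ℕ) (P : Program k) (T : ℕ), ∀ (w σ : ℕ) (mem : List Bool) (x : List (Fin σ)) (p : Prop),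
      (fin.eval mem (x.foldl (fun ρ a => body.eval mem
        (Function.update ρ l (BitVec.ofNat w a.val))) (pre.eval mem fun _ => 0)) r ≠ 0 ↔ p) →
      DecidesWithin P w mem x (T * (x.length + 1)) p := by
  set D := pre.depth + body.depth + fin.depth with hD
  refine ⟨_, streamProgram D pre body fin l r,
    (pre.compile D).length + ((body.compile D).length + 2) + ((fin.compile D).length + 4),
    fun w σ mem x p hp => ⟨_, ?_, (bne_iff_ne).trans hp⟩⟩
  have hrun := run_straight mem
    (x.length * ((body.compile D).length + 2) + ((fin.compile D).length + 4))
    (pre.compile D) [] ([.next (vreg D l) ((pre.compile D).length + (body.compile D).length + 2)] ++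
      (body.compile D ++ ([.jump (pre.compile D).length] ++
        ((fin.compile D ++ [.const (treg V D 0) 0]) ++
          [.jumpEq (vreg D r) (treg V D 0) ((pre.compile D).length + (body.compile D).length + 2 +
            (fin.compile D).length + 3), .accept, .reject]))))
      pre.compile_isStraight (start w x) rfl
  rw [List.nil_append, ← streamProgram] at hrun
  rw [streamProgram_loop (pre := pre) (body := body) (fin := fin) (l := l) (r := r) mem
    (by omega) (by omega) x _ (by
    rw [execList_pc mem _ pre.compile_isStraight]; simp [start]) (by
    rw [execList_input mem _ pre.compile_isStraight]; rfl)] at hrun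
  rw [pre.compile_spec (D := D) mem (by omega)] at hrun
  have := run_mono hrun ((pre.compile D).length * x.length + ((body.compile D).length + 2) +
    ((fin.compile D).length + 4) * x.length)
  rw [← show x.length * ((body.compile D).length + 2) + ((fin.compile D).length + 4) +
    (pre.compile D).length + ((pre.compile D).length * x.length + ((body.compile D).length + 2) +
    ((fin.compile D).length + 4) * x.length) = ((pre.compile D).length +
    ((body.compile D).length + 2) + ((fin.compile D).length + 4)) * (x.length + 1) by ring]
  exact this

end WordRAM

namespace WordRAM

/-! ### Bit strings in the memory -/

/-- The number whose binary digits are the `l` bits of the memory from bit number `p` on. -/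
def readNat (mem : List Bool) (p l : ℕ) : ℕ :=
  ∑ i ∈ Finset.range l, if mem.getD (p + i) false then 2 ^ i else 0

theorem readNat_succ (mem : List Bool) (p l : ℕ) :
    readNat mem p (l + 1) = readNat mem p l + if mem.getD (p + l) false then 2 ^ l else 0 :=
  Finset.sum_range_succ _ _

theorem readNat_lt (mem : List Bool) (p l : ℕ) : readNat mem p l < 2 ^ l := by
  induction l with
  | zero => simp [readNat]
  | succ l ih => rw [readNat_succ, pow_succ]; split_ifs <;> omega

theorem readBits_toNat {w : ℕ} (mem : List Bool) (p l : ℕ) :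
    (readBits w mem p l).toNat = readNat mem p (min l w) := by
  rw [readBits, BitVec.toNat_ofNat]
  exact Nat.mod_eq_of_lt ((readNat_lt mem p (min l w)).trans_le
    (Nat.pow_le_pow_right (by norm_num) (min_le_right _ _)))

theorem testBit_readNat (mem : List Bool) (p l i : ℕ) (hi : i < l) :
    (readNat mem p l).testBit i = mem.getD (p + i) false := by
  induction l with
  | zero => omega
  | succ l ih =>
    rw [readNat_succ]
    have h := readNat_lt mem p l
    rcases Nat.lt_succ_iff_lt_or_eq.1 hi with hi | rfl
    · rw [← ih hi]
      split_ifs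
      · rw [add_comm, Nat.testBit_two_pow_add_gt hi]
      · simp
    · split_ifs with hm
      · rw [add_comm, Nat.testBit_two_pow_add_eq, Nat.testBit_lt_two_pow h, hm]; rfl
      · rw [add_zero, Nat.testBit_lt_two_pow h]; simpa using hm

/-- The `l` lowest binary digits of `v`, the least significant one first. -/
def toBits (l v : ℕ) : List Bool := (List.range l).map v.testBit

@[simp] theorem length_toBits (l v : ℕ) : (toBits l v).length = l := by simp [toBits]

theorem getD_toBits {l v i : ℕ} (hi : i < l) : (toBits l v).getD i false = v.testBit i := by
  simp [toBits, List.getD_eq_getElem?_getD, hi]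

/-- The bit string `bs` stands in the memory from bit number `p` on. -/
def At (mem : List Bool) (p : ℕ) (bs : List Bool) : Prop :=
  ∀ i < bs.length, mem.getD (p + i) false = bs.getD i false

theorem at_zero_self (mem : List Bool) : At mem 0 mem := fun i _ => by rw [zero_add]

theorem At.append_left {mem : List Bool} {p : ℕ} {as bs : List Bool} (h : At mem p (as ++ bs)) :
    At mem p as := by
  intro i hi
  rw [h i (by rw [List.length_append]; omega), List.getD_append _ _ _ _ hi]

theorem At.append_right {mem : List Bool} {p : ℕ} {as bs : List Bool} (h : At mem p (as ++ bs)) :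
    At mem (p + as.length) bs := by
  intro i hi
  have := h (as.length + i) (by rw [List.length_append]; omega)
  rw [← add_assoc] at this
  rw [this, List.getD_append_right _ _ _ _ (by omega)]
  congr 1
  omega

theorem At.readNat_eq {mem : List Bool} {p l v : ℕ} (h : At mem p (toBits l v))
    (hv : v < 2 ^ l) : readNat mem p l = v := by
  apply Nat.eq_of_testBit_eq
  intro i
  by_cases hi : i < l
  · rw [testBit_readNat _ _ _ _ hi, h i (by simpa using hi), getD_toBits hi]
  · have h2 : 2 ^ l ≤ 2 ^ i := Nat.pow_le_pow_right (by norm_num) (by omega)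
    rw [Nat.testBit_lt_two_pow ((readNat_lt mem p l).trans_le h2),
      Nat.testBit_lt_two_pow (hv.trans_le h2)]

/-- The concatenation of the bit strings `f 0, …, f (m - 1)`. -/
def cat (f : ℕ → List Bool) (m : ℕ) : List Bool := (List.range m).flatMap f

theorem cat_succ (f : ℕ → List Bool) (m : ℕ) : cat f (m + 1) = cat f m ++ f m := by
  simp [cat, List.range_succ]

@[simp] theorem cat_zero (f : ℕ → List Bool) : cat f 0 = [] := rfl

theorem length_cat (f : ℕ → List Bool) (m : ℕ) :
    (cat f m).length = ∑ i ∈ Finset.range m, (f i).length := by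
  induction m with
  | zero => rfl
  | succ m ih => rw [cat_succ, List.length_append, ih, Finset.sum_range_succ]

theorem At.cat {mem : List Bool} {p m i : ℕ} {f : ℕ → List Bool} (h : At mem p (cat f m))
    (hi : i < m) : At mem (p + (WordRAM.cat f i).length) (f i) := by
  induction m with
  | zero => omega
  | succ m ih =>
    rw [cat_succ] at h
    rcases Nat.lt_succ_iff_lt_or_eq.1 hi with hi | rfl
    · exact ih h.append_left hi
    · exact h.append_right

/-- The array of the numbers `f 0, …, f (m - 1)`, each of them in `l` bits. -/
def arr (l : ℕ) (f : ℕ → ℕ) (m : ℕ) : List Bool := cat (fun i => toBits l (f i)) m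

@[simp] theorem length_arr (l : ℕ) (f : ℕ → ℕ) (m : ℕ) : (arr l f m).length = m * l := by
  simp [arr, length_cat]

theorem At.arr_at {mem : List Bool} {p m i l : ℕ} {f : ℕ → ℕ} (h : At mem p (arr l f m))
    (hi : i < m) : At mem (p + i * l) (toBits l (f i)) := by
  have := At.cat h hi
  rwa [show (WordRAM.cat (fun i => toBits l (f i)) i).length = i * l from length_arr l f i] at this

theorem At.readNat_arr {mem : List Bool} {p m i l : ℕ} {f : ℕ → ℕ} (h : At mem p (arr l f m))
    (hi : i < m) (hv : f i < 2 ^ l) : readNat mem (p + i * l) l = f i :=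
  (h.arr_at hi).readNat_eq hv

/-- The bits of the memory from bit number `p` on, as a list. -/
def readList (mem : List Bool) (p l : ℕ) : List Bool :=
  (List.range l).map fun i => mem.getD (p + i) false

theorem toBits_readNat (mem : List Bool) (p l : ℕ) :
    toBits l (readNat mem p l) = readList mem p l := by
  simp only [toBits, readList]
  exact List.map_congr_left fun i hi => testBit_readNat _ _ _ _ (List.mem_range.1 hi)

theorem readList_add (mem : List Bool) (p l m : ℕ) :
    readList mem p (l + m) = readList mem p l ++ readList mem (p + l) m := by
  simp only [readList, List.range_add, List.map_append, List.map_map]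
  congr 1
  exact List.map_congr_left fun i _ => by simp [add_assoc]

theorem At.readList_eq {mem : List Bool} {p : ℕ} {bs : List Bool} (h : At mem p bs) :
    readList mem p bs.length = bs := by
  apply List.ext_getElem
  · simp [readList]
  · intro i h1 h2
    have := h i h2
    rw [List.getD_eq_getElem _ _ h2] at this
    simpa [readList] using this

/-! ### Unary codes of monotone sequences -/

/-- The number of zeros before the `j`-th one of a bit string (`j` counts from 1); the number of all
zeros if there are fewer ones. -/
def zerosBefore : List Bool → ℕ → ℕ
  | [], _ => 0
  | _ :: _, 0 => 0
  | true :: bs, j + 1 => zerosBefore bs j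
  | false :: bs, j + 1 => zerosBefore bs (j + 1) + 1

@[simp] theorem zerosBefore_zero (bs : List Bool) : zerosBefore bs 0 = 0 := by
  cases bs <;> rfl

theorem zerosBefore_le (bs : List Bool) (j : ℕ) : zerosBefore bs j ≤ bs.length := by
  induction bs generalizing j with
  | nil => simp [zerosBefore]
  | cons b bs ih =>
    cases j with
    | zero => simp
    | succ j =>
      cases b
      · simpa [zerosBefore] using ih (j + 1)
      · simpa [zerosBefore] using (ih j).trans (Nat.le_succ _)

theorem zerosBefore_append (as bs : List Bool) (j : ℕ) :
    zerosBefore (as ++ bs) j = zerosBefore as j + zerosBefore bs (j - as.count true) := by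
  induction as generalizing j with
  | nil => simp [zerosBefore]
  | cons a as ih =>
    cases j with
    | zero => simp
    | succ j =>
      cases a
      · simp only [List.cons_append, zerosBefore, ih, List.count_cons]
        simp; ring
      · simp only [List.cons_append, zerosBefore, ih, List.count_cons]
        simp

/-- The unary code of the monotone sequence `h 0 ≤ h 1 ≤ …`: each term is a one that has as many
zeros before it as the term says. -/
def unary (h : ℕ → ℕ) (m : ℕ) : List Bool :=
  cat (fun i => List.replicate (h i - if i = 0 then 0 else h (i - 1)) false ++ [true]) m

theorem unary_succ (h : ℕ → ℕ) (m : ℕ) : unary h (m + 1) =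
    unary h m ++ (List.replicate (h m - if m = 0 then 0 else h (m - 1)) false ++ [true]) :=
  cat_succ _ _

theorem count_unary (h : ℕ → ℕ) (m : ℕ) : (unary h m).count true = m := by
  induction m with
  | zero => rfl
  | succ m ih => rw [unary_succ]; simp [ih, List.count_replicate]

theorem zerosBefore_replicate (m j : ℕ) :
    zerosBefore (List.replicate m false ++ [true]) (j + 1) = m := by
  induction m with
  | zero => simp [zerosBefore]
  | succ m ih => simp [List.replicate_succ, zerosBefore, ih]

theorem zerosBefore_unary_of_le {h : ℕ → ℕ} (hh : Monotone h) (m j : ℕ) (hj : m ≤ j) :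
    zerosBefore (unary h m) j = if m = 0 then 0 else h (m - 1) := by
  induction m with
  | zero => simp [unary, zerosBefore]
  | succ m ih =>
    rw [unary_succ, zerosBefore_append, ih (by omega), count_unary,
      show j - m = (j - m - 1) + 1 by omega, zerosBefore_replicate]
    have := hh (Nat.sub_le m 1)
    rcases Nat.eq_zero_or_pos m with rfl | hm
    · simp
    · simp only [hm.ne', if_false, Nat.add_sub_cancel, Nat.succ_ne_zero]
      omega

theorem zerosBefore_unary {h : ℕ → ℕ} (hh : Monotone h) (m k : ℕ) (hk : k < m) :
    zerosBefore (unary h m) (k + 1) = h k := by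
  induction m with
  | zero => omega
  | succ m ih =>
    rcases Nat.lt_succ_iff_lt_or_eq.1 hk with hk | rfl
    · rw [unary_succ, zerosBefore_append, ih hk, count_unary,
        show k + 1 - m = 0 by omega, zerosBefore_zero, add_zero]
    · rw [zerosBefore_unary_of_le hh _ _ le_rfl]; simp

theorem length_unary {h : ℕ → ℕ} (hh : Monotone h) (m : ℕ) :
    (unary h (m + 1)).length = h m + (m + 1) := by
  induction m with
  | zero => simp [unary, cat]
  | succ m ih =>
    rw [unary_succ, List.length_append, ih]
    have : h m ≤ h (m + 1) := hh (Nat.le_succ m)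
    simp
    omega

/-! ### Values of expressions as natural numbers -/

instance {V : ℕ} : Add (Expr V) := ⟨.op .add⟩
instance {V : ℕ} : Sub (Expr V) := ⟨.op .sub⟩
instance {V : ℕ} : Mul (Expr V) := ⟨.op .mul⟩
instance {V : ℕ} : Div (Expr V) := ⟨.op .div⟩
instance {V : ℕ} : Mod (Expr V) := ⟨.op .mod⟩

/-- The expression `e` has the value `x`, and `x` has at most `a * L` bits. As long as `a ≤ 100` and
`100 * L ≤ w`, operations on such expressions do not overflow. -/
structure HasVal {V w : ℕ} (L : ℕ) (mem : List Bool) (ρ : Fin V → BitVec w) (e : Expr V)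
    (x a : ℕ) : Prop where
  toNat_eq : (e.eval mem ρ).toNat = x
  lt : x < 2 ^ (a * L)

namespace HasVal

variable {V w L : ℕ} {mem : List Bool} {ρ : Fin V → BitVec w} {e f : Expr V} {x y a b : ℕ}

theorem mono (h : HasVal L mem ρ e x a) (hab : a ≤ b) : HasVal L mem ρ e x b :=
  ⟨h.1, h.2.trans_le (Nat.pow_le_pow_right (by norm_num) (Nat.mul_le_mul_right L hab))⟩

theorem var {i : Fin V} (h : (ρ i).toNat = x) (hx : x < 2 ^ (a * L)) :
    HasVal L mem ρ (.var i) x a := ⟨h, hx⟩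

theorem lit (hL : 1 ≤ L) (hw : 100 * L ≤ w) (ha : a ≤ 100) (hx : x < 2 ^ a) :
    HasVal L mem ρ (.lit x) x a := by
  have h1 : x < 2 ^ (a * L) :=
    hx.trans_le (Nat.pow_le_pow_right (by norm_num) (Nat.le_mul_of_pos_right a hL))
  refine ⟨?_, h1⟩
  rw [Expr.eval, BitVec.toNat_ofNat, Nat.mod_eq_of_lt]
  exact h1.trans_le (Nat.pow_le_pow_right (by norm_num) ((Nat.mul_le_mul_right L ha).trans hw))

theorem add (hL : 1 ≤ L) (hw : 100 * L ≤ w) (he : HasVal L mem ρ e x a)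
    (hf : HasVal L mem ρ f y b) (hab : max a b + 1 ≤ 100) :
    HasVal L mem ρ (e + f) (x + y) (max a b + 1) := by
  have h1 := (he.mono (le_max_left a b)).2
  have h2 := (hf.mono (le_max_right a b)).2
  have h3 : x + y < 2 ^ ((max a b + 1) * L) := by
    calc x + y < 2 ^ (max a b * L + 1) := by rw [pow_succ]; omega
      _ ≤ _ := Nat.pow_le_pow_right (by norm_num) (by rw [add_mul]; omega)
  refine ⟨?_, h3⟩
  change (e.eval mem ρ + f.eval mem ρ).toNat = _
  rw [BitVec.toNat_add, he.1, hf.1, Nat.mod_eq_of_lt]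
  exact h3.trans_le (Nat.pow_le_pow_right (by norm_num) ((Nat.mul_le_mul_right L hab).trans hw))

theorem sub (he : HasVal L mem ρ e x a) (hf : HasVal L mem ρ f y b) (hyx : y ≤ x) :
    HasVal L mem ρ (e - f) (x - y) a := by
  refine ⟨?_, (Nat.sub_le x y).trans_lt he.2⟩
  change (e.eval mem ρ - f.eval mem ρ).toNat = _
  rw [BitVec.toNat_sub_of_le, he.1, hf.1]
  rw [BitVec.le_def, he.1, hf.1]
  exact hyx

theorem mul (hw : 100 * L ≤ w) (he : HasVal L mem ρ e x a)
    (hf : HasVal L mem ρ f y b) (hab : a + b ≤ 100) :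
    HasVal L mem ρ (e * f) (x * y) (a + b) := by
  have h3 : x * y < 2 ^ ((a + b) * L) := by
    rw [add_mul, pow_add]
    exact Nat.mul_lt_mul'' he.2 hf.2
  refine ⟨?_, h3⟩
  change (e.eval mem ρ * f.eval mem ρ).toNat = _
  rw [BitVec.toNat_mul, he.1, hf.1, Nat.mod_eq_of_lt]
  exact h3.trans_le (Nat.pow_le_pow_right (by norm_num) ((Nat.mul_le_mul_right L hab).trans hw))

/-- A product with zero is zero, whatever the other factor is; it selects one of two results
without a jump. -/
theorem zero_mul (he : HasVal L mem ρ e 0 a) (f : Expr V) : HasVal L mem ρ (e * f) 0 0 := by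
  refine ⟨?_, by positivity⟩
  change (e.eval mem ρ * f.eval mem ρ).toNat = _
  rw [BitVec.toNat_mul, he.1, Nat.zero_mul, Nat.zero_mod]

theorem div (he : HasVal L mem ρ e x a) (hf : HasVal L mem ρ f y b) :
    HasVal L mem ρ (e / f) (x / y) a := by
  refine ⟨?_, (Nat.div_le_self x y).trans_lt he.2⟩
  change ((e.eval mem ρ).udiv (f.eval mem ρ)).toNat = _
  rw [BitVec.udiv_eq, BitVec.toNat_udiv, he.1, hf.1]

theorem mod (he : HasVal L mem ρ e x a) (hf : HasVal L mem ρ f y b) :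
    HasVal L mem ρ (e % f) (x % y) a := by
  refine ⟨?_, (Nat.mod_le x y).trans_lt he.2⟩
  change ((e.eval mem ρ).umod (f.eval mem ρ)).toNat = _
  rw [BitVec.umod_eq, BitVec.toNat_umod, he.1, hf.1]

theorem shl (hw : 100 * L ≤ w) (he : HasVal L mem ρ e x a) (hf : HasVal L mem ρ f y b) {c : ℕ}
    (hy : y ≤ c * L) (hac : a + c ≤ 100) :
    HasVal L mem ρ (.op .shl e f) (x * 2 ^ y) (a + c) := by
  have h3 : x * 2 ^ y < 2 ^ ((a + c) * L) := by
    rw [add_mul, pow_add]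
    exact Nat.mul_lt_mul_of_lt_of_le he.2 (Nat.pow_le_pow_right (by norm_num) hy)
      (by positivity)
  refine ⟨?_, h3⟩
  change (e.eval mem ρ <<< (f.eval mem ρ).toNat).toNat = _
  rw [BitVec.toNat_shiftLeft, he.1, hf.1, Nat.shiftLeft_eq, Nat.mod_eq_of_lt]
  exact h3.trans_le (Nat.pow_le_pow_right (by norm_num) ((Nat.mul_le_mul_right L hac).trans hw))

theorem load (hw : 100 * L ≤ w) (he : HasVal L mem ρ e x a) (hf : HasVal L mem ρ f y b) {c : ℕ}
    (hy : y ≤ c * L) (hc : c ≤ 100) :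
    HasVal L mem ρ (.load e f) (readNat mem x y) c := by
  refine ⟨?_, (readNat_lt _ _ _).trans_le (Nat.pow_le_pow_right (by norm_num) hy)⟩
  rw [Expr.eval, readBits_toNat, he.1, hf.1, min_eq_left]
  exact hy.trans ((Nat.mul_le_mul_right L hc).trans hw)

theorem congr (h : HasVal L mem ρ e x a) (hxy : x = y) : HasVal L mem ρ e y a := hxy ▸ h

end HasVal

/-- An expression that is `1` if `e < f`, and `0` otherwise: the inner quotient is zero if and only
if `e < f`. -/
def Expr.lt {V : ℕ} (e f : Expr V) : Expr V := .lit 1 / ((e + .lit 1) / (f + .lit 1) + .lit 1)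

theorem HasVal.ltExpr {V w L : ℕ} {mem : List Bool} {ρ : Fin V → BitVec w} {e f : Expr V}
    {x y a b : ℕ} (hL : 1 ≤ L) (hw : 100 * L ≤ w) (he : HasVal L mem ρ e x a)
    (hf : HasVal L mem ρ f y b) (ha : max a 1 + 2 ≤ 100) (hb : max b 1 + 1 ≤ 100) :
    HasVal L mem ρ (e.lt f) (if x < y then 1 else 0) 1 := by
  have one : HasVal L mem ρ (.lit 1) 1 1 := .lit hL hw (by norm_num) (by norm_num)
  have h1 := (HasVal.add hL hw he one (by omega)).div (HasVal.add hL hw hf one (by omega))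
  have h2 := one.div (HasVal.add hL hw h1 one (by omega))
  refine h2.congr ?_
  split_ifs with h
  · rw [Nat.div_eq_of_lt (show x + 1 < y + 1 by omega)]
  · have : 0 < (x + 1) / (y + 1) := Nat.div_pos (by omega) (by omega)
    exact Nat.div_eq_of_lt (by omega)

end WordRAM

/-! ### Acyclic automata -/

namespace DFA

section Acyclic

variable {α Q : Type*} {A : DFA α Q} {d : Q}

theorem evalFrom_replicate (A : DFA α Q) (a : α) (k : ℕ) (q : Q) :
    A.evalFrom q (List.replicate k a) = (fun p => A.step p a)^[k] q := by
  induction k generalizing q with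
  | zero => rfl
  | succ k ih => simpa [List.replicate_succ, DFA.evalFrom] using ih (A.step q a)

theorem isRecurrent_of_iterate {a : α} {k : ℕ} {q : Q}
    (h : (fun p => A.step p a)^[k + 1] q = q) : A.IsRecurrent q :=
  ⟨List.replicate (k + 1) a, by simp, by rw [evalFrom_replicate]; exact h⟩

variable [Finite Q]

theorem exists_iterate_isRecurrent (A : DFA α Q) (a : α) (q : Q) :
    ∃ j, A.IsRecurrent ((fun p => A.step p a)^[j] q) := by
  obtain ⟨i, j, hne, hij⟩ := Finite.exists_ne_map_eq_of_infinite
    (fun j : ℕ => (fun p => A.step p a)^[j] q)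
  wlog hlt : i < j generalizing i j
  · exact this j i hne.symm hij.symm (by omega)
  refine ⟨i, isRecurrent_of_iterate (a := a) (k := j - i - 1) ?_⟩
  rw [← Function.iterate_add_apply, show j - i - 1 + 1 + i = j by omega]
  exact hij.symm

theorem exists_iterate_eq_dead (hd : ∀ q, A.IsRecurrent q ↔ q = d) (a : α) (q : Q) :
    ∃ j, (fun p => A.step p a)^[j] q = d :=
  (exists_iterate_isRecurrent A a q).imp fun _ h => (hd _).1 h

theorem step_dead (hd : ∀ q, A.IsRecurrent q ↔ q = d) (a : α) : A.step d a = d := by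
  obtain ⟨j, hj⟩ := exists_iterate_eq_dead hd a (A.step d a)
  refine (hd _).1 (isRecurrent_of_iterate (a := a) (k := j) ?_)
  rw [Function.iterate_succ_apply', hj]

theorem letterGraph_isTree (hd : ∀ q, A.IsRecurrent q ↔ q = d) (a : α) :
    (A.letterGraph a).IsTree := by
  classical
  have := Fintype.ofFinite Q
  have hadj : ∀ p, p ≠ A.step p a → (A.letterGraph a).Adj p (A.step p a) := fun p hp => by
    simp [letterGraph, hp]
  have hreach : ∀ (j : ℕ) (q : Q),
      (A.letterGraph a).Reachable q ((fun p => A.step p a)^[j] q) := by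
    intro j
    induction j with
    | zero => exact fun q => .rfl
    | succ j ih =>
      intro q
      rw [Function.iterate_succ_apply]
      refine SimpleGraph.Reachable.trans ?_ (ih _)
      by_cases hq : q = A.step q a
      · rw [← hq]
      · exact (hadj q hq).reachable
  have hd' : ∀ q, (A.letterGraph a).Reachable q d := fun q => by
    obtain ⟨j, hj⟩ := exists_iterate_eq_dead hd a q
    exact hj ▸ hreach j q
  have hconn : (A.letterGraph a).Connected :=
    { preconnected := fun p q => (hd' p).trans (hd' q).symm, nonempty := ⟨d⟩ }
  rw [SimpleGraph.isTree_iff_connected_and_card]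
  refine ⟨hconn, le_antisymm ?_ hconn.card_vert_le_card_edgeSet_add_one⟩
  -- every edge joins some `q ≠ d` with its successor
  have hsub : (A.letterGraph a).edgeSet ⊆ (fun q => s(q, A.step q a)) '' {q | q ≠ d} := by
    intro e
    induction e with | _ p q =>
    simp only [letterGraph, SimpleGraph.mem_edgeSet, SimpleGraph.fromRel_adj]
    rintro ⟨hne, h | h⟩
    · refine ⟨p, ?_, by simp [h]⟩
      rintro rfl
      exact hne (h ▸ (step_dead hd a).symm)
    · refine ⟨q, ?_, by simp [h, Sym2.eq_swap]⟩
      rintro rfl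
      exact hne (h ▸ (step_dead hd a))
  have h1 : Nat.card (A.letterGraph a).edgeSet ≤ Set.ncard {q : Q | q ≠ d} := by
    rw [Nat.card_coe_set_eq]
    exact (Set.ncard_le_ncard hsub (Set.toFinite _)).trans (Set.ncard_image_le (Set.toFinite _))
  have h2 : Set.ncard {q : Q | q ≠ d} + 1 = Nat.card Q := by
    rw [show {q : Q | q ≠ d} = {d}ᶜ from rfl, ← Set.ncard_add_ncard_compl {d}, Set.ncard_singleton,
      add_comm]
  omega

/-- In an acyclic automaton, the transitions out of the states other than the dead one are
well-founded. -/
theorem wellFounded_step (hd : ∀ q, A.IsRecurrent q ↔ q = d) :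
    WellFounded fun p q => q ≠ d ∧ ∃ a, A.step q a = p := by
  set r : Q → Q → Prop := fun p q => q ≠ d ∧ ∃ a, A.step q a = p
  have hx : ∀ p q, Relation.TransGen r p q → q ≠ d ∧ ∃ x, x ≠ [] ∧ A.evalFrom q x = p := by
    intro p q h
    induction h with
    | single h => obtain ⟨h1, a, h2⟩ := h; exact ⟨h1, [a], by simp, h2⟩
    | tail _ h ih =>
      obtain ⟨h1, a, h2⟩ := h
      obtain ⟨-, x, -, h3⟩ := ih
      exact ⟨h1, a :: x, by simp, by rw [← h3, ← h2]; rfl⟩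
  have : Std.Irrefl (Relation.TransGen r) := ⟨fun q hq => by
    obtain ⟨h1, x, h2, h3⟩ := hx q q hq
    exact h1 ((hd q).1 ⟨x, h2, h3⟩)⟩
  exact Subrelation.wf (fun h => Relation.TransGen.single h)
    (Finite.wellFounded_of_trans_of_irrefl (Relation.TransGen r))

end Acyclic

/-- The height of a state is the length of the longest path to the dead state; a state other than
the dead one has a successor whose height is less by one. -/
theorem exists_height {α Q : Type*} [Fintype α] [Nonempty α] [Finite Q] {A : DFA α Q} {d : Q}
    (hd : ∀ q, A.IsRecurrent q ↔ q = d) :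
    ∃ (h : Q → ℕ) (fl : Q → α), h d = 0 ∧ (∀ q, q ≠ d → ∀ a, h (A.step q a) < h q) ∧
      ∀ q, q ≠ d → h q = h (A.step q (fl q)) + 1 := by
  classical
  have wf := wellFounded_step hd
  set F : (q : Q) → ((p : Q) → (q ≠ d ∧ ∃ a, A.step q a = p) → ℕ) → ℕ := fun q ih =>
    if hq : q = d then 0 else
      (Finset.univ.sup fun a => ih (A.step q a) ⟨hq, a, rfl⟩) + 1 with hF
  set h : Q → ℕ := wf.fix F with hh
  have heq : ∀ q, q ≠ d → h q = (Finset.univ.sup fun a => h (A.step q a)) + 1 := fun q hq => by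
    rw [hh, wf.fix_eq]; simp [hF, hq]
  have hsucc : ∀ q, ∃ a, q ≠ d → h q = h (A.step q a) + 1 := by
    intro q
    obtain ⟨a, -, ha⟩ := Finset.exists_mem_eq_sup (Finset.univ : Finset α)
      Finset.univ_nonempty (fun a => h (A.step q a))
    exact ⟨a, fun hq => by rw [heq q hq, ha]⟩
  choose fl hfl using hsucc
  refine ⟨h, fl, by rw [hh, wf.fix_eq]; simp [hF], fun q hq a => ?_, hfl⟩
  rw [heq q hq, Nat.lt_succ_iff]
  exact Finset.le_sup (f := fun a => h (A.step q a)) (Finset.mem_univ a)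

/-- A numbering of the states of an acyclic automaton that decreases along all transitions and for
which the transitions on suitable letters `fl q` are monotone. The key of a state `q` is the string
of the states on the path of the letters `fl`, read as a number in base `n`, so that the keys of
states of greater height are greater, and the key of the next state on the path is obtained by
dropping the last digit. -/
theorem exists_key {α : Type*} [Fintype α] [Nonempty α] {n : ℕ} {A : DFA α (Fin n)} {d : Fin n}
    (hd : ∀ q, A.IsRecurrent q ↔ q = d) :
    ∃ (v : Fin n → ℕ) (fl : Fin n → α), Function.Injective v ∧ (∀ q, q ≠ d → v d < v q) ∧
      (∀ q, q ≠ d → ∀ a, v (A.step q a) < v q) ∧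
      ∀ p q, v p ≤ v q → v (A.step p (fl p)) ≤ v (A.step q (fl q)) := by
  classical
  obtain ⟨h, fl, h0, hlt, hfl⟩ := exists_height hd
  have wf := wellFounded_step hd
  set F : (q : Fin n) → ((p : Fin n) → (q ≠ d ∧ ∃ a, A.step q a = p) → ℕ) → ℕ := fun q ih =>
    if hq : q = d then 1 else n * ih (A.step q (fl q)) ⟨hq, _, rfl⟩ + q.val with hF
  set v : Fin n → ℕ := wf.fix F with hv
  have vd : v d = 1 := by rw [hv, wf.fix_eq]; simp [hF]
  have vq : ∀ q, q ≠ d → v q = n * v (A.step q (fl q)) + q.val := fun q hq => by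
    rw [hv, wf.fix_eq]; simp [hF, hq]
  have hn : 0 < n := d.pos
  -- the keys of the states of height `h` lie between `n ^ h` and `2 * n ^ h - 1`
  have bounds : ∀ q, n ^ h q ≤ v q ∧ v q + 1 ≤ 2 * n ^ h q := by
    intro q
    induction q using wf.induction with | _ q ih =>
    by_cases hq : q = d
    · rw [hq, h0, vd]; simp
    · obtain ⟨i1, i2⟩ := ih _ ⟨hq, fl q, rfl⟩
      rw [vq q hq, hfl q hq, pow_succ]
      have hqn := q.isLt
      constructor <;> nlinarith
  have hstep : ∀ q a, q ≠ d → v (A.step q a) < v q := by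
    intro q a hq
    have hn2 : 2 ≤ n := by
      have h1 := q.isLt
      have h2 := d.isLt
      have h3 : q.val ≠ d.val := fun h => hq (Fin.ext h)
      omega
    calc v (A.step q a) < 2 * n ^ h (A.step q a) := (bounds _).2
      _ ≤ n ^ (h (A.step q a) + 1) := by rw [pow_succ]; nlinarith [pow_pos hn (h (A.step q a))]
      _ ≤ n ^ h q := Nat.pow_le_pow_right hn (hlt q hq a)
      _ ≤ v q := (bounds q).1
  have hpos : ∀ q, 1 ≤ v q := fun q => (Nat.one_le_pow _ _ hn).trans (bounds q).1
  have hdlt : ∀ q, q ≠ d → v d < v q := by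
    intro q hq
    have h1 := hstep q (fl q) hq
    have := hpos (A.step q (fl q))
    omega
  refine ⟨v, fl, ?_, hdlt, fun q hq a => hstep q a hq, ?_⟩
  · intro p q hpq
    by_cases hp : p = d
    · by_contra hne
      exact absurd hpq (hp ▸ (hdlt q fun h => hne (hp.trans h.symm)).ne)
    by_cases hq : q = d
    · exact absurd hpq (hq ▸ (hdlt p hp).ne')
    rw [vq p hp, vq q hq] at hpq
    have := congrArg (· % n) hpq
    simp only [Nat.mul_add_mod, Nat.mod_eq_of_lt p.isLt, Nat.mod_eq_of_lt q.isLt] at this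
    exact Fin.ext this
  · intro p q hpq
    by_cases hp : p = d
    · rw [hp, step_dead hd, vd]; exact hpos _
    by_cases hq : q = d
    · exact absurd hpq (not_le.2 (hq ▸ hdlt p hp))
    rw [vq p hp, vq q hq] at hpq
    have := Nat.div_le_div_right (c := n) hpq
    simpa [Nat.mul_add_div hn, Nat.div_eq_of_lt p.isLt, Nat.div_eq_of_lt q.isLt] using this

/-- The states of `A` are numbered so that the dead state is `0`, all transitions out of other
states decrease, and the transitions on the letters `fl i` are monotone. -/
structure IsSorted {σ n : ℕ} (A : DFA (Fin σ) (Fin n)) (fl : Fin n → Fin σ) : Prop where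
  step_zero : ∀ i : Fin n, i.val = 0 → ∀ a, A.step i a = i
  step_lt : ∀ i : Fin n, 0 < i.val → ∀ a, A.step i a < i
  monotone : Monotone fun i => A.step i (fl i)

theorem exists_isSorted {σ n : ℕ} {A : DFA (Fin σ) (Fin n)} (hA : A.IsAcyclic) :
    ∃ (e : Fin n ≃ Fin n) (fl : Fin n → Fin σ), (DFA.reindex e A).IsSorted fl := by
  obtain ⟨d, hd1, hd2⟩ := hA
  have hd : ∀ q, A.IsRecurrent q ↔ q = d := fun q => ⟨hd2 q, fun h => h ▸ hd1⟩
  have : Nonempty (Fin σ) := by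
    obtain ⟨x, hx, -⟩ := hd1
    cases x with
    | nil => exact absurd rfl hx
    | cons a _ => exact ⟨a⟩
  obtain ⟨v, fl, hinj, hdlt, hstep, hmono⟩ := exists_key hd
  set s := Tuple.sort v with hs
  have hsm : StrictMono (v ∘ s) :=
    (Tuple.monotone_sort v).strictMono_of_injective (hinj.comp s.injective)
  have hlt : ∀ p q, v p < v q → s.symm p < s.symm q := fun p q h => by
    rw [← hsm.lt_iff_lt]; simpa using h
  have hle : ∀ p q, v p ≤ v q → s.symm p ≤ s.symm q := fun p q h => by
    rw [← hsm.le_iff_le]; simpa using h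
  have hzero : ∀ i : Fin n, s i = d ↔ i.val = 0 := by
    have hd0 : (s.symm d).val = 0 := by
      by_contra h
      have h0 := hlt d (s ⟨0, d.pos⟩) (hdlt _ fun h' => h (by
        have := congrArg s.symm h'
        rw [Equiv.symm_apply_apply] at this
        rw [← this]))
      rw [Equiv.symm_apply_apply] at h0
      exact absurd h0 (by simp [Fin.lt_def])
    intro i
    rw [← Equiv.eq_symm_apply, Fin.ext_iff, hd0]
  refine ⟨s.symm, fun i => fl (s i), fun i hi a => ?_, fun i hi a => ?_, fun i j hij => ?_⟩
  · have := (hzero i).2 hi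
    simp only [DFA.reindex_apply_step, Equiv.symm_symm]
    rw [this, step_dead hd, ← this, Equiv.symm_apply_apply]
  · have h1 : s i ≠ d := fun h => hi.ne' ((hzero i).1 h)
    have h2 := hlt _ _ (hstep (s i) h1 a)
    simpa using h2
  · have h2 := hle _ _ (hmono (s i) (s j) (hsm.monotone hij))
    simpa using h2

theorem IsInitiallyConnected.reindex {α Q R : Type*} {A : DFA α Q} (h : A.IsInitiallyConnected)
    (e : Q ≃ R) : (DFA.reindex e A).IsInitiallyConnected := by
  intro r
  obtain ⟨x, hx⟩ := h (e.symm r)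
  exact ⟨x, by rw [DFA.eval_reindex, hx, Equiv.apply_symm_apply]⟩

/-- With a single letter, a sorted automaton is a path. -/
theorem IsSorted.step_eq_pred {n : ℕ} {A : DFA (Fin 1) (Fin n)} {fl : Fin n → Fin 1}
    (h : A.IsSorted fl) (hA : A.IsInitiallyConnected) (i : Fin n) (a : Fin 1) :
    (A.step i a).val = i.val - 1 := by
  rcases Nat.eq_zero_or_pos i.val with h0 | h0
  · rw [h.step_zero i h0, h0]
  have hlt := h.step_lt i h0 a
  have hle : ∀ (k : ℕ) (j : Fin n), ((fun q => A.step q a)^[k] j).val ≤ j.val := by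
    intro k
    induction k with
    | zero => exact fun j => le_rfl
    | succ k ih =>
      intro j
      rw [Function.iterate_succ_apply]
      refine (ih _).trans ?_
      rcases Nat.eq_zero_or_pos j.val with hj | hj
      · rw [h.step_zero j hj]
      · exact (h.step_lt j hj a).le
  have hreach : ∀ q, ∃ k, (fun q => A.step q a)^[k] A.start = q := fun q => by
    obtain ⟨x, hx⟩ := hA q
    refine ⟨x.length, ?_⟩
    rw [← evalFrom_replicate, ← hx]
    congr 1
    exact (List.eq_replicate_iff.2 ⟨rfl, fun b _ => Subsingleton.elim b a⟩).symm
  obtain ⟨k, hk⟩ := hreach i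
  obtain ⟨m, hm⟩ := hreach ⟨i.val - 1, by omega⟩
  -- the states on the path decrease, hence `i - 1` comes after `i`
  have hkm : k < m := by
    by_contra hmk
    have h1 := hle (k - m) ⟨i.val - 1, by omega⟩
    rw [← hm, ← Function.iterate_add_apply, Nat.sub_add_cancel (by omega), hk, hm] at h1
    simp only at h1
    omega
  have h2 := hle (m - k - 1) (A.step i a)
  have h3 : (fun q => A.step q a)^[m - k - 1] (A.step i a) = ⟨i.val - 1, by omega⟩ := by
    rw [← hm, ← hk, show m = m - k - 1 + 1 + k by omega, Function.iterate_add_apply,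
      Function.iterate_succ_apply, Nat.add_sub_cancel]
    congr 2
    omega
  rw [h3] at h2
  simp only at h2
  have h4 : (A.step i a).val < i.val := hlt
  omega

end DFA

/-! ### The code of a sorted automaton -/

/-- The transition tables of a sorted automaton with `n` states and `sg + 1` letters, and the
parameters of its code. The transition from state `i` on the letter `fl i` goes to `c i`; the
transitions on the other letters, numbered by `b < sg`, go to `ent i b`. The rows of the states are
treated in blocks of `R`; `s` is the number of bits that are looked up in a table at once, and `L`
is the number of bits of an address. -/
structure Code where
  n : ℕ
  sg : ℕ
  start : ℕ
  acc : ℕ → Bool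
  fl : ℕ → ℕ
  c : ℕ → ℕ
  ent : ℕ → ℕ → ℕ
  R : ℕ
  s : ℕ
  L : ℕ

namespace Code

open WordRAM

variable (C : Code)

/-- The number of bits of a letter. -/
def phi : ℕ := Nat.size C.sg

/-- The number of blocks. -/
def nb : ℕ := (C.n + C.R - 1) / C.R

/-- The increase of `c` over the block `J`. -/
def incr (J : ℕ) : ℕ := C.c (J * C.R + C.R - 1) - C.c (J * C.R)

/-- The number of low bits of the values of `c` in the block `J` that are stored separately. It is
chosen so that the high parts increase by at most `2 * R` over the block. -/
def lowBits (J : ℕ) : ℕ := Nat.log 2 (C.incr J / C.R)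

/-- The high part of the `k`-th value of `c` in the block `J`, relative to the first value. -/
def high (J k : ℕ) : ℕ := (C.c (J * C.R + k) - C.c (J * C.R)) / 2 ^ C.lowBits J

/-- The low part of the `k`-th value of `c` in the block `J`, relative to the first value. -/
def low (J k : ℕ) : ℕ := (C.c (J * C.R + k) - C.c (J * C.R)) % 2 ^ C.lowBits J

/-- A strict bound on the targets of the transitions in the block `J`, whose last row has the number
`J * R + R - 1`; the targets of row `i` are less than `max 1 i`. -/
def X (J : ℕ) : ℕ := max 1 (J * C.R + C.R - 1)

/-- The number of bits of four targets in the block `J`. -/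
def W (J : ℕ) : ℕ := Nat.clog 2 (C.X J ^ 4)

/-- The `e`-th target in the block `J`. -/
def digit (J e : ℕ) : ℕ := if e < C.R * C.sg then C.ent (J * C.R + e / C.sg) (e % C.sg) else 0

/-- Four consecutive targets in the block `J`, as the digits of a number in base `X J`. -/
def pack (J g : ℕ) : ℕ :=
  C.digit J (4 * g) + C.X J * (C.digit J (4 * g + 1) + C.X J * (C.digit J (4 * g + 2) +
    C.X J * C.digit J (4 * g + 3)))

/-- The number of packs of four targets in a block. -/
def groups : ℕ := (C.R * C.sg + 3) / 4

/-- The code of the block `J`. -/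
def block (J : ℕ) : List Bool :=
  unary (C.high J) C.R ++ arr (C.lowBits J) (C.low J) C.R ++ arr (C.W J) (C.pack J) C.groups

/-- The number of bits of an entry of the lookup table. -/
def wt : ℕ := Nat.size (C.R + C.s)

/-- The lookup table: for each string `u` of `s` bits and each `j ≤ R`, the number of ones that
remain to be found after `u` if the `j`-th one is sought, and the number of zeros before it. -/
def table (m : ℕ) : ℕ :=
  if m % 2 = 0 then m / 2 % (C.R + 1) - (toBits C.s (m / 2 / (C.R + 1))).count true
  else zerosBefore (toBits C.s (m / 2 / (C.R + 1))) (m / 2 % (C.R + 1))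

/-- The address of the accepting bits. -/
def aAcc : ℕ := C.L + 1 + 12 * C.L

/-- The address of the letters `fl`. -/
def aFl : ℕ := C.aAcc + C.n

/-- The address of the directory. -/
def aDir : ℕ := C.aFl + C.n * C.phi

/-- The address of the lookup table. -/
def aTab : ℕ := C.aDir + C.nb * 7 * C.L

/-- The address of the blocks. -/
def aBody : ℕ := C.aTab + 2 ^ C.s * (C.R + 1) * 2 * C.wt

/-- The address of the block `J`. -/
def aBlock (J : ℕ) : ℕ := C.aBody + (cat C.block J).length

/-- The entries of the directory for the block `J`: the address of the block, the first value of
`c`, the number of low bits, the address of the low parts, the base and the number of bits of a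
pack, and the address of the packs. -/
def record (J m : ℕ) : ℕ :=
  match m with
  | 0 => C.aBlock J
  | 1 => C.c (J * C.R)
  | 2 => C.lowBits J
  | 3 => C.aBlock J + (unary (C.high J) C.R).length
  | 4 => C.X J
  | 5 => C.W J
  | _ => C.aBlock J + (unary (C.high J) C.R).length + C.R * C.lowBits J

/-- The entries of the header; entry `1` tells whether there is more than one letter. -/
def header (m : ℕ) : ℕ :=
  match m with
  | 0 => C.L
  | 1 => min C.sg 1
  | 2 => C.aAcc
  | 3 => C.sg
  | 4 => C.R
  | 5 => C.s
  | 6 => C.wt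
  | 7 => C.aFl
  | 8 => C.phi
  | 9 => C.aDir
  | 10 => C.aTab
  | _ => C.start

/-- The whole code. The length `L` of the entries is given by the position of the first one. With a
single letter the automaton is a path, and nothing but the accepting bits is stored. -/
def bits : List Bool :=
  toBits (C.L + 1) (2 ^ C.L) ++ arr C.L C.header 12 ++ (List.range C.n).map C.acc ++
    if C.sg = 0 then [] else
      arr C.phi C.fl C.n ++ arr C.L (fun m => C.record (m / 7) (m % 7)) (C.nb * 7) ++
      arr C.wt C.table (2 ^ C.s * (C.R + 1) * 2) ++ cat C.block C.nb

/-- The transition function. -/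
def next (i a : ℕ) : ℕ :=
  if C.sg = 0 then i - 1 else
  if a = C.fl i then C.c i else C.ent i (a - if C.fl i < a then 1 else 0)

/-- The properties of the transition tables. -/
structure IsTable : Prop where
  R_pos : 1 ≤ C.R
  monotone : Monotone C.c
  c_lt : ∀ i, C.c i < C.n
  fl_le : ∀ i, C.fl i ≤ C.sg
  ent_lt : ∀ i b, C.ent i b < max 1 i
  start_lt : C.start < C.n

/-- The bounds on the numbers that appear in the code; `3 * K` is the number of table lookups that
are needed for a block. -/
structure IsValid (K : ℕ) : Prop extends C.IsTable where
  R_le : C.R ≤ K * C.s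
  L_ge : 5 ≤ C.L
  sg_lt : C.sg < 2 ^ C.L
  scan_lt : 3 * K * C.s < 2 ^ C.L
  s_le : C.s ≤ C.L
  X_lt : ∀ J < C.nb, C.X J < 2 ^ C.L
  addr_lt : C.aBlock C.nb < 2 ^ C.L

variable {C} {K : ℕ}

theorem phi_le (h : C.IsValid K) : C.phi ≤ C.L := Nat.size_le.2 h.sg_lt

theorem addr_le : C.aFl ≤ C.aDir ∧ C.aDir ≤ C.aTab ∧ C.aTab ≤ C.aBody ∧ C.aBody ≤ C.aBlock C.nb ∧
    C.aAcc ≤ C.aFl ∧ C.n ≤ C.aFl := by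
  simp [aDir, aTab, aBody, aBlock, aFl]

theorem n_lt (h : C.IsValid K) : C.n < 2 ^ C.L := by
  have := addr_le (C := C); have := h.addr_lt; omega

theorem R_le_scan (h : C.IsValid K) : 3 * C.R ≤ 3 * K * C.s := by
  have := h.R_le; nlinarith

theorem length_block_add_le (J : ℕ) (hJ : J < C.nb) :
    C.aBlock J + (C.block J).length ≤ C.aBlock C.nb := by
  simp only [aBlock, length_cat]
  rw [add_assoc, ← Finset.sum_range_succ (fun i => (C.block i).length) J]
  exact Nat.add_le_add_left (Finset.sum_le_sum_of_subset
    (Finset.range_mono (show J + 1 ≤ C.nb from hJ))) _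

theorem wt_le (h : C.IsValid K) : C.wt ≤ C.L := by
  refine Nat.size_le.2 ?_
  have h1 := R_le_scan h
  have h2 := h.scan_lt
  have h3 := h.R_pos
  have h4 : 1 ≤ K := by
    by_contra hK
    have := h.R_le
    rw [show K = 0 by omega] at this
    omega
  have h5 : 3 * C.s ≤ 3 * K * C.s := by nlinarith
  omega

theorem header_lt (h : C.IsValid K) {m : ℕ} (hm : m < 12) : C.header m < 2 ^ C.L := by
  have h1 := addr_le (C := C)
  have h2 := h.addr_lt
  have h3 : C.L < 2 ^ C.L := Nat.lt_two_pow_self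
  have h4 := h.sg_lt
  have h5 := R_le_scan h
  have h6 := h.scan_lt
  have h7 := wt_le h
  have h8 := phi_le h
  have h9 := h.s_le
  have h10 := h.start_lt
  have h11 := n_lt h
  interval_cases m <;> simp only [header] <;> omega

theorem incr_lt (h : C.IsValid K) (J : ℕ) : C.incr J < C.n :=
  (Nat.sub_le _ _).trans_lt (h.c_lt _)

theorem lowBits_le (h : C.IsValid K) (J : ℕ) : C.lowBits J ≤ C.L := by
  have h1 : C.incr J / C.R < 2 ^ C.L :=
    (Nat.div_le_self _ _).trans_lt ((incr_lt h J).trans (n_lt h))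
  exact (Nat.log_lt_of_lt_pow' (by have := h.L_ge; omega) h1).le

theorem W_le (h : C.IsValid K) {J : ℕ} (hJ : J < C.nb) : C.W J ≤ 4 * C.L := by
  rw [W, Nat.clog_le_iff_le_pow (by norm_num), mul_comm, pow_mul]
  exact Nat.pow_le_pow_left (h.X_lt J hJ).le 4

theorem X_pos (J : ℕ) : 1 ≤ C.X J := le_max_left _ _

theorem record_lt (h : C.IsValid K) {J m : ℕ} (hJ : J < C.nb) (hm : m < 7) :
    C.record J m < 2 ^ C.L := by
  have h1 := length_block_add_le J hJ
  have h2 := h.addr_lt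
  have h3 := lowBits_le h J
  have h4 := h.X_lt J hJ
  have h5 := (h.c_lt (J * C.R)).trans (n_lt h)
  have h6 : C.L < 2 ^ C.L := Nat.lt_two_pow_self
  have h7 : 4 * C.L < 2 ^ C.L := by
    have := h.L_ge
    generalize C.L = l at this
    induction l, this using Nat.le_induction with
    | base => norm_num
    | succ l hl ih => rw [pow_succ]; omega
  have h8 := W_le h hJ
  simp only [block, List.length_append, length_arr] at h1
  interval_cases m <;> simp only [record] <;> omega

/-! ### Reading the code -/

theorem at_header (C : Code) : At C.bits (C.L + 1) (arr C.L C.header 12) := by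
  have h := at_zero_self C.bits
  nth_rw 2 [bits] at h
  have := h.append_left.append_left.append_right
  rwa [length_toBits, zero_add] at this

theorem readNat_header (h : C.IsValid K) {m : ℕ} (hm : m < 12) :
    readNat C.bits (C.L + 1 + m * C.L) C.L = C.header m :=
  (at_header C).readNat_arr hm (header_lt h hm)

theorem readNat_add (mem : List Bool) (p l m : ℕ) :
    readNat mem p (l + m) = readNat mem p l + 2 ^ l * readNat mem (p + l) m := by
  rw [readNat, readNat, readNat, Finset.sum_range_add, Finset.mul_sum]
  congr 1
  refine Finset.sum_congr rfl fun i _ => ?_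
  rw [← add_assoc, mul_ite, mul_zero, pow_add]

/-- The code begins with `L` zeros and a one, followed by the number `L` itself, which can therefore
be found in the first word. -/
theorem readNat_first (h : C.IsValid K) {w : ℕ} (hw : 2 * C.L + 1 ≤ w) :
    ∃ z, readNat C.bits 0 w = 2 ^ C.L + 2 ^ (C.L + 1) * (C.L + 2 ^ C.L * z) := by
  have h0 := at_zero_self C.bits
  nth_rw 2 [bits] at h0
  have h1 := h0.append_left.append_left.append_left.readNat_eq
    (Nat.pow_lt_pow_right (by norm_num) (Nat.lt_succ_self _))
  have h2 := readNat_header h (m := 0) (by norm_num)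
  refine ⟨readNat C.bits (C.L + 1 + C.L) (w - (2 * C.L + 1)), ?_⟩
  conv_lhs => rw [show w = (C.L + 1) + (C.L + (w - (2 * C.L + 1))) by omega]
  rw [readNat_add, h1, zero_add, readNat_add]
  rw [Nat.zero_mul, Nat.add_zero] at h2
  rw [h2, header]

theorem readNat_acc (C : Code) {i : ℕ} (hi : i < C.n) :
    readNat C.bits (C.aAcc + i) 1 = if C.acc i then 1 else 0 := by
  have h := at_zero_self C.bits
  nth_rw 2 [bits] at h
  have h1 := h.append_left.append_right
  rw [List.length_append, length_toBits, length_arr, zero_add] at h1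
  have := h1 i (by simpa using hi)
  rw [show C.L + 1 + 12 * C.L + i = C.aAcc + i from rfl] at this
  rw [readNat, Finset.sum_range_one, add_zero, this]
  simp [List.getD_eq_getElem?_getD, hi]

theorem at_parts (hsg : C.sg ≠ 0) : At C.bits C.aFl (arr C.phi C.fl C.n) ∧
    At C.bits C.aDir (arr C.L (fun m => C.record (m / 7) (m % 7)) (C.nb * 7)) ∧
    At C.bits C.aTab (arr C.wt C.table (2 ^ C.s * (C.R + 1) * 2)) ∧
    At C.bits C.aBody (cat C.block C.nb) := by
  have h := at_zero_self C.bits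
  nth_rw 2 [bits] at h
  have h1 := h.append_right
  rw [if_neg hsg] at h1
  simp only [List.length_append, length_toBits, length_arr, List.length_map, List.length_range,
    zero_add] at h1
  rw [show C.L + 1 + 12 * C.L + C.n = C.aFl from rfl] at h1
  have h2 := h1.append_left.append_right
  have h3 := h1.append_left.append_left.append_right
  have h4 := h1.append_right
  simp only [List.length_append, length_arr] at h2 h3 h4
  refine ⟨h1.append_left.append_left.append_left, h3, ?_, ?_⟩
  · rw [← add_assoc] at h2; exact h2
  · rw [← add_assoc, ← add_assoc] at h4; exact h4

theorem readNat_fl (hsg : C.sg ≠ 0) (h : C.IsValid K) {i : ℕ} (hi : i < C.n) :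
    readNat C.bits (C.aFl + i * C.phi) C.phi = C.fl i :=
  (at_parts hsg).1.readNat_arr hi (Nat.size_le.1 (Nat.size_le_size (h.fl_le i)))

theorem readNat_record (hsg : C.sg ≠ 0) (h : C.IsValid K) {J m : ℕ} (hJ : J < C.nb)
    (hm : m < 7) :
    readNat C.bits (C.aDir + (J * 7 + m) * C.L) C.L = C.record J m := by
  have e1 : (J * 7 + m) / 7 = J := by omega
  have e2 : (J * 7 + m) % 7 = m := by omega
  have := (at_parts hsg).2.1.readNat_arr (i := J * 7 + m) (by omega)
    (by rw [e1, e2]; exact record_lt h hJ hm)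
  rwa [e1, e2] at this

theorem table_lt (C : Code) (m : ℕ) : C.table m < 2 ^ C.wt := by
  have h0 : C.R + C.s < 2 ^ C.wt := Nat.lt_size_self _
  rw [table]
  split_ifs
  · have := Nat.mod_lt (m / 2) (show 0 < C.R + 1 by omega)
    omega
  · have := zerosBefore_le (toBits C.s (m / 2 / (C.R + 1))) (m / 2 % (C.R + 1))
    rw [length_toBits] at this
    omega

/-- A lookup of the `s` bits at `p`. -/
theorem readNat_table (hsg : C.sg ≠ 0) (p : ℕ) {j : ℕ} (hj : j ≤ C.R) :
    readNat C.bits (C.aTab + (readNat C.bits p C.s * (C.R + 1) + j) * 2 * C.wt) C.wt =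
        j - (readList C.bits p C.s).count true ∧
      readNat C.bits (C.aTab + (readNat C.bits p C.s * (C.R + 1) + j) * 2 * C.wt + C.wt) C.wt =
        zerosBefore (readList C.bits p C.s) j := by
  set u := readNat C.bits p C.s with hu
  have hlt : u < 2 ^ C.s := readNat_lt _ _ _
  have hb : u * (C.R + 1) + j < 2 ^ C.s * (C.R + 1) := by
    calc u * (C.R + 1) + j < (u + 1) * (C.R + 1) := by rw [add_mul]; omega
      _ ≤ _ := Nat.mul_le_mul_right _ hlt
  have e1 : (u * (C.R + 1) + j) / (C.R + 1) = u := by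
    rw [mul_comm, Nat.mul_add_div (by omega), Nat.div_eq_of_lt (by omega), add_zero]
  have e2 : (u * (C.R + 1) + j) % (C.R + 1) = j := by
    rw [mul_comm, Nat.mul_add_mod, Nat.mod_eq_of_lt (by omega)]
  generalize u * (C.R + 1) + j = q at hb e1 e2
  constructor
  · rw [(at_parts hsg).2.2.1.readNat_arr (by omega) (table_lt C _), table,
      if_pos (by omega), show q * 2 / 2 = q by omega, e1, e2, toBits_readNat]
  · rw [add_assoc, show q * 2 * C.wt + C.wt = (q * 2 + 1) * C.wt by ring,
      (at_parts hsg).2.2.1.readNat_arr (by omega) (table_lt C _), table,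
      if_neg (by omega), show (q * 2 + 1) / 2 = q by omega, e1, e2, toBits_readNat]

theorem at_block (hsg : C.sg ≠ 0) {J : ℕ} (hJ : J < C.nb) : At C.bits (C.aBlock J) (C.block J) :=
  (at_parts hsg).2.2.2.cat hJ

theorem high_monotone (h : C.IsTable) (J : ℕ) : Monotone (C.high J) := fun _ _ hk =>
  Nat.div_le_div_right (Nat.sub_le_sub_right (h.monotone (by omega)) _)

theorem high_last_le (h : C.IsTable) (J : ℕ) : C.high J (C.R - 1) ≤ 2 * C.R := by
  have hR := h.R_pos
  rw [high, show J * C.R + (C.R - 1) = J * C.R + C.R - 1 by omega]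
  change C.incr J / 2 ^ C.lowBits J ≤ 2 * C.R
  rw [Nat.div_le_iff_le_mul_add_pred (by positivity)]
  have h1 : C.incr J / C.R < 2 ^ (C.lowBits J + 1) := Nat.lt_pow_succ_log_self (by norm_num) _
  have h2 : C.incr J < 2 ^ (C.lowBits J + 1) * C.R := (Nat.div_lt_iff_lt_mul hR).1 h1
  rw [pow_succ] at h2
  nlinarith [Nat.zero_le (2 ^ C.lowBits J - 1)]

theorem length_unary_high (h : C.IsTable) (J : ℕ) :
    (unary (C.high J) C.R).length = C.high J (C.R - 1) + C.R := by
  obtain ⟨r, hr⟩ : ∃ r, C.R = r + 1 := ⟨C.R - 1, by have := h.R_pos; omega⟩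
  rw [hr, length_unary (high_monotone h J), Nat.add_sub_cancel]

/-- The `k`-th high part is found by `3 * K` lookups. -/
theorem zerosBefore_readList (hsg : C.sg ≠ 0) (h : C.IsValid K) {J k : ℕ} (hJ : J < C.nb)
    (hk : k < C.R) :
    zerosBefore (readList C.bits (C.aBlock J) (3 * K * C.s)) (k + 1) = C.high J k := by
  have hlen : (unary (C.high J) C.R).length ≤ 3 * K * C.s := by
    have h1 := high_last_le h.toIsTable J
    have h2 := length_unary_high h.toIsTable J
    have h3 := R_le_scan h
    omega
  obtain ⟨m, hm⟩ := Nat.exists_eq_add_of_le hlen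
  rw [hm, readList_add, (at_block hsg hJ).append_left.append_left.readList_eq, zerosBefore_append,
    zerosBefore_unary (high_monotone h.toIsTable J) _ _ hk, count_unary,
    show k + 1 - C.R = 0 by omega, zerosBefore_zero, add_zero]

/-- The low parts; entry `3` of the directory is their address. -/
theorem readNat_low (hsg : C.sg ≠ 0) {J k : ℕ} (hJ : J < C.nb) (hk : k < C.R) :
    readNat C.bits (C.record J 3 + k * C.lowBits J) (C.lowBits J) = C.low J k :=
  (at_block hsg hJ).append_left.append_right.readNat_arr hk (Nat.mod_lt _ (by positivity))

theorem c_eq (h : C.IsValid K) (J k : ℕ) :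
    C.c (J * C.R) + C.high J k * 2 ^ C.lowBits J + C.low J k = C.c (J * C.R + k) := by
  rw [add_assoc, high, low, Nat.div_add_mod']
  have := h.monotone (show J * C.R ≤ J * C.R + k by omega)
  omega

theorem digit_lt (hsg : C.sg ≠ 0) (h : C.IsValid K) (J e : ℕ) : C.digit J e < C.X J := by
  rw [digit]
  split_ifs with he
  · refine (h.ent_lt _ _).trans_le ?_
    have h1 : e / C.sg < C.R := (Nat.div_lt_iff_lt_mul (by omega)).2 he
    rw [X]
    omega
  · exact X_pos J

theorem pack_lt (hsg : C.sg ≠ 0) (h : C.IsValid K) (J g : ℕ) : C.pack J g < C.X J ^ 4 := by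
  have h0 := digit_lt hsg h J (4 * g)
  have h1 := digit_lt hsg h J (4 * g + 1)
  have h2 := digit_lt hsg h J (4 * g + 2)
  have h3 := digit_lt hsg h J (4 * g + 3)
  have key : ∀ d y m : ℕ, d < C.X J → y < C.X J ^ m → d + C.X J * y < C.X J ^ (m + 1) := by
    intro d y m hd hy
    calc d + C.X J * y < C.X J * (y + 1) := by rw [mul_add]; omega
      _ ≤ C.X J * C.X J ^ m := Nat.mul_le_mul_left _ hy
      _ = _ := by rw [pow_succ, mul_comm]
  exact key _ _ 3 h0 (key _ _ 2 h1 (key _ _ 1 h2 (by simpa using h3)))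

theorem readNat_pack (hsg : C.sg ≠ 0) (h : C.IsValid K) {J g : ℕ} (hJ : J < C.nb)
    (hg : g < C.groups) :
    readNat C.bits (C.record J 6 + g * C.W J) (C.W J) = C.pack J g := by
  have := (at_block hsg hJ).append_right
  rw [List.length_append, length_arr, ← add_assoc] at this
  exact this.readNat_arr hg ((pack_lt hsg h J g).trans_le (Nat.le_pow_clog (by norm_num) _))

/-- Extraction of a digit from a pack by at most three divisions. -/
theorem pack_digit (hsg : C.sg ≠ 0) (h : C.IsValid K) (J e : ℕ) :
    C.pack J (e / 4) / (1 + (if 0 < e % 4 then 1 else 0) * (C.X J - 1)) /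
      (1 + (if 1 < e % 4 then 1 else 0) * (C.X J - 1)) /
      (1 + (if 2 < e % 4 then 1 else 0) * (C.X J - 1)) % C.X J = C.digit J e := by
  have hX := X_pos (C := C) J
  have key : ∀ d y : ℕ, d < C.X J → (d + C.X J * y) / C.X J = y ∧ (d + C.X J * y) % C.X J = d := by
    intro d y hd
    rw [Nat.add_mul_div_left _ _ hX, Nat.div_eq_of_lt hd, zero_add, Nat.add_mul_mod_self_left,
      Nat.mod_eq_of_lt hd]
    exact ⟨rfl, rfl⟩
  have h0 := key _ (C.digit J (4 * (e / 4) + 1) + C.X J * (C.digit J (4 * (e / 4) + 2) +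
    C.X J * C.digit J (4 * (e / 4) + 3))) (digit_lt hsg h J (4 * (e / 4)))
  have h1 := key _ (C.digit J (4 * (e / 4) + 2) +
    C.X J * C.digit J (4 * (e / 4) + 3)) (digit_lt hsg h J (4 * (e / 4) + 1))
  have h2 := key _ (C.digit J (4 * (e / 4) + 3)) (digit_lt hsg h J (4 * (e / 4) + 2))
  have h3 := digit_lt hsg h J (4 * (e / 4) + 3)
  have hone : 1 + 1 * (C.X J - 1) = C.X J := by omega
  have he := Nat.div_add_mod e 4
  have hlt : e % 4 < 4 := Nat.mod_lt _ (by norm_num)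
  rw [pack]
  generalize e % 4 = m at he hlt
  interval_cases m
  · simp only [lt_irrefl, Nat.not_lt_zero, if_false, Nat.zero_mul, Nat.add_zero, Nat.div_one]
    rw [h0.2, ← he, Nat.add_zero]
    congr 1; omega
  · norm_num only [if_true, if_false, Nat.zero_mul, Nat.add_zero, Nat.div_one, hone]
    rw [h0.1, h1.2]
    congr 1
  · norm_num only [if_true, if_false, Nat.zero_mul, Nat.add_zero, Nat.div_one, hone]
    rw [h0.1, h1.1, h2.2]
    congr 1
  · norm_num only [if_true, if_false, Nat.zero_mul, Nat.add_zero, Nat.div_one, hone]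
    rw [h0.1, h1.1, h2.1, Nat.mod_eq_of_lt h3]
    congr 1

theorem digit_eq (C : Code) (J k b : ℕ) (hk : k < C.R) (hb : b < C.sg) :
    C.digit J (k * C.sg + b) = C.ent (J * C.R + k) b ∧ (k * C.sg + b) / 4 < C.groups := by
  have hlt : k * C.sg + b < C.R * C.sg := by
    calc k * C.sg + b < (k + 1) * C.sg := by rw [add_mul]; omega
      _ ≤ _ := Nat.mul_le_mul_right _ hk
  rw [digit, if_pos hlt, groups, mul_comm k, Nat.mul_add_div (by omega), Nat.mul_add_mod,
    Nat.div_eq_of_lt hb, Nat.mod_eq_of_lt hb, add_zero]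
  rw [mul_comm k] at hlt
  exact ⟨rfl, by omega⟩

theorem block_lt (h : C.IsValid K) {i : ℕ} (hi : i < C.n) : i / C.R < C.nb := by
  have hR := h.R_pos
  rw [nb, Nat.div_lt_iff_lt_mul hR]
  have h1 := Nat.div_add_mod (C.n + C.R - 1) C.R
  have h2 := Nat.mod_lt (C.n + C.R - 1) hR
  rw [mul_comm]
  omega

end Code

/-! ### The program -/

namespace WordRAM

theorem Block.eval_of_notMem {V w : ℕ} (mem : List Bool) (ss : Block V) (ρ : Fin V → BitVec w)
    (v : Fin V) (hv : ∀ s ∈ ss, s.1 ≠ v) : ss.eval mem ρ v = ρ v := by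
  induction ss generalizing ρ with
  | nil => rfl
  | cons s ss ih =>
    rw [Block.eval_cons, ih _ (fun t ht => hv t (by simp [ht])),
      Function.update_of_ne (hv s (by simp)).symm]

/-- The variable for the letter read. -/
abbrev vLetter : Fin 16 := 0

/-- The variable for the current state. -/
abbrev vState : Fin 16 := 1

/-- The variable for the position in the unary code of a block when it is scanned. -/
abbrev vPos : Fin 16 := 13

/-- The variable for the number of ones that are still sought in the scan. -/
abbrev vOnes : Fin 16 := 14

/-- The variable for the number of zeros found in the scan. -/
abbrev vZeros : Fin 16 := 15

/-- The entries of the header are kept in the variables `2, …, 12`. -/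
abbrev hdr (m : ℕ) (hm : m < 11 := by decide) : Expr 16 := .var ⟨m + 2, by omega⟩

/-- The entry `m` of the directory for the block of the current state. -/
def recordExpr (m : ℕ) : Expr 16 :=
  .load (hdr 9 + ((.var vState / hdr 4) * .lit 7 + .lit m) * hdr 0) (hdr 0)

/-- The address of the entry of the lookup table for the next bits of the unary code. -/
def lookupExpr : Expr 16 :=
  hdr 10 + (.load (.var vPos) (hdr 5) * (hdr 4 + .lit 1) + .var vOnes) * .lit 2 * hdr 6

/-- One table lookup. Both entries are looked up with the same number of ones sought, which is
therefore updated after the zeros, and the position last. -/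
def scanBlock : Block 16 :=
  [(vZeros, .var vZeros + .load (lookupExpr + hdr 6) (hdr 6)),
   (vOnes, .load lookupExpr (hdr 6)),
   (vPos, .var vPos + hdr 5)]

/-- The transition on the letter `fl`. -/
def cExpr : Expr 16 :=
  recordExpr 1 + .op .shl (.var vZeros) (recordExpr 2) +
    .load (recordExpr 3 + (.var vState % hdr 4) * recordExpr 2) (recordExpr 2)

/-- The letter `fl`. -/
def flExpr : Expr 16 := .load (hdr 7 + .var vState * hdr 8) (hdr 8)

/-- The number of the transition on another letter within its block. -/
def indexExpr : Expr 16 :=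
  (.var vState % hdr 4) * hdr 3 + (.var vLetter - flExpr.lt (.var vLetter))

/-- A divisor that is `1` for the first digits of a pack. -/
def divisorExpr (m : ℕ) : Expr 16 :=
  .lit 1 + (Expr.lit m).lt (indexExpr % .lit 4) * (recordExpr 4 - .lit 1)

/-- The transition on another letter. -/
def entExpr : Expr 16 :=
  .load (recordExpr 6 + (indexExpr / .lit 4) * recordExpr 5) (recordExpr 5) /
    divisorExpr 0 / divisorExpr 1 / divisorExpr 2 % recordExpr 4

/-- An expression that is zero if the letter read is `fl`, and one otherwise. -/
def otherExpr : Expr 16 := flExpr.lt (.var vLetter) + (Expr.var vLetter).lt flExpr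

/-- The next state. There are no jumps: the result is selected by factors `0` and `1`. If there is
only one letter, the directory does not exist, and the values read from it are multiplied by `0`. -/
def nextExpr : Expr 16 :=
  hdr 1 * (otherExpr * entExpr + (.lit 1 - otherExpr) * cExpr) +
    (.lit 1 - hdr 1) * (.var vState - (Expr.lit 0).lt (.var vState))

/-- The preparation of a transition. -/
def initBlock : Block 16 :=
  [(vPos, recordExpr 0), (vOnes, .var vState % hdr 4 + .lit 1), (vZeros, .lit 0)]

/-- A transition, with `3 * K` table lookups. -/
def stepBlock (K : ℕ) : Block 16 :=
  initBlock ++ (List.replicate (3 * K) scanBlock).flatten ++ [(vState, nextExpr)]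

/-- The length `L` of the entries of the header. The first `w` bits of the code are read as a number
`V`; the length of the load is the greatest word, which is cut down to `w`. Since `V xor (V - 1)`
consists of the lowest one of `V` and the zeros below it, adding `1` yields `2 ^ (L + 1)`. -/
def lengthBlock : Block 16 :=
  [(vZeros, .load (.lit 0) (.lit 0 - .lit 1)),
   (vPos, .op .xor (.var vZeros) (.var vZeros - .lit 1) + .lit 1),
   (2, (.var vZeros / .var vPos) % (.var vPos / .lit 2))]

/-- The entry `m` of the header. -/
def headerExpr (m : ℕ) : Expr 16 :=
  .load (hdr 0 + .lit 1 + .lit m * hdr 0) (hdr 0)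

/-- Reading the header. -/
def headerBlock : Block 16 :=
  lengthBlock ++ [(3, headerExpr 1), (4, headerExpr 2), (5, headerExpr 3), (6, headerExpr 4),
    (7, headerExpr 5), (8, headerExpr 6), (9, headerExpr 7), (10, headerExpr 8),
    (11, headerExpr 9), (12, headerExpr 10), (vState, headerExpr 11)]

/-- Reading the accepting bit of the current state. -/
def acceptBlock : Block 16 := [(vState, .load (hdr 2 + .var vState) (.lit 1))]

end WordRAM

namespace Code

open WordRAM

variable {C : Code} {K w : ℕ}

/-- The variables `2, …, 12` hold the header. -/
def HasHeader (C : Code) (ρ : Fin 16 → BitVec w) : Prop :=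
  ∀ m (hm : m < 11), (ρ ⟨m + 2, by omega⟩).toNat = C.header m

theorem HasHeader.of_eq {ρ ρ' : Fin 16 → BitVec w} (h : C.HasHeader ρ)
    (he : ∀ v, v ≠ vLetter → v ≠ vState → v ≠ vPos → v ≠ vOnes → v ≠ vZeros → ρ' v = ρ v) :
    C.HasHeader ρ' := fun m hm => by
  rw [he _ (by simp [Fin.ext_iff]) (by simp [Fin.ext_iff]) (by simp [Fin.ext_iff]; omega)
    (by simp [Fin.ext_iff]; omega) (by simp [Fin.ext_iff]; omega)]
  exact h m hm

section Values

variable {ρ : Fin 16 → BitVec w} {i a : ℕ}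

theorem hasVal_hdr (h : C.IsValid K) (hρ : C.HasHeader ρ) (m : ℕ) (hm : m < 11) :
    HasVal C.L C.bits ρ (hdr m hm) (C.header m) 1 :=
  .var (hρ m hm) (by rw [one_mul]; exact header_lt h (by omega))

theorem hasVal_state (h : C.IsValid K) (hi : i < C.n) (hi' : (ρ vState).toNat = i) :
    HasVal C.L C.bits ρ (.var vState) i 1 :=
  .var hi' (by rw [one_mul]; exact hi.trans (n_lt h))

theorem hasVal_letter (h : C.IsValid K) (ha : a ≤ C.sg) (ha' : (ρ vLetter).toNat = a) :
    HasVal C.L C.bits ρ (.var vLetter) a 1 :=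
  .var ha' (by rw [one_mul]; exact ha.trans_lt h.sg_lt)

theorem hasVal_lit (h : C.IsValid K) (hw : 100 * C.L ≤ w) (x : ℕ) (hx : x < 2 ^ 3) :
    HasVal C.L C.bits ρ (.lit x) x 3 :=
  .lit (by have := h.L_ge; omega) hw (by norm_num) hx

theorem hasVal_record (h : C.IsValid K) (hw : 100 * C.L ≤ w) (hsg : C.sg ≠ 0)
    (hρ : C.HasHeader ρ) (hi : i < C.n) (hi' : (ρ vState).toNat = i) {m : ℕ} (hm : m < 7) :
    HasVal C.L C.bits ρ (recordExpr m) (C.record (i / C.R) m) 1 := by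
  have hL : 1 ≤ C.L := by have := h.L_ge; omega
  have h1 := ((hasVal_state (C := C) h hi hi').div (hasVal_hdr h hρ 4 (by norm_num))).mul hw
    (hasVal_lit h hw 7 (by norm_num)) (by norm_num)
  have h2 := (h1.add hL hw (hasVal_lit h hw m (by omega)) (by norm_num)).mul hw
    (hasVal_hdr h hρ 0 (by norm_num)) (by norm_num)
  have h3 := ((hasVal_hdr h hρ 9 (by norm_num)).add hL hw h2 (by norm_num)).load hw
    (hasVal_hdr h hρ 0 (by norm_num)) (c := 1) (by rw [one_mul, header]) (by norm_num)
  exact h3.congr (readNat_record hsg h (block_lt h hi) hm)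

theorem hasVal_lookup (h : C.IsValid K) (hw : 100 * C.L ≤ w) (hρ : C.HasHeader ρ) {p j : ℕ}
    (hp : p < 2 ^ (2 * C.L)) (hp' : (ρ vPos).toNat = p) (hj : j ≤ C.R)
    (hj' : (ρ vOnes).toNat = j) :
    HasVal C.L C.bits ρ lookupExpr
      (C.aTab + (readNat C.bits p C.s * (C.R + 1) + j) * 2 * C.wt) 20 := by
  have hL : 1 ≤ C.L := by have := h.L_ge; omega
  have hR : C.R < 2 ^ C.L := header_lt h (m := 4) (by norm_num)
  have h0 : HasVal C.L C.bits ρ (.var vPos) p 2 := .var hp' hp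
  have h1 : HasVal C.L C.bits ρ (.var vOnes) j 1 := .var hj' (by rw [one_mul]; omega)
  have h2 := h0.load hw (hasVal_hdr h hρ 5 (by norm_num)) (c := 1)
    (by rw [one_mul]; exact h.s_le) (by norm_num)
  have h3 := (hasVal_hdr h hρ 4 (by norm_num)).add hL hw (hasVal_lit h hw 1 (by norm_num))
    (by norm_num)
  have h4 := (((h2.mul hw h3 (by norm_num)).add hL hw h1 (by norm_num)).mul hw
    (hasVal_lit h hw 2 (by norm_num)) (by norm_num)).mul hw (hasVal_hdr h hρ 6 (by norm_num))
    (by norm_num)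
  exact ((hasVal_hdr h hρ 10 (by norm_num)).add hL hw h4 (by norm_num)).mono (by norm_num)

end Values

/-- The state of the scan for the `k`-th one (counted from 0) of the unary code at the address `U`
after `m` lookups. -/
structure IsScanning (C : Code) (U k m : ℕ) (ρ : Fin 16 → BitVec w) : Prop where
  pos : (ρ vPos).toNat = U + m * C.s
  ones : (ρ vOnes).toNat = k + 1 - (readList C.bits U (m * C.s)).count true
  zeros : (ρ vZeros).toNat = zerosBefore (readList C.bits U (m * C.s)) (k + 1)

theorem IsScanning.succ (h : C.IsValid K) (hw : 100 * C.L ≤ w) (hsg : C.sg ≠ 0)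
    {ρ : Fin 16 → BitVec w} (hρ : C.HasHeader ρ) {U k m : ℕ} (hU : U < 2 ^ C.L) (hk : k < C.R)
    (hm : m < 3 * K) (hs : C.IsScanning U k m ρ) :
    C.IsScanning U k (m + 1) (scanBlock.eval C.bits ρ) := by
  have hL : 1 ≤ C.L := by have := h.L_ge; omega
  have hms : m * C.s < 2 ^ C.L :=
    (Nat.mul_le_mul_right _ hm.le).trans_lt h.scan_lt
  have hp : U + m * C.s < 2 ^ (2 * C.L) := by
    calc U + m * C.s < 2 ^ (C.L + 1) := by rw [pow_succ]; omega
      _ ≤ _ := Nat.pow_le_pow_right (by norm_num) (by omega)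
  obtain ⟨hpos, hones, hzeros⟩ := hs
  set j := k + 1 - (readList C.bits U (m * C.s)).count true with hj
  set z := zerosBefore (readList C.bits U (m * C.s)) (k + 1) with hz
  have hjR : j ≤ C.R := by omega
  have hzl : z < 2 ^ C.L := by
    have := zerosBefore_le (readList C.bits U (m * C.s)) (k + 1)
    rw [readList, List.length_map, List.length_range] at this
    exact this.trans_lt hms
  obtain ⟨t1, t2⟩ := readNat_table (C := C) hsg (U + m * C.s) hjR
  have hwt : C.header 6 ≤ 1 * C.L := by rw [one_mul]; exact wt_le h
  have q1 := hasVal_lookup h hw hρ hp hpos hjR hones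
  have z1 : HasVal C.L C.bits ρ (.var vZeros) z 1 := .var hzeros (by rwa [one_mul])
  have z2 := z1.add hL hw ((q1.add hL hw (hasVal_hdr h hρ 6 (by norm_num)) (by norm_num)).load hw
    (hasVal_hdr h hρ 6 (by norm_num)) hwt (by norm_num)) (by norm_num)
  set ρ1 := Function.update ρ vZeros ((Expr.var vZeros + .load (lookupExpr + hdr 6) (hdr 6) :
    Expr 16).eval C.bits ρ) with hρ1
  have hρ1' : C.HasHeader ρ1 := hρ.of_eq fun v _ _ _ _ h5 => Function.update_of_ne h5 _ _
  have q2 := (hasVal_lookup h hw hρ1' hp (by rw [hρ1, Function.update_of_ne (by decide), hpos]) hjR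
    (by rw [hρ1, Function.update_of_ne (by decide), hones])).load hw
    (hasVal_hdr h hρ1' 6 (by norm_num)) hwt (by norm_num)
  set ρ2 := Function.update ρ1 vOnes ((Expr.load lookupExpr (hdr 6)).eval C.bits ρ1) with hρ2
  have hρ2' : C.HasHeader ρ2 := hρ1'.of_eq fun v _ _ _ h4 _ => Function.update_of_ne h4 _ _
  have p1 : HasVal C.L C.bits ρ2 (.var vPos) (U + m * C.s) 2 :=
    .var (by rw [hρ2, Function.update_of_ne (by decide), hρ1, Function.update_of_ne (by decide),
      hpos]) hp
  have p2 := p1.add hL hw (hasVal_hdr h hρ2' 5 (by norm_num)) (by norm_num)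
  have hsplit := readList_add C.bits U (m * C.s) C.s
  have heval : scanBlock.eval C.bits ρ =
    Function.update ρ2 vPos ((Expr.var vPos + hdr 5 : Expr 16).eval C.bits ρ2) := rfl
  rw [heval]
  refine ⟨?_, ?_, ?_⟩
  · rw [Function.update_self, p2.toNat_eq, header]; ring
  · rw [Function.update_of_ne (by decide), hρ2, Function.update_self, q2.toNat_eq, header, t1,
      add_mul, one_mul, hsplit, List.count_append, hj]
    omega
  · rw [Function.update_of_ne (by decide), hρ2, Function.update_of_ne (by decide), hρ1,
      Function.update_self, z2.toNat_eq, header, t2, add_mul, one_mul, hsplit, zerosBefore_append]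

theorem eval_step_of_ne (K : ℕ) (mem : List Bool) (ρ : Fin 16 → BitVec w) (v : Fin 16)
    (h2 : v ≠ vState) (h3 : v ≠ vPos) (h4 : v ≠ vOnes) (h5 : v ≠ vZeros) :
    (stepBlock K).eval mem ρ v = ρ v := by
  refine Block.eval_of_notMem _ _ _ _ fun s hs => ?_
  simp only [stepBlock, initBlock, scanBlock, List.mem_append, List.mem_flatten, List.mem_replicate,
    List.mem_cons, List.not_mem_nil, or_false] at hs
  rcases hs with ((rfl | rfl | rfl) | ⟨l, ⟨-, rfl⟩, hs⟩) | rfl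
  · exact h3.symm
  · exact h4.symm
  · exact h5.symm
  · simp only [List.mem_cons, List.not_mem_nil, or_false] at hs
    rcases hs with rfl | rfl | rfl
    · exact h5.symm
    · exact h4.symm
    · exact h3.symm
  · exact h2.symm

/-- The scan finds the high part of the transition on `fl`. -/
theorem eval_scan (h : C.IsValid K) (hw : 100 * C.L ≤ w) (hsg : C.sg ≠ 0)
    {ρ : Fin 16 → BitVec w} (hρ : C.HasHeader ρ) {i : ℕ} (hi : i < C.n)
    (hi' : (ρ vState).toNat = i) :
    ((initBlock ++ (List.replicate (3 * K) scanBlock).flatten).eval C.bits ρ vZeros).toNat =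
      C.high (i / C.R) (i % C.R) := by
  have hL : 1 ≤ C.L := by have := h.L_ge; omega
  have hk : i % C.R < C.R := Nat.mod_lt _ h.R_pos
  have hJ := block_lt h hi
  set U := C.aBlock (i / C.R) with hU
  have hUlt : U < 2 ^ C.L := record_lt h hJ (m := 0) (by norm_num)
  have key : ∀ m ≤ 3 * K,
      C.HasHeader ((initBlock ++ (List.replicate m scanBlock).flatten).eval C.bits ρ) ∧
      C.IsScanning U (i % C.R) m
        ((initBlock ++ (List.replicate m scanBlock).flatten).eval C.bits ρ) := by
    intro m
    induction m with
    | zero =>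
      intro _
      simp only [List.replicate_zero, List.flatten_nil, List.append_nil]
      have r1 := hasVal_record h hw hsg hρ hi hi' (m := 0) (by norm_num)
      set ρ1 := Function.update ρ vPos ((recordExpr 0).eval C.bits ρ) with hρ1
      have hρ1' : C.HasHeader ρ1 := hρ.of_eq fun v _ _ h3 _ _ => Function.update_of_ne h3 _ _
      have r2 := ((hasVal_state (C := C) (ρ := ρ1) h hi (by
        rw [hρ1, Function.update_of_ne (by decide), hi'])).mod
          (hasVal_hdr h hρ1' 4 (by norm_num))).add hL hw (hasVal_lit h hw 1 (by norm_num))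
          (by norm_num)
      set ρ2 := Function.update ρ1 vOnes
        ((Expr.var vState % hdr 4 + .lit 1 : Expr 16).eval C.bits ρ1) with hρ2
      have hρ2' : C.HasHeader ρ2 := hρ1'.of_eq fun v _ _ _ h4 _ => Function.update_of_ne h4 _ _
      have heval : initBlock.eval C.bits ρ =
        Function.update ρ2 vZeros ((Expr.lit 0 : Expr 16).eval C.bits ρ2) := rfl
      rw [heval]
      refine ⟨hρ2'.of_eq fun v _ _ _ _ h5 => Function.update_of_ne h5 _ _, ?_, ?_, ?_⟩
      · rw [Function.update_of_ne (by decide), hρ2, Function.update_of_ne (by decide), hρ1,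
          Function.update_self, r1.toNat_eq, record, zero_mul, add_zero]
      · rw [Function.update_of_ne (by decide), hρ2, Function.update_self, r2.toNat_eq, header]
        simp [readList]
      · rw [Function.update_self]
        simp [readList, Expr.eval, zerosBefore]
    | succ m ih =>
      intro hm
      obtain ⟨i1, i2⟩ := ih (by omega)
      rw [List.replicate_succ', List.flatten_append, ← List.append_assoc, Block.eval_append]
      simp only [List.flatten_cons, List.flatten_nil, List.append_nil]
      refine ⟨i1.of_eq fun v _ _ h3 h4 h5 => ?_, i2.succ h hw hsg i1 hUlt hk (by omega)⟩
      refine Block.eval_of_notMem _ _ _ _ fun s hs => ?_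
      simp only [scanBlock, List.mem_cons, List.not_mem_nil, or_false] at hs
      rcases hs with rfl | rfl | rfl
      · exact h5.symm
      · exact h4.symm
      · exact h3.symm
  rw [(key _ le_rfl).2.zeros, zerosBefore_readList hsg h hJ hk]

end Code

namespace Code

open WordRAM

variable {C : Code} {K w : ℕ}

section Next

variable {ρ : Fin 16 → BitVec w} {i a : ℕ}

theorem hasVal_fl (h : C.IsValid K) (hw : 100 * C.L ≤ w) (hsg : C.sg ≠ 0) (hρ : C.HasHeader ρ)
    (hi : i < C.n) (hi' : (ρ vState).toNat = i) : HasVal C.L C.bits ρ flExpr (C.fl i) 1 := by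
  have hL : 1 ≤ C.L := by have := h.L_ge; omega
  have h1 := (hasVal_hdr h hρ 7 (by norm_num)).add hL hw ((hasVal_state (C := C) h hi hi').mul hw
    (hasVal_hdr h hρ 8 (by norm_num)) (by norm_num)) (by norm_num)
  exact (h1.load hw (hasVal_hdr h hρ 8 (by norm_num)) (c := 1)
    (by rw [one_mul]; exact phi_le h) (by norm_num)).congr (readNat_fl hsg h hi)

theorem hasVal_index (h : C.IsValid K) (hw : 100 * C.L ≤ w) (hsg : C.sg ≠ 0)
    (hρ : C.HasHeader ρ) (hi : i < C.n) (hi' : (ρ vState).toNat = i) (ha : a ≤ C.sg)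
    (ha' : (ρ vLetter).toNat = a) :
    HasVal C.L C.bits ρ indexExpr
      (i % C.R * C.sg + (a - if C.fl i < a then 1 else 0)) 3 := by
  have hL : 1 ≤ C.L := by have := h.L_ge; omega
  have hl := hasVal_letter (C := C) h ha ha'
  have h1 := hl.sub ((hasVal_fl h hw hsg hρ hi hi').ltExpr hL hw hl (by norm_num) (by norm_num))
    (by split_ifs <;> omega)
  exact (((hasVal_state (C := C) h hi hi').mod (hasVal_hdr h hρ 4 (by norm_num))).mul hw
    (hasVal_hdr h hρ 3 (by norm_num)) (by norm_num)).add hL hw h1 (by norm_num)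

theorem hasVal_divisor (h : C.IsValid K) (hw : 100 * C.L ≤ w) (hsg : C.sg ≠ 0)
    (hρ : C.HasHeader ρ) (hi : i < C.n) (hi' : (ρ vState).toNat = i) {e : ℕ}
    (he : HasVal C.L C.bits ρ indexExpr e 3) (m : ℕ) (hm : m < 3) :
    HasVal C.L C.bits ρ (divisorExpr m)
      (1 + (if m < e % 4 then 1 else 0) * (C.X (i / C.R) - 1)) 4 := by
  have hL : 1 ≤ C.L := by have := h.L_ge; omega
  have h1 := (hasVal_lit h hw m (by omega)).ltExpr hL hw
    (he.mod (hasVal_lit h hw 4 (by norm_num))) (by norm_num) (by norm_num)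
  have h2 := (hasVal_record h hw hsg hρ hi hi' (m := 4) (by norm_num)).sub
    (hasVal_lit h hw 1 (by norm_num)) (X_pos _)
  exact (hasVal_lit h hw 1 (by norm_num)).add hL hw (h1.mul hw h2 (by norm_num)) (by norm_num)

/-- The transition on a letter other than `fl`; on `fl` the value is irrelevant. -/
theorem hasVal_ent (h : C.IsValid K) (hw : 100 * C.L ≤ w) (hsg : C.sg ≠ 0)
    (hρ : C.HasHeader ρ) (hi : i < C.n) (hi' : (ρ vState).toNat = i) (ha : a ≤ C.sg)
    (ha' : (ρ vLetter).toNat = a) :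
    ∃ x, HasVal C.L C.bits ρ entExpr x 4 ∧
      (a ≠ C.fl i → x = C.ent i (a - if C.fl i < a then 1 else 0)) := by
  have hL : 1 ≤ C.L := by have := h.L_ge; omega
  have hJ := block_lt h hi
  have he := hasVal_index h hw hsg hρ hi hi' ha ha'
  have hdiv := hasVal_divisor h hw hsg hρ hi hi' he
  have hrec := fun m (hm : m < 7) => hasVal_record h hw hsg hρ hi hi' hm
  have h1 := ((hrec 6 (by norm_num)).add hL hw ((he.div (hasVal_lit h hw 4 (by norm_num))).mul hw
    (hrec 5 (by norm_num)) (by norm_num)) (by norm_num)).load hw (hrec 5 (by norm_num)) (c := 4)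
    (W_le h hJ) (by norm_num)
  refine ⟨_, (((h1.div (hdiv 0 (by norm_num))).div (hdiv 1 (by norm_num))).div
    (hdiv 2 (by norm_num))).mod (hrec 4 (by norm_num)), fun hne => ?_⟩
  have hb : (a - if C.fl i < a then 1 else 0) < C.sg := by
    have := h.fl_le i
    split_ifs <;> omega
  obtain ⟨d1, d2⟩ := digit_eq C (i / C.R) (i % C.R) _ (Nat.mod_lt _ h.R_pos) hb
  rw [Nat.div_add_mod'] at d1
  rw [show C.record (i / C.R) 5 = C.W (i / C.R) from rfl,
    show C.record (i / C.R) 4 = C.X (i / C.R) from rfl, readNat_pack hsg h hJ d2,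
    pack_digit hsg h, d1]

theorem hasVal_c (h : C.IsValid K) (hw : 100 * C.L ≤ w) (hsg : C.sg ≠ 0)
    (hρ : C.HasHeader ρ) (hi : i < C.n) (hi' : (ρ vState).toNat = i)
    (hz : (ρ vZeros).toNat = C.high (i / C.R) (i % C.R)) :
    HasVal C.L C.bits ρ cExpr (C.c i) 4 := by
  have hL : 1 ≤ C.L := by have := h.L_ge; omega
  have hJ := block_lt h hi
  have hrec := fun m (hm : m < 7) => hasVal_record h hw hsg hρ hi hi' hm
  have ht : C.record (i / C.R) 2 ≤ 1 * C.L := by rw [one_mul]; exact lowBits_le h _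
  have h1 : HasVal C.L C.bits ρ (.var vZeros) (C.high (i / C.R) (i % C.R)) 1 :=
    .var hz (by
      rw [one_mul]
      refine lt_of_le_of_lt ?_ ((h.c_lt (i / C.R * C.R + i % C.R)).trans (n_lt h))
      exact (Nat.div_le_self _ _).trans (Nat.sub_le _ _))
  have h2 := (hrec 1 (by norm_num)).add hL hw (h1.shl hw (hrec 2 (by norm_num)) ht (by norm_num))
    (by norm_num)
  have h3 := ((hrec 3 (by norm_num)).add hL hw (((hasVal_state (C := C) h hi hi').mod
    (hasVal_hdr h hρ 4 (by norm_num))).mul hw (hrec 2 (by norm_num)) (by norm_num))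
    (by norm_num)).load hw (hrec 2 (by norm_num)) ht (by norm_num)
  refine (h2.add hL hw h3 (by norm_num)).congr ?_
  have hlow := readNat_low (C := C) hsg hJ (Nat.mod_lt i h.R_pos)
  rw [show C.record (i / C.R) 2 = C.lowBits (i / C.R) from rfl,
    show C.record (i / C.R) 1 = C.c (i / C.R * C.R) from rfl, show C.header 4 = C.R from rfl, hlow,
    c_eq h, Nat.div_add_mod']

theorem hasVal_next (h : C.IsValid K) (hw : 100 * C.L ≤ w) (hρ : C.HasHeader ρ) (hi : i < C.n)
    (hi' : (ρ vState).toNat = i) (ha : a ≤ C.sg) (ha' : (ρ vLetter).toNat = a)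
    (hz : C.sg ≠ 0 → (ρ vZeros).toNat = C.high (i / C.R) (i % C.R)) :
    (nextExpr.eval C.bits ρ).toNat = C.next i a := by
  have hL : 1 ≤ C.L := by have := h.L_ge; omega
  have hsel := hasVal_hdr h hρ 1 (by norm_num)
  have hst := hasVal_state (C := C) h hi hi'
  have hpred := hst.sub ((hasVal_lit h hw 0 (by norm_num)).ltExpr hL hw hst
    (by norm_num) (by norm_num)) (by split_ifs <;> omega)
  have hnsel := (hasVal_lit h hw 1 (by norm_num)).sub hsel (Nat.min_le_right _ _)
  rw [show C.header 1 = min C.sg 1 from rfl] at hsel hnsel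
  by_cases hsg : C.sg = 0
  · rw [next, if_pos hsg]
    rw [hsg, Nat.zero_min] at hsel hnsel
    have := (hsel.zero_mul (otherExpr * entExpr + (.lit 1 - otherExpr) * cExpr)).add hL hw
      (hnsel.mul hw hpred (by norm_num)) (by norm_num)
    refine this.toNat_eq.trans ?_
    split_ifs <;> omega
  · rw [next, if_neg hsg]
    rw [Nat.min_eq_right (by omega)] at hsel hnsel
    have hl := hasVal_letter (C := C) h ha ha'
    have hfl := hasVal_fl h hw hsg hρ hi hi'
    have ho := (hfl.ltExpr hL hw hl (by norm_num) (by norm_num)).add hL hw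
      (hl.ltExpr hL hw hfl (by norm_num) (by norm_num)) (by norm_num)
    obtain ⟨x, hx, hxe⟩ := hasVal_ent h hw hsg hρ hi hi' ha ha'
    have hno := (hasVal_lit h hw 1 (by norm_num)).sub ho (by split_ifs <;> omega)
    have hgen := (ho.mul hw hx (by norm_num)).add hL hw
      (hno.mul hw (hasVal_c h hw hsg hρ hi hi' (hz hsg)) (by norm_num)) (by norm_num)
    have := (hsel.mul hw hgen (by norm_num)).add hL hw (hnsel.mul hw hpred (by norm_num))
      (by norm_num)
    refine this.toNat_eq.trans ?_
    by_cases hafl : a = C.fl i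
    · rw [if_pos hafl, if_neg (show ¬C.fl i < a by omega), if_neg (show ¬a < C.fl i by omega)]
      simp
    · rw [if_neg hafl, ← hxe hafl]
      rcases Nat.lt_or_gt_of_ne hafl with h1 | h1
      · rw [if_pos h1, if_neg (show ¬C.fl i < a by omega)]
        simp
      · rw [if_pos h1, if_neg (show ¬a < C.fl i by omega)]
        simp

end Next

/-- The program carries out a transition. -/
theorem eval_step (h : C.IsValid K) (hw : 100 * C.L ≤ w) {ρ : Fin 16 → BitVec w} {i a : ℕ}
    (hρ : C.HasHeader ρ) (hi : i < C.n) (hi' : (ρ vState).toNat = i) (ha : a ≤ C.sg)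
    (ha' : (ρ vLetter).toNat = a) :
    C.HasHeader ((stepBlock K).eval C.bits ρ) ∧
      ((stepBlock K).eval C.bits ρ vState).toNat = C.next i a := by
  refine ⟨hρ.of_eq fun v _ h2 h3 h4 h5 => eval_step_of_ne K _ _ _ h2 h3 h4 h5, ?_⟩
  set ρ' := (initBlock ++ (List.replicate (3 * K) scanBlock).flatten).eval C.bits ρ with hρ'
  have heval : (stepBlock K).eval C.bits ρ = Function.update ρ' vState
      (nextExpr.eval C.bits ρ') := by
    rw [stepBlock, Block.eval_append]; rfl
  have hne : ∀ v, v ≠ vPos → v ≠ vOnes → v ≠ vZeros → ρ' v = ρ v := by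
    intro v h3 h4 h5
    refine Block.eval_of_notMem _ _ _ _ fun s hs => ?_
    simp only [initBlock, scanBlock, List.mem_append, List.mem_flatten, List.mem_replicate,
      List.mem_cons, List.not_mem_nil, or_false] at hs
    rcases hs with (rfl | rfl | rfl) | ⟨l, ⟨-, rfl⟩, hs⟩
    · exact h3.symm
    · exact h4.symm
    · exact h5.symm
    · simp only [List.mem_cons, List.not_mem_nil, or_false] at hs
      rcases hs with rfl | rfl | rfl
      · exact h5.symm
      · exact h4.symm
      · exact h3.symm
  rw [heval, Function.update_self]
  refine hasVal_next h hw (hρ.of_eq fun v _ _ h3 h4 h5 => hne v h3 h4 h5) hi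
    (by rw [hne _ (by decide) (by decide) (by decide), hi']) ha
    (by rw [hne _ (by decide) (by decide) (by decide), ha']) fun hsg => ?_
  exact eval_scan h hw hsg hρ hi hi'

/-! ### Reading the header -/

/-- A number whose lowest one is bit number `l`, and its predecessor. -/
theorem xor_pred (l y : ℕ) :
    (2 ^ l + 2 ^ (l + 1) * y) ^^^ (2 ^ l + 2 ^ (l + 1) * y - 1) = 2 ^ (l + 1) - 1 := by
  have hpos : 0 < 2 ^ l := by positivity
  have hlt : 2 ^ l < 2 ^ (l + 1) := by rw [pow_succ]; omega
  apply Nat.eq_of_testBit_eq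
  intro j
  rw [show 2 ^ l + 2 ^ (l + 1) * y - 1 = 2 ^ (l + 1) * y + (2 ^ l - 1) by omega,
    show 2 ^ l + 2 ^ (l + 1) * y = 2 ^ (l + 1) * y + 2 ^ l by omega, Nat.testBit_xor,
    Nat.testBit_two_pow_mul_add _ hlt, Nat.testBit_two_pow_mul_add _ (by omega),
    Nat.testBit_two_pow_sub_one]
  by_cases hj : j < l + 1
  · simp only [hj, if_true, Nat.testBit_two_pow_sub_one, Nat.testBit_two_pow, decide_true]
    rcases Nat.lt_succ_iff_lt_or_eq.1 hj with h | h
    · simp [h, h.ne']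
    · simp [h]
  · simp [hj]

theorem eval_lengthBlock (h : C.IsValid K) (hw : 100 * C.L ≤ w) (ρ : Fin 16 → BitVec w) :
    (lengthBlock.eval C.bits ρ 2).toNat = C.L := by
  have hL : 5 ≤ C.L := h.L_ge
  obtain ⟨z, hz⟩ := readNat_first h (w := w) (by omega)
  set V := readNat C.bits 0 w with hV
  have hVlt : V < 2 ^ w := readNat_lt _ _ _
  have hwpos : 1 < 2 ^ w := Nat.one_lt_two_pow (by omega)
  have hLw : 2 ^ (C.L + 1) < 2 ^ w := Nat.pow_lt_pow_right (by norm_num) (by omega)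
  have h2L : 2 ^ (C.L + 1) = 2 * 2 ^ C.L := by rw [pow_succ, mul_comm]
  have hpos : 0 < 2 ^ C.L := by positivity
  set ρ1 := Function.update ρ vZeros
    ((Expr.load (.lit 0) (.lit 0 - .lit 1) : Expr 16).eval C.bits ρ) with hρ1
  have e1 : (ρ1 vZeros).toNat = V := by
    rw [hρ1, Function.update_self, Expr.eval, readBits_toNat]
    change readNat C.bits (BitVec.ofNat w 0).toNat
      (min (BitVec.ofNat w 0 - BitVec.ofNat w 1).toNat w) = V
    have h1 : (BitVec.ofNat w 0 - BitVec.ofNat w 1).toNat = 2 ^ w - 1 := by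
      rw [BitVec.toNat_sub, BitVec.toNat_ofNat, BitVec.toNat_ofNat, Nat.zero_mod, add_zero,
        Nat.mod_eq_of_lt hwpos, Nat.mod_eq_of_lt (by omega)]
    have h2 : w < 2 ^ w := Nat.lt_two_pow_self
    rw [h1, min_eq_right (by omega), BitVec.toNat_ofNat, Nat.zero_mod]
  have elit : ∀ x, x < 2 ^ w → (BitVec.ofNat w x).toNat = x := fun x hx => by
    rw [BitVec.toNat_ofNat, Nat.mod_eq_of_lt hx]
  set ρ2 := Function.update ρ1 vPos
    ((Expr.op .xor (.var vZeros) (.var vZeros - .lit 1) + .lit 1 : Expr 16).eval C.bits ρ1) with hρ2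
  have e2 : (ρ2 vPos).toNat = 2 ^ (C.L + 1) := by
    rw [hρ2, Function.update_self]
    change ((ρ1 vZeros ^^^ (ρ1 vZeros - BitVec.ofNat w 1)) + BitVec.ofNat w 1).toNat = _
    have hsub : (ρ1 vZeros - BitVec.ofNat w 1).toNat = V - 1 := by
      rw [BitVec.toNat_sub_of_le, e1, elit _ hwpos]
      rw [BitVec.le_def, e1, elit _ hwpos, hz]
      omega
    rw [BitVec.toNat_add, BitVec.toNat_xor, hsub, e1, elit _ hwpos, hz, xor_pred,
      Nat.sub_add_cancel (by omega), Nat.mod_eq_of_lt hLw]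
  have e2' : (ρ2 vZeros).toNat = V := by rw [hρ2, Function.update_of_ne (by decide), e1]
  have heval : lengthBlock.eval C.bits ρ = Function.update ρ2 2
    (((Expr.var vZeros / .var vPos) % (.var vPos / .lit 2) : Expr 16).eval C.bits ρ2) := rfl
  rw [heval, Function.update_self]
  change ((((ρ2 vZeros).udiv (ρ2 vPos)).umod ((ρ2 vPos).udiv (BitVec.ofNat w 2)))).toNat = _
  have h2w : 2 < 2 ^ w := by
    have : 2 ^ 1 ≤ 2 ^ C.L := Nat.pow_le_pow_right (by norm_num) (by omega)
    omega
  rw [BitVec.umod_eq, BitVec.toNat_umod, BitVec.udiv_eq, BitVec.toNat_udiv, BitVec.udiv_eq,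
    BitVec.toNat_udiv, e2, e2', elit _ h2w, hz, Nat.add_mul_div_left _ _ (by positivity),
    Nat.div_eq_of_lt (show 2 ^ C.L < 2 ^ (C.L + 1) by omega), zero_add, h2L,
    Nat.mul_div_cancel_left _ (by norm_num), Nat.add_mul_mod_self_left,
    Nat.mod_eq_of_lt Nat.lt_two_pow_self]

theorem hasVal_header (h : C.IsValid K) (hw : 100 * C.L ≤ w) {ρ : Fin 16 → BitVec w}
    (hρ : (ρ 2).toNat = C.L) (m : ℕ) (hm : m < 12) :
    ((headerExpr m).eval C.bits ρ).toNat = C.header m := by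
  have hL : 1 ≤ C.L := by have := h.L_ge; omega
  have h0 : HasVal C.L C.bits ρ (hdr 0) C.L 1 :=
    .var hρ (by rw [one_mul]; exact Nat.lt_two_pow_self)
  have hlm : HasVal C.L C.bits ρ (.lit m) m 4 := .lit hL hw (by norm_num) (by omega)
  have h1 := (h0.add hL hw (hasVal_lit h hw 1 (by norm_num)) (by norm_num)).add hL hw
    (hlm.mul hw h0 (by norm_num)) (by norm_num)
  exact (h1.load hw h0 (c := 1) (by rw [one_mul]) (by norm_num)).toNat_eq.trans
    (readNat_header h hm)

theorem eval_header (h : C.IsValid K) (hw : 100 * C.L ≤ w) (ρ : Fin 16 → BitVec w) :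
    C.HasHeader (headerBlock.eval C.bits ρ) ∧
      (headerBlock.eval C.bits ρ vState).toNat = C.start := by
  have key : ∀ (vs : List (Fin 16 × ℕ)) (ρ : Fin 16 → BitVec w), (∀ v ∈ vs, v.1 ≠ 2) →
      (∀ v ∈ vs, v.2 < 12) → (vs.map Prod.fst).Nodup → (ρ 2).toNat = C.L →
      (∀ v ∈ vs, (Block.eval C.bits (vs.map fun v => (v.1, headerExpr v.2)) ρ v.1).toNat =
        C.header v.2) := by
    intro vs
    induction vs with
    | nil => simp
    | cons v vs ih =>
      intro ρ h1 h2 h3 h4 u hu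
      rw [List.map_cons, Block.eval_cons]
      rw [List.map_cons, List.nodup_cons] at h3
      rcases List.mem_cons.1 hu with rfl | hu
      · rw [Block.eval_of_notMem, Function.update_self]
        · exact hasVal_header h hw h4 _ (h2 _ (by simp))
        · intro s hs
          obtain ⟨t, ht, rfl⟩ := List.mem_map.1 hs
          intro he
          exact h3.1 (List.mem_map.2 ⟨t, ht, he⟩)
      · refine ih _ (fun v hv => h1 v (by simp [hv])) (fun v hv => h2 v (by simp [hv])) h3.2 ?_ u hu
        rw [Function.update_of_ne (h1 v (by simp)).symm, h4]
  set vs : List (Fin 16 × ℕ) := [(3, 1), (4, 2), (5, 3), (6, 4), (7, 5), (8, 6), (9, 7), (10, 8),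
    (11, 9), (12, 10), (vState, 11)] with hvs
  have heval : headerBlock.eval C.bits ρ = Block.eval C.bits (vs.map fun v => (v.1, headerExpr v.2))
      (lengthBlock.eval C.bits ρ) := by
    rw [headerBlock, Block.eval_append]; rfl
  have hlen := eval_lengthBlock h hw ρ
  have hne : ∀ v ∈ vs, v.1 ≠ 2 := by decide
  have hall := key vs (lengthBlock.eval C.bits ρ) hne (by decide) (by decide) hlen
  rw [← heval] at hall
  refine ⟨fun m hm => ?_, hall (vState, 11) (by simp [hvs])⟩
  rcases Nat.eq_zero_or_pos m with rfl | h0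
  · rw [heval, Block.eval_of_notMem]
    · exact hlen
    · intro s hs
      obtain ⟨t, ht, rfl⟩ := List.mem_map.1 hs
      exact hne t ht
  · have hmem : ((⟨m + 2, by omega⟩ : Fin 16), m) ∈ vs := by
      interval_cases m <;> simp [hvs, Fin.ext_iff]
    exact hall _ hmem

theorem eval_accept (h : C.IsValid K) (hw : 100 * C.L ≤ w) {ρ : Fin 16 → BitVec w} {i : ℕ}
    (hρ : C.HasHeader ρ) (hi : i < C.n) (hi' : (ρ vState).toNat = i) :
    acceptBlock.eval C.bits ρ vState ≠ 0 ↔ C.acc i = true := by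
  have hL : 1 ≤ C.L := by have := h.L_ge; omega
  have h1 := ((hasVal_hdr h hρ 2 (by norm_num)).add hL hw (hasVal_state (C := C) h hi hi')
    (by norm_num)).load hw (hasVal_lit h hw 1 (by norm_num)) (c := 1) (by rw [one_mul]; exact hL)
    (by norm_num)
  have h2 : (acceptBlock.eval C.bits ρ vState).toNat = if C.acc i then 1 else 0 :=
    h1.toNat_eq.trans (readNat_acc C hi)
  rw [Ne, ← BitVec.toNat_inj, h2]
  split_ifs with hacc <;> simp [hacc]

/-- The program for the code of sorted automata: it computes the states that are reached, and
accepts if the last one is accepting. -/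
theorem exists_program (K : ℕ) :
    ∃ (k : ℕ) (P : Program k) (T : ℕ), ∀ (w σ : ℕ) (C : Code) (x : List (Fin σ)),
      C.IsValid K → σ = C.sg + 1 → 100 * C.L ≤ w → (∀ i < C.n, ∀ a ≤ C.sg, C.next i a < C.n) →
      DecidesWithin P w C.bits x (T * (x.length + 1))
        (C.acc (x.foldl (fun i a => C.next i a.val) C.start) = true) := by
  obtain ⟨k, P, T, hP⟩ := exists_streamProgram headerBlock (stepBlock K) acceptBlock vLetter vState
  refine ⟨k, P, T, fun w σ C x h hσ hw hn => hP w σ C.bits x _ ?_⟩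
  obtain ⟨h1, h2⟩ := eval_header h hw (fun _ => 0)
  have key : ∀ (x : List (Fin σ)) (ρ : Fin 16 → BitVec w) (i : ℕ), C.HasHeader ρ → i < C.n →
      (ρ vState).toNat = i → C.HasHeader (x.foldl (fun ρ a => (stepBlock K).eval C.bits
        (Function.update ρ vLetter (BitVec.ofNat w a.val))) ρ) ∧
      x.foldl (fun i a => C.next i a.val) i < C.n ∧
      ((x.foldl (fun ρ a => (stepBlock K).eval C.bits
        (Function.update ρ vLetter (BitVec.ofNat w a.val))) ρ) vState).toNat =
        x.foldl (fun i a => C.next i a.val) i := by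
    intro x
    induction x with
    | nil => exact fun ρ i h1 h2 h3 => ⟨h1, h2, h3⟩
    | cons a x ih =>
      intro ρ i h1 h2 h3
      have ha : a.val ≤ C.sg := by have := a.isLt; omega
      have hlt : a.val < 2 ^ w := (ha.trans_lt h.sg_lt).trans_le
        (Nat.pow_le_pow_right (by norm_num) (by omega))
      obtain ⟨s1, s2⟩ := eval_step h hw
        (ρ := Function.update ρ vLetter (BitVec.ofNat w a.val))
        (h1.of_eq fun v hv _ _ _ _ => Function.update_of_ne hv _ _) h2
        (by rw [Function.update_of_ne (by decide), h3]) ha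
        (by rw [Function.update_self, BitVec.toNat_ofNat, Nat.mod_eq_of_lt hlt])
      exact ih _ _ s1 (hn i h2 _ ha) s2
  obtain ⟨k1, k2, k3⟩ := key x _ _ h1 h.start_lt h2
  exact eval_accept h hw k1 k2 k3

end Code

/-! ### The length of the code -/

namespace Code

open WordRAM

variable {C : Code}

theorem length_bits (C : Code) : C.bits.length =
    if C.sg = 0 then C.L + 1 + 12 * C.L + C.n else C.aBlock C.nb := by
  rw [bits]
  split_ifs with h
  · simp
    ring
  · simp [aBlock, aBody, aTab, aDir, aFl, aAcc]
    ring

/-- The high and low parts of the values of `c` in a block, without the ones of the unary code, need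
at most as many bits as `c` increases over the block. -/
theorem high_add_le (h : C.IsTable) (J : ℕ) :
    C.high J (C.R - 1) + C.R * C.lowBits J ≤ C.incr J := by
  have hR := h.R_pos
  rw [high, show J * C.R + (C.R - 1) = J * C.R + C.R - 1 by omega]
  change C.incr J / 2 ^ C.lowBits J + C.R * C.lowBits J ≤ C.incr J
  rcases Nat.eq_zero_or_pos (C.lowBits J) with h0 | h0
  · rw [h0]; simp
  have hne : C.incr J / C.R ≠ 0 := by
    intro h1
    rw [lowBits, h1] at h0
    simp at h0
  have h1 : 2 ^ C.lowBits J ≤ C.incr J / C.R := Nat.pow_log_le_self 2 hne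
  have h2 : 2 ^ C.lowBits J * C.R ≤ C.incr J := (Nat.le_div_iff_mul_le hR).1 h1
  set t := C.lowBits J
  set y := C.incr J / 2 ^ t with hy
  have h3 : C.R ≤ y := by
    rw [hy, Nat.le_div_iff_mul_le (by positivity), mul_comm]
    exact h2
  have h4 : y * 2 ^ t ≤ C.incr J := Nat.div_mul_le_self _ _
  have h5 : t + 1 ≤ 2 ^ t := Nat.lt_two_pow_self
  nlinarith

theorem sum_incr_le (h : C.IsTable) (m : ℕ) : ∑ J ∈ Finset.range m, C.incr J ≤ C.c (m * C.R) := by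
  have hR := h.R_pos
  induction m with
  | zero => simp
  | succ m ih =>
    rw [Finset.sum_range_succ, incr]
    have h1 := h.monotone (show m * C.R ≤ m * C.R + C.R - 1 by omega)
    have h2 := h.monotone (show m * C.R + C.R - 1 ≤ (m + 1) * C.R by rw [add_mul]; omega)
    omega

theorem length_block (h : C.IsTable) (J : ℕ) :
    (C.block J).length ≤ C.R + C.incr J + C.groups * C.W J := by
  have h1 := high_add_le h J
  rw [block, List.length_append, List.length_append, length_arr, length_arr,
    length_unary_high h]
  omega

/-- The length of the code, part by part. The blocks without the packs of targets take
`nb * R + n` bits. -/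
theorem aBlock_le (h : C.IsTable) : C.aBlock C.nb ≤
    C.L + 1 + 12 * C.L + C.n + C.n * C.phi + C.nb * 7 * C.L +
      2 ^ C.s * (C.R + 1) * 2 * C.wt + (C.nb * C.R + C.n +
        C.groups * ∑ J ∈ Finset.range C.nb, C.W J) := by
  have h1 := sum_incr_le h C.nb
  have h2 := h.c_lt (C.nb * C.R)
  have h3 : (cat C.block C.nb).length ≤
      C.nb * C.R + C.n + C.groups * ∑ J ∈ Finset.range C.nb, C.W J := by
    rw [length_cat]
    calc ∑ J ∈ Finset.range C.nb, (C.block J).length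
        ≤ ∑ J ∈ Finset.range C.nb, (C.R + C.incr J + C.groups * C.W J) :=
          Finset.sum_le_sum fun J _ => length_block h J
      _ = C.nb * C.R + ∑ J ∈ Finset.range C.nb, C.incr J +
          C.groups * ∑ J ∈ Finset.range C.nb, C.W J := by
          rw [Finset.sum_add_distrib, Finset.sum_add_distrib, Finset.sum_const, Finset.card_range,
            smul_eq_mul, Finset.mul_sum]
      _ ≤ _ := by omega
  simp only [aBlock, aBody, aTab, aDir, aFl, aAcc]
  omega

theorem nb_mul_le (C : Code) : C.nb * C.R ≤ C.n + C.R - 1 := Nat.div_mul_le_self _ _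

theorem nb_le (h : C.IsTable) : C.nb ≤ C.n := by
  have hR := h.R_pos
  have hn := h.start_lt
  rw [nb, ← Nat.lt_succ_iff, Nat.div_lt_iff_lt_mul hR, Nat.succ_mul]
  have : C.n ≤ C.n * C.R := Nat.le_mul_of_pos_right _ hR
  omega

theorem X_le (h : C.IsTable) {J : ℕ} (hJ : J < C.nb) : C.X J ≤ (J + 1) * C.R ∧
    C.X J ≤ C.n + C.R - 1 := by
  have hR := h.R_pos
  have hn := h.start_lt
  have h1 : (J + 1) * C.R ≤ C.nb * C.R := Nat.mul_le_mul_right _ hJ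
  have h2 := nb_mul_le C
  rw [add_mul, one_mul] at *
  rw [X]
  have : 0 ≤ J * C.R := Nat.zero_le _
  omega

theorem W_le_four_mul (C : Code) (J : ℕ) : C.W J ≤ 4 * C.X J := by
  rw [W, Nat.clog_le_iff_le_pow (by norm_num), mul_comm, pow_mul]
  exact Nat.pow_le_pow_left (Nat.lt_two_pow_self).le 4

/-- The parameters that are used satisfy the bounds on which the program relies. -/
theorem isValid_of_size (h : C.IsTable) {l : ℕ} (hl : l = Nat.size (C.n * (C.sg + 1)))
    (hL : C.L = 60 * l) (hs : C.s = Nat.size C.n / 4 + 1) (hR : C.R ≤ 2 ^ 17 * C.s) :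
    C.IsValid (2 ^ 17) := by
  have hn : 1 ≤ C.n := by have := h.start_lt; omega
  set B := 2 ^ l with hB
  have hnB : C.n * (C.sg + 1) < B := by rw [hB, hl]; exact Nat.lt_size_self _
  have hl1 : 1 ≤ l := by
    rw [hl]
    exact Nat.size_pos.2 (by positivity)
  have hB2 : 2 ≤ B := by
    calc 2 = 2 ^ 1 := rfl
      _ ≤ B := Nat.pow_le_pow_right (by norm_num) hl1
  have hn1 : C.n ≤ B := by nlinarith
  have hsg1 : C.sg ≤ B := by nlinarith
  have hlB : l ≤ B := Nat.lt_two_pow_self.le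
  have hsn : C.s ≤ Nat.size C.n := by
    have : 1 ≤ Nat.size C.n := Nat.size_pos.2 hn
    omega
  have hsl : C.s ≤ l := hsn.trans (by rw [hl]; exact Nat.size_le_size (by nlinarith))
  have hLB : 2 ^ C.L = B ^ 60 := by rw [hL, hB, ← pow_mul, mul_comm]
  have hpow : ∀ k m : ℕ, 2 ^ k * B ^ m ≤ B ^ (k + m) := fun k m => by
    rw [pow_add]; exact Nat.mul_le_mul_right _ (Nat.pow_le_pow_left hB2 k)
  have hlt : ∀ k m x : ℕ, x ≤ 2 ^ k * B ^ m → k + m < 60 → x < 2 ^ C.L := fun k m x hx hkm => by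
    rw [hLB]
    exact (hx.trans (hpow k m)).trans_lt (Nat.pow_lt_pow_right hB2 hkm)
  have hR1 : C.R ≤ 2 ^ 17 * B := hR.trans (Nat.mul_le_mul_left _ (hsl.trans hlB))
  have hX : ∀ J < C.nb, C.X J ≤ 2 ^ 18 * B := fun J hJ => by
    have := (X_le h hJ).2
    have := h.R_pos
    omega
  refine { toIsTable := h, R_le := hR, L_ge := by omega,
           sg_lt := hlt 0 1 _ (by simpa using hsg1) (by norm_num),
           scan_lt := hlt 19 1 _ (by nlinarith) (by norm_num), s_le := by omega,
           X_lt := fun J hJ => hlt 18 1 _ (by simpa using hX J hJ) (by norm_num), addr_lt := ?_ }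
  refine hlt 42 4 _ ((aBlock_le h).trans ?_) (by norm_num)
  have hphi : C.phi ≤ B := by
    refine Nat.size_le.2 ?_
    exact hsg1.trans_lt Nat.lt_two_pow_self
  have hnb := (nb_le h).trans hn1
  have h2s : 2 ^ C.s ≤ B := Nat.pow_le_pow_right (by norm_num) hsl
  have hwt : C.wt ≤ 2 ^ 18 * B := by
    refine le_trans (Nat.size_le.2 Nat.lt_two_pow_self) ?_
    omega
  have hgr : C.groups ≤ 2 ^ 18 * B ^ 2 := by
    have h1 : C.R * C.sg ≤ 2 ^ 17 * B * B := Nat.mul_le_mul hR1 hsg1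
    have h2 : 1 ≤ B ^ 2 := Nat.one_le_pow _ _ (by omega)
    rw [groups]
    have h3 : 2 ^ 17 * B * B = 2 ^ 17 * B ^ 2 := by ring
    omega
  have hW : ∑ J ∈ Finset.range C.nb, C.W J ≤ B * (2 ^ 20 * B) := by
    calc ∑ J ∈ Finset.range C.nb, C.W J ≤ ∑ J ∈ Finset.range C.nb, 2 ^ 20 * B :=
          Finset.sum_le_sum fun J hJ => by
            have h1 := hX J (Finset.mem_range.1 hJ)
            have h2 := W_le_four_mul C J
            omega
      _ = C.nb * (2 ^ 20 * B) := by simp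
      _ ≤ _ := Nat.mul_le_mul_right _ hnb
  have m1 : C.n * C.phi ≤ B * B := Nat.mul_le_mul hn1 hphi
  have hLle : C.L ≤ 60 * B := by omega
  have m2 : C.nb * 7 * C.L ≤ B * 7 * (60 * B) :=
    Nat.mul_le_mul (Nat.mul_le_mul_right _ hnb) hLle
  have m3 : 2 ^ C.s * (C.R + 1) * 2 * C.wt ≤ B * (2 ^ 18 * B) * 2 * (2 ^ 18 * B) :=
    Nat.mul_le_mul (Nat.mul_le_mul_right _ (Nat.mul_le_mul h2s (by omega))) hwt
  have m4 : C.nb * C.R ≤ B * (2 ^ 17 * B) := Nat.mul_le_mul hnb hR1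
  have m5 : C.groups * ∑ J ∈ Finset.range C.nb, C.W J ≤ 2 ^ 18 * B ^ 2 * (B * (2 ^ 20 * B)) :=
    Nat.mul_le_mul hgr hW
  have b1 : B ≤ B ^ 4 := Nat.le_self_pow (by norm_num) B
  have b2 : B ^ 2 ≤ B ^ 4 := Nat.pow_le_pow_right (by omega) (by norm_num)
  have b3 : B ^ 3 ≤ B ^ 4 := Nat.pow_le_pow_right (by omega) (by norm_num)
  ring_nf at m1 m2 m3 m4 m5 ⊢
  ring_nf at b1 b2 b3
  omega

end Code

namespace Code

open WordRAM Real

/-! ### Estimates for logarithms -/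

theorem inv_log_two_bounds : 1.44 ≤ 1 / log 2 ∧ 1 / log 2 ≤ 1.5 := by
  have h1 := Real.log_two_gt_d9
  have h2 := Real.log_two_lt_d9
  have h3 : 0 < log 2 := by linarith
  rw [le_div_iff₀ h3, div_le_iff₀ h3]
  constructor <;> linarith

/-- A form of Stirling's bound, `m! ≤ m * m ^ m * exp (1 - m)`. -/
theorem sum_logb_le (m : ℕ) (hm : 1 ≤ m) :
    ∑ J ∈ Finset.range m, logb 2 ((J : ℝ) + 1) ≤
      m * logb 2 m - 1.44 * ((m : ℝ) - 1) + logb 2 m := by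
  induction m, hm using Nat.le_induction with
  | base => simp
  | succ m hm ih =>
    rw [Finset.sum_range_succ]
    have hm0 : (0 : ℝ) < m := by exact_mod_cast hm
    have h1 : 1 / ((m : ℝ) + 1) ≤ log (m + 1) - log m := by
      rw [← Real.log_div (by positivity) (by positivity)]
      have := Real.one_sub_inv_le_log_of_pos (x := ((m : ℝ) + 1) / m) (by positivity)
      refine le_trans (le_of_eq ?_) this
      field_simp
      ring
    have h2 : 1.44 ≤ ((m : ℝ) + 1) * (logb 2 (m + 1) - logb 2 m) := by
      rw [logb, logb, ← sub_div]
      have h3 : 1 ≤ ((m : ℝ) + 1) * (log (m + 1) - log m) := by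
        rw [div_le_iff₀ (by positivity)] at h1
        linarith
      have h4 : (0 : ℝ) < log 2 := Real.log_pos (by norm_num)
      calc (1.44 : ℝ) ≤ 1 / log 2 := inv_log_two_bounds.1
        _ ≤ (((m : ℝ) + 1) * (log (m + 1) - log m)) / log 2 := by gcongr
        _ = _ := by ring
    push_cast
    nlinarith

theorem logb_add_le {x y : ℝ} (hx : 0 < x) (hy : 0 ≤ y) :
    logb 2 (x + y) ≤ logb 2 x + 1.5 * (y / x) := by
  have h0 : x + y = x * (1 + y / x) := by field_simp
  have h1 : (0 : ℝ) < 1 + y / x := by positivity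
  have h2 : log (1 + y / x) ≤ y / x := by
    have := Real.log_le_sub_one_of_pos h1
    linarith
  have h4 : (0 : ℝ) < log 2 := Real.log_pos (by norm_num)
  rw [h0, Real.logb_mul hx.ne' h1.ne']
  have h5 : logb 2 (1 + y / x) ≤ y / x * (1 / log 2) := by
    rw [logb, div_eq_mul_one_div]
    gcongr
  have h6 : y / x * (1 / log 2) ≤ y / x * 1.5 := by
    have := inv_log_two_bounds.2
    gcongr
  linarith

/-- An elementary form of `(1 + 1 / m) ^ m ≥ 2`. -/
theorem one_le_mul_logb_sub (m : ℕ) (hm : 1 ≤ m) :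
    1 ≤ (m : ℝ) * (logb 2 (m + 1) - logb 2 m) := by
  have hm0 : (0 : ℝ) < m := by exact_mod_cast hm
  have h1 := one_add_mul_le_pow (a := 1 / (m : ℝ)) (by
    have : (0 : ℝ) ≤ 1 / m := by positivity
    linarith) m
  rw [mul_one_div_cancel hm0.ne'] at h1
  have h2 : 1 + 1 / (m : ℝ) = (m + 1) / m := by field_simp
  have h3 := Real.logb_le_logb_of_le (b := 2) (by norm_num) (by norm_num) h1
  rw [Real.logb_pow, h2, Real.logb_div (by positivity) (by positivity)] at h3
  calc (1 : ℝ) = logb 2 (1 + 1) := by norm_num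
    _ ≤ _ := h3

/-- A variant of the bound `2 ^ (n - 1) * (n - 1)! ≤ n ^ (n - 1)`. It leaves a bit for rounding each
target when every block is a single row; the targets of rows `0` and `1` need no bits. -/
theorem sum_logb_add_one_le (n : ℕ) (hn : 1 ≤ n) :
    ∑ J ∈ Finset.range n, (if J ≤ 1 then 0 else logb 2 (J : ℝ) + 1) ≤
      ((n : ℝ) - 1) * logb 2 n := by
  induction n, hn using Nat.le_induction with
  | base => simp
  | succ n hn ih =>
    rw [Finset.sum_range_succ]
    have h := one_le_mul_logb_sub n hn
    have h0 : 0 ≤ logb 2 (n : ℝ) := Real.logb_nonneg (by norm_num) (by exact_mod_cast hn)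
    push_cast
    split_ifs
    · nlinarith
    · nlinarith

theorem natSize_bounds (n : ℕ) (hn : 1 ≤ n) :
    logb 2 n ≤ Nat.size n ∧ (Nat.size n : ℝ) ≤ logb 2 n + 1 := by
  have hn0 : (0 : ℝ) < n := by exact_mod_cast hn
  constructor
  · rw [Real.logb_le_iff_le_rpow (by norm_num) hn0, Real.rpow_natCast]
    exact_mod_cast (Nat.lt_size_self n).le
  · have h1 : 1 ≤ Nat.size n := Nat.size_pos.2 hn
    have h2 : 2 ^ (Nat.size n - 1) ≤ n := Nat.lt_size.1 (by omega)
    have h3 : ((Nat.size n - 1 : ℕ) : ℝ) ≤ logb 2 n := by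
      rw [Real.le_logb_iff_rpow_le (by norm_num) hn0, Real.rpow_natCast]
      exact_mod_cast h2
    rw [Nat.cast_sub h1] at h3
    push_cast at h3
    linarith

theorem one_le_logb_succ (m : ℕ) (hm : 1 ≤ m) : 1 ≤ logb 2 ((m : ℝ) + 1) := by
  rw [Real.le_logb_iff_rpow_le (by norm_num) (by positivity), Real.rpow_one]
  have : (1 : ℝ) ≤ m := by exact_mod_cast hm
  linarith

theorem natSize_succ_le (m : ℕ) (hm : 1 ≤ m) :
    (Nat.size (m + 1) : ℝ) ≤ logb 2 ((m : ℝ) + 1) ^ 2 + 1 := by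
  have h1 := (natSize_bounds (m + 1) (by omega)).2
  have h2 := one_le_logb_succ m hm
  push_cast at h1
  nlinarith

/-- The bit length of `n` and the powers of two of a quarter of it, in terms of the fourth root. -/
theorem natSize_le_fourth_root (n : ℕ) (hn : 1 ≤ n) :
    1 ≤ (n : ℝ) ^ (1 / 4 : ℝ) ∧ (Nat.size n : ℝ) ≤ 5 * (n : ℝ) ^ (1 / 4 : ℝ) ∧
      (2 : ℝ) ^ (Nat.size n / 4 + 1) ≤ 4 * (n : ℝ) ^ (1 / 4 : ℝ) := by
  have hn1 : (1 : ℝ) ≤ n := by exact_mod_cast hn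
  have hn0 : (0 : ℝ) < n := by linarith
  have hy : (n : ℝ) ^ (1 / 4 : ℝ) = 2 ^ (logb 2 n / 4) := by
    conv_lhs => rw [← Real.rpow_logb (b := 2) (by norm_num) (by norm_num) hn0]
    rw [← Real.rpow_mul (by norm_num)]
    ring_nf
  obtain ⟨-, h2⟩ := natSize_bounds n hn
  have h1 : 1 ≤ (n : ℝ) ^ (1 / 4 : ℝ) := Real.one_le_rpow hn1 (by norm_num)
  have h3 : logb 2 n / 4 ≤ 2 ^ (logb 2 n / 4) := by
    set x := logb 2 n / 4 with hx
    have hx0 : 0 ≤ x := div_nonneg (Real.logb_nonneg (by norm_num) hn1) (by norm_num)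
    rcases le_total x 1 with hx1 | hx1
    · exact hx1.trans (Real.one_le_rpow (by norm_num) hx0)
    · have := one_add_mul_self_le_rpow_one_add (s := (1 : ℝ)) (by norm_num) hx1
      norm_num at this
      linarith
  refine ⟨h1, ?_, ?_⟩
  · rw [← hy] at h3
    linarith
  · rw [hy, pow_succ, ← Real.rpow_natCast]
    have h4 : ((Nat.size n / 4 : ℕ) : ℝ) ≤ logb 2 n / 4 + 1 := by
      have : ((Nat.size n / 4 : ℕ) : ℝ) ≤ (Nat.size n : ℝ) / 4 := Nat.cast_div_le
      linarith
    have h5 : (2 : ℝ) ^ ((Nat.size n / 4 : ℕ) : ℝ) ≤ 2 ^ (logb 2 n / 4 + 1) :=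
      Real.rpow_le_rpow_of_exponent_le (by norm_num) h4
    rw [Real.rpow_add (by norm_num), Real.rpow_one] at h5
    linarith

/-! ### The length of the code, in terms of logarithms -/

variable {C : Code}

theorem W_le_logb (C : Code) (J : ℕ) : (C.W J : ℝ) ≤ 4 * logb 2 (C.X J) + 1 := by
  have hX := X_pos (C := C) J
  have hX0 : (0 : ℝ) < C.X J := by exact_mod_cast hX
  have hnn : 0 ≤ logb 2 (C.X J : ℝ) := Real.logb_nonneg (by norm_num) (by exact_mod_cast hX)
  rw [W]
  rcases Nat.lt_or_ge 1 (C.X J ^ 4) with h1 | h1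
  · have h2 := (Nat.pow_pred_clog_lt_self (b := 2) (by norm_num) h1).le
    have h3 : 1 ≤ Nat.clog 2 (C.X J ^ 4) := Nat.clog_pos (by norm_num) h1
    have h4 : ((Nat.clog 2 (C.X J ^ 4)).pred : ℝ) ≤ 4 * logb 2 (C.X J) := by
      rw [show (4 : ℝ) = ((4 : ℕ) : ℝ) by norm_num, ← Real.logb_pow,
        Real.le_logb_iff_rpow_le (by norm_num) (by positivity), Real.rpow_natCast]
      exact_mod_cast h2
    rw [Nat.pred_eq_sub_one, Nat.cast_sub h3] at h4
    push_cast at h4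
    linarith
  · rw [Nat.clog_of_right_le_one h1]
    push_cast
    linarith

theorem W_eq_zero {J : ℕ} (h : C.X J = 1) : C.W J = 0 := by
  rw [W, h]; simp

/-- The packs of four targets in a block. With four targets to a pack, the rounding to whole bits
costs `1 / 4` bit per target. -/
theorem groups_mul_le (C : Code) (J : ℕ) : (C.groups : ℝ) * C.W J ≤
    C.sg * (C.R * (logb 2 (C.X J) + 1 / 4)) + (3 * logb 2 (C.X J) + 1) := by
  have h1 := W_le_logb C J
  have h2 : (C.groups : ℝ) ≤ (C.R * C.sg + 3) / 4 := by
    rw [groups]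
    refine Nat.cast_div_le.trans ?_
    push_cast
    rfl
  have hnn : 0 ≤ logb 2 (C.X J : ℝ) :=
    Real.logb_nonneg (by norm_num) (by exact_mod_cast X_pos (C := C) J)
  calc (C.groups : ℝ) * C.W J ≤ (C.R * C.sg + 3) / 4 * (4 * logb 2 (C.X J) + 1) := by gcongr
    _ = C.sg * (C.R * (logb 2 (C.X J) + 1 / 4)) + (3 * logb 2 (C.X J) + 3 / 4) := by ring
    _ ≤ _ := by gcongr; norm_num

/-- The size of the lookup table. -/
theorem table_le (h : C.IsTable) (hs : C.s = Nat.size C.n / 4 + 1) (hR : C.R ≤ 2 ^ 17 * C.s) :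
    ((2 ^ C.s * (C.R + 1) * 2 * C.wt : ℕ) : ℝ) ≤
      800 * 2 ^ 34 * ((C.n : ℝ) ^ (1 / 4 : ℝ)) ^ 3 := by
  have hn : 1 ≤ C.n := by have := h.start_lt; omega
  have hS : 1 ≤ Nat.size C.n := Nat.size_pos.2 hn
  obtain ⟨h1, h2, h3⟩ := natSize_le_fourth_root C.n hn
  rw [← hs] at h3
  set y := (C.n : ℝ) ^ (1 / 4 : ℝ)
  have a1 : C.R + 1 ≤ 2 ^ 18 * Nat.size C.n := by omega
  have a2 : C.wt ≤ 2 ^ 18 * Nat.size C.n := by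
    refine le_trans (Nat.size_le.2 Nat.lt_two_pow_self) ?_
    omega
  have b1 : ((C.R + 1 : ℕ) : ℝ) ≤ 2 ^ 18 * (5 * y) := by
    refine (Nat.cast_le.2 a1).trans ?_
    push_cast
    gcongr
    norm_num
  have b2 : (C.wt : ℝ) ≤ 2 ^ 18 * (5 * y) := by
    refine (Nat.cast_le.2 a2).trans ?_
    push_cast
    gcongr
    norm_num
  rw [Nat.cast_mul, Nat.cast_mul, Nat.cast_mul]
  calc ((2 ^ C.s : ℕ) : ℝ) * ((C.R + 1 : ℕ) : ℝ) * ((2 : ℕ) : ℝ) * (C.wt : ℝ)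
      ≤ 4 * y * (2 ^ 18 * (5 * y)) * 2 * (2 ^ 18 * (5 * y)) := by
        push_cast at b1 ⊢
        gcongr
    _ = _ := by ring

theorem L_le (hL : C.L = 60 * Nat.size (C.n * (C.sg + 1))) :
    C.L ≤ 60 * (Nat.size C.n + Nat.size (C.sg + 1)) := by
  rw [hL]
  refine Nat.mul_le_mul_left _ (Nat.size_le.2 ?_)
  rw [pow_add]
  exact Nat.mul_lt_mul'' (Nat.lt_size_self _) (Nat.lt_size_self _)

/-- The length for few states, with a block for each state. -/
theorem aBlock_le_of_small (h : C.IsTable) (hsg : 1 ≤ C.sg) {n₀ : ℕ} (hn₀ : C.n ≤ n₀)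
    (hL : C.L = 60 * Nat.size (C.n * (C.sg + 1))) (hs : C.s = Nat.size C.n / 4 + 1)
    (hR : C.R = 1) :
    (C.aBlock C.nb : ℝ) ≤ C.sg * ((C.n - 1) * logb 2 C.n) +
      2 * (n₀ + 60 * (13 + 7 * n₀)) * logb 2 (C.sg + 1) ^ 2 +
      (800 * 2 ^ 34 * ((C.n : ℝ) ^ (1 / 4 : ℝ)) ^ 3 +
        (1 + 4 * n₀ + 3 * n₀ ^ 2 + 60 * n₀ * (13 + 7 * n₀))) := by
  have hn : 1 ≤ C.n := by have := h.start_lt; omega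
  have hnb : C.nb = C.n := by rw [nb, hR]; simp
  have h0 := aBlock_le h
  have hT := table_le h hs (by omega)
  have hLle := L_le hL
  have hSn : Nat.size C.n ≤ C.n := Nat.size_le.2 Nat.lt_two_pow_self
  have hphi : C.phi ≤ Nat.size (C.sg + 1) := Nat.size_le_size (Nat.le_succ _)
  have hS' : (Nat.size (C.sg + 1) : ℝ) ≤ 2 * logb 2 (C.sg + 1) ^ 2 := by
    have h1 := natSize_succ_le C.sg hsg
    have h2 := one_le_logb_succ C.sg hsg
    nlinarith only [h1, h2]
  have hW : ((C.groups * ∑ J ∈ Finset.range C.nb, C.W J : ℕ) : ℝ) ≤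
      C.sg * ((C.n - 1) * logb 2 C.n) + (3 * C.n ^ 2 + C.n) := by
    have hterm : ∀ J ∈ Finset.range C.n, (C.groups : ℝ) * C.W J ≤
        C.sg * (if J ≤ 1 then 0 else logb 2 (J : ℝ) + 1) + (3 * C.n + 1) := by
      intro J hJ
      have hXJ : C.X J = max 1 J := by rw [X, hR]; simp
      split_ifs with hJ1
      · rw [W_eq_zero (by rw [hXJ]; omega)]
        simp
        positivity
      · have hXJ' : C.X J = J := by rw [hXJ]; omega
        have h1 := groups_mul_le C J
        rw [hXJ', hR] at h1
        have hJn : (J : ℝ) ≤ C.n := by exact_mod_cast (Finset.mem_range.1 hJ).le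
        have h2 : logb 2 (J : ℝ) ≤ J :=
          ((natSize_bounds J (by omega)).1).trans
            (by exact_mod_cast Nat.size_le.2 Nat.lt_two_pow_self)
        have h3 : (0 : ℝ) ≤ C.sg := by positivity
        push_cast at h1
        nlinarith
    calc ((C.groups * ∑ J ∈ Finset.range C.nb, C.W J : ℕ) : ℝ)
        = ∑ J ∈ Finset.range C.n, (C.groups : ℝ) * C.W J := by
          rw [hnb]; push_cast; rw [Finset.mul_sum]
      _ ≤ ∑ J ∈ Finset.range C.n, ((C.sg : ℝ) * (if J ≤ 1 then 0 else logb 2 (J : ℝ) + 1) +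
          (3 * C.n + 1)) := Finset.sum_le_sum hterm
      _ = C.sg * ∑ J ∈ Finset.range C.n, (if J ≤ 1 then 0 else logb 2 (J : ℝ) + 1) +
          C.n * (3 * C.n + 1) := by
          rw [Finset.sum_add_distrib, ← Finset.mul_sum, Finset.sum_const, Finset.card_range,
            nsmul_eq_mul]
      _ ≤ C.sg * ((C.n - 1) * logb 2 C.n) + C.n * (3 * C.n + 1) := by
          have := sum_logb_add_one_le C.n hn
          gcongr
      _ = _ := by ring
  rw [hnb, hR] at h0
  have hn0R : (C.n : ℝ) ≤ n₀ := by exact_mod_cast hn₀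
  have key : ((C.L + 1 + 12 * C.L + C.n + C.n * C.phi + C.n * 7 * C.L + (C.n * 1 + C.n) : ℕ) : ℝ) ≤
      (1 + 3 * n₀ + 60 * n₀ * (13 + 7 * n₀)) +
        (n₀ + 60 * (13 + 7 * n₀)) * (2 * logb 2 (C.sg + 1) ^ 2) := by
    have h1 : C.L + 1 + 12 * C.L + C.n + C.n * C.phi + C.n * 7 * C.L + (C.n * 1 + C.n) ≤
        (1 + 3 * n₀ + 60 * n₀ * (13 + 7 * n₀)) +
          (n₀ + 60 * (13 + 7 * n₀)) * Nat.size (C.sg + 1) := by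
      have i1 : C.n * C.phi ≤ n₀ * Nat.size (C.sg + 1) := Nat.mul_le_mul hn₀ hphi
      have i2 : C.L * (13 + 7 * C.n) ≤ 60 * (n₀ + Nat.size (C.sg + 1)) * (13 + 7 * n₀) :=
        Nat.mul_le_mul (by omega) (by omega)
      nlinarith
    refine (Nat.cast_le.2 h1).trans ?_
    push_cast
    gcongr
  rw [hnb] at hW ⊢
  have h0R := Nat.cast_le (α := ℝ).2 h0
  rw [show C.L + 1 + 12 * C.L + C.n + C.n * C.phi + C.n * 7 * C.L +
      2 ^ C.s * (1 + 1) * 2 * C.wt + (C.n * 1 + C.n + C.groups * ∑ J ∈ Finset.range C.n, C.W J) =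
      (C.L + 1 + 12 * C.L + C.n + C.n * C.phi + C.n * 7 * C.L + (C.n * 1 + C.n)) +
      2 ^ C.s * (1 + 1) * 2 * C.wt + C.groups * ∑ J ∈ Finset.range C.n, C.W J by ring,
    Nat.cast_add, Nat.cast_add] at h0R
  rw [hR] at hT
  have hsq : (C.n : ℝ) ^ 2 ≤ (n₀ : ℝ) ^ 2 := by gcongr
  linarith

theorem le_nb_mul (h : C.IsTable) : C.n ≤ C.nb * C.R := by
  have hR := h.R_pos
  have h1 := Nat.lt_div_mul_add hR (a := C.n + C.R - 1)
  rw [nb]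
  omega

/-- A position is bounded by the end of its block, which makes the targets of all blocks together
as cheap as `n!` rather than `n ^ n`. -/
theorem mul_sum_logb_X_le (h : C.IsTable) (hRn : C.R ≤ C.n) :
    (C.R : ℝ) * ∑ J ∈ Finset.range C.nb, logb 2 (C.X J) ≤
      C.n * logb 2 C.n - 1.44 * C.n + C.R * (2 * logb 2 C.n + 4.44) := by
  have hn : 1 ≤ C.n := by have := h.start_lt; omega
  have hR : (0 : ℝ) < C.R := by exact_mod_cast h.R_pos
  have hn0 : (1 : ℝ) ≤ C.n := by exact_mod_cast hn
  have hRn' : (C.R : ℝ) ≤ C.n := by exact_mod_cast hRn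
  have hM1 : (C.n : ℝ) ≤ C.nb * C.R := by exact_mod_cast le_nb_mul h
  have hM2 : (C.nb : ℝ) * C.R ≤ C.n + C.R := by
    have := nb_mul_le C
    exact_mod_cast (by omega : C.nb * C.R ≤ C.n + C.R)
  have hnb : 1 ≤ C.nb := by
    have := le_nb_mul h
    by_contra h0
    rw [show C.nb = 0 by omega] at this
    omega
  have hnb0 : (0 : ℝ) < C.nb := by exact_mod_cast hnb
  have h1 : ∑ J ∈ Finset.range C.nb, logb 2 (C.X J : ℝ) ≤
      ∑ J ∈ Finset.range C.nb, (logb 2 ((J : ℝ) + 1) + logb 2 C.R) := by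
    refine Finset.sum_le_sum fun J hJ => ?_
    rw [← Real.logb_mul (by positivity) hR.ne']
    refine Real.logb_le_logb_of_le (by norm_num) (by exact_mod_cast X_pos (C := C) J) ?_
    exact_mod_cast (X_le h (Finset.mem_range.1 hJ)).1
  rw [Finset.sum_add_distrib, Finset.sum_const, Finset.card_range, nsmul_eq_mul] at h1
  have h2 := sum_logb_le C.nb hnb
  have h3 : logb 2 ((C.nb : ℝ) * C.R) = logb 2 C.nb + logb 2 C.R :=
    Real.logb_mul hnb0.ne' hR.ne'
  have h4 : logb 2 ((C.nb : ℝ) * C.R) ≤ logb 2 C.n + 1.5 * (C.R / C.n) :=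
    (Real.logb_le_logb_of_le (by norm_num) (by positivity) hM2).trans
      (logb_add_le (by linarith) hR.le)
  have h5 : logb 2 (C.nb : ℝ) ≤ logb 2 C.n :=
    Real.logb_le_logb_of_le (by norm_num) hnb0 (by exact_mod_cast nb_le h)
  have hlg : 0 ≤ logb 2 (C.n : ℝ) := Real.logb_nonneg (by norm_num) hn0
  have h6 : (C.nb : ℝ) * C.R * logb 2 ((C.nb : ℝ) * C.R) ≤
      (C.n + C.R) * (logb 2 C.n + 1.5 * (C.R / C.n)) := by
    have : 0 ≤ logb 2 ((C.nb : ℝ) * C.R) :=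
      Real.logb_nonneg (by norm_num) (by linarith)
    gcongr
  have h7 : (C.n + C.R) * (logb 2 C.n + 1.5 * (C.R / C.n)) ≤
      (C.n : ℝ) * logb 2 C.n + C.R * logb 2 C.n + 3 * C.R := by
    have : (C.n + C.R) * (1.5 * ((C.R : ℝ) / C.n)) ≤ (C.n + C.n) * (1.5 * (C.R / C.n)) := by gcongr
    have e : (C.n + C.n) * (1.5 * ((C.R : ℝ) / C.n)) = 3 * C.R := by field_simp; norm_num
    nlinarith
  have h8 := mul_le_mul_of_nonneg_left (h1.trans (add_le_add_left h2 _)) hR.le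
  have h9 := mul_le_mul_of_nonneg_left h5 hR.le
  rw [h3] at h6
  nlinarith

/-- The length for many states. Since the targets of each block are bounded by its position, they
take `1.44 * n` bits less per letter than `n * logb 2 n`. This pays for the letters `fl` (`n` bits),
the rounding in the packs (`n / 4` bits) and, as `R` is a large multiple of `log n`, the directory
(less than `0.04 * n` bits); what is left outweighs the terms of order `(log n) ^ 2`. -/
theorem aBlock_le_of_large (h : C.IsTable) (hsg : 1 ≤ C.sg) (hn₀ : (2 * 10 ^ 8) ^ 2 ≤ C.n)
    (hL : C.L = 60 * Nat.size (C.n * (C.sg + 1))) (hs : C.s = Nat.size C.n / 4 + 1)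
    (hR : C.R = 2 ^ 17 * C.s) :
    (C.aBlock C.nb : ℝ) ≤ C.sg * ((C.n - 1) * logb 2 C.n) + 3 * C.n +
      780 * logb 2 (C.sg + 1) ^ 2 +
      (800 * 2 ^ 34 + 781 + 5 * (780 + 2 ^ 17)) * ((C.n : ℝ) ^ (1 / 4 : ℝ)) ^ 3 := by
  have hn : 1 ≤ C.n := by have := h.start_lt; omega
  have hS1 : 1 ≤ Nat.size C.n := Nat.size_pos.2 hn
  have hT := table_le h hs hR.le
  obtain ⟨hy1, hSy, -⟩ := natSize_le_fourth_root C.n hn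
  have hyn : ((C.n : ℝ) ^ (1 / 4 : ℝ)) ^ 4 = C.n := by
    rw [← Real.rpow_natCast, ← Real.rpow_mul (by positivity)]
    norm_num
  have hlgS := (natSize_bounds C.n hn).1
  set y := (C.n : ℝ) ^ (1 / 4 : ℝ)
  have hy2 : 2 * 10 ^ 8 ≤ y ^ 2 := by
    have h1 : ((2 * 10 ^ 8 : ℝ)) ^ 2 ≤ (y ^ 2) ^ 2 := by
      rw [← pow_mul, hyn]
      exact_mod_cast hn₀
    exact (pow_le_pow_iff_left₀ (by positivity) (by positivity) two_ne_zero).1 h1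
  have hSS : (Nat.size C.n : ℝ) ^ 2 ≤ 25 * y ^ 2 := by
    calc (Nat.size C.n : ℝ) ^ 2 ≤ (5 * y) ^ 2 := by gcongr
      _ = _ := by ring
  -- the terms of order `S ^ 2` are small; this is where the lower bound on `n` is used
  have hbig : 918772 * (Nat.size C.n : ℝ) ^ 2 ≤ 0.15 * C.n := by
    rw [← hyn]
    nlinarith
  have hs1 : (C.s : ℝ) ≤ Nat.size C.n := by exact_mod_cast (by omega : C.s ≤ Nat.size C.n)
  have hs4 : (Nat.size C.n : ℝ) ≤ 4 * C.s := by
    exact_mod_cast (by omega : Nat.size C.n ≤ 4 * C.s)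
  have hRR : (C.R : ℝ) = 2 ^ 17 * C.s := by rw [hR]; push_cast; norm_num
  have hS1R : (1 : ℝ) ≤ Nat.size C.n := by exact_mod_cast hS1
  have hLle : (C.L : ℝ) ≤ 60 * ((Nat.size C.n : ℝ) + Nat.size (C.sg + 1)) := by
    exact_mod_cast L_le hL
  set S : ℝ := (Nat.size C.n : ℝ)
  have hSsq : S ≤ S ^ 2 := le_self_pow₀ hS1R (by norm_num)
  have hRS : (C.R : ℝ) ≤ 2 ^ 17 * S := by rw [hRR]; gcongr
  have hRn' : (C.R : ℝ) ≤ C.n := by linarith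
  have hRn : C.R ≤ C.n := by exact_mod_cast hRn'
  have hn1 : (1 : ℝ) ≤ C.n := by exact_mod_cast hn
  have hsgR : (1 : ℝ) ≤ C.sg := by exact_mod_cast hsg
  have hlg : 0 ≤ logb 2 (C.n : ℝ) := Real.logb_nonneg (by norm_num) hn1
  have hM2 : (C.nb : ℝ) * C.R ≤ C.n + C.R := by
    have := nb_mul_le C
    exact_mod_cast (by omega : C.nb * C.R ≤ C.n + C.R)
  -- the number of blocks
  have hnbS : (C.nb : ℝ) * S ≤ 4 / 2 ^ 17 * C.n + S := by
    have h0 : (C.nb : ℝ) - 1 ≤ C.n / C.R := by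
      rw [le_div_iff₀ (by exact_mod_cast h.R_pos)]
      linarith
    have hs0 : (0 : ℝ) < C.s := by linarith
    have h1 : (C.n : ℝ) / C.R * S ≤ C.n / C.R * (4 * C.s) := by gcongr
    have h2 : (C.n : ℝ) / C.R * (4 * C.s) = 4 / 2 ^ 17 * C.n := by
      rw [hRR]; field_simp
    nlinarith
  -- the targets
  have hG : ((C.groups * ∑ J ∈ Finset.range C.nb, C.W J : ℕ) : ℝ) ≤
      C.sg * (C.n * logb 2 C.n - 1.44 * C.n + C.R * (2 * logb 2 C.n + 4.44) +
        (C.n + C.R) / 4) + C.nb * (7 * S) := by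
    have hterm : ∀ J ∈ Finset.range C.nb, (C.groups : ℝ) * C.W J ≤
        C.sg * (C.R * (logb 2 (C.X J) + 1 / 4)) + 7 * S := by
      intro J hJ
      have h1 := groups_mul_le C J
      have h2 : logb 2 (C.X J : ℝ) ≤ logb 2 C.n + 1 := by
        have h3 := (X_le h (Finset.mem_range.1 hJ)).2
        have h4 : (C.X J : ℝ) ≤ C.n * 2 := by
          exact_mod_cast (by omega : C.X J ≤ C.n * 2)
        refine (Real.logb_le_logb_of_le (b := 2) (by norm_num)
          (by exact_mod_cast X_pos (C := C) J) h4).trans (le_of_eq ?_)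
        rw [Real.logb_mul (by positivity) (by norm_num), Real.logb_self_eq_one (by norm_num)]
      linarith
    have h1 : (C.R : ℝ) * ∑ J ∈ Finset.range C.nb, (logb 2 (C.X J : ℝ) + 1 / 4) ≤
        C.n * logb 2 C.n - 1.44 * C.n + C.R * (2 * logb 2 C.n + 4.44) + (C.n + C.R) / 4 := by
      rw [Finset.sum_add_distrib, Finset.sum_const, Finset.card_range, nsmul_eq_mul]
      have := mul_sum_logb_X_le h hRn
      linarith
    calc ((C.groups * ∑ J ∈ Finset.range C.nb, C.W J : ℕ) : ℝ)
        = ∑ J ∈ Finset.range C.nb, (C.groups : ℝ) * C.W J := by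
          push_cast; rw [Finset.mul_sum]
      _ ≤ ∑ J ∈ Finset.range C.nb,
          ((C.sg : ℝ) * (C.R * (logb 2 (C.X J) + 1 / 4)) + 7 * S) := Finset.sum_le_sum hterm
      _ = C.sg * (C.R * ∑ J ∈ Finset.range C.nb, (logb 2 (C.X J : ℝ) + 1 / 4)) +
          C.nb * (7 * S) := by
          rw [Finset.sum_add_distrib, ← Finset.mul_sum, ← Finset.mul_sum, Finset.sum_const,
            Finset.card_range, nsmul_eq_mul]
      _ ≤ _ := by gcongr
  -- the remaining parts
  have hS' : (Nat.size (C.sg + 1) : ℝ) ≤ logb 2 (C.sg + 1) ^ 2 + 1 :=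
    natSize_succ_le C.sg hsg
  have hS'sg : (Nat.size (C.sg + 1) : ℝ) ≤ 2 * C.sg := by
    have h1 : Nat.size (C.sg + 1) ≤ C.sg + 1 := Nat.size_le.2 Nat.lt_two_pow_self
    exact_mod_cast (by omega : Nat.size (C.sg + 1) ≤ 2 * C.sg)
  have hphi : (C.phi : ℝ) ≤ C.sg := by
    exact_mod_cast (Nat.size_le.2 Nat.lt_two_pow_self : Nat.size C.sg ≤ C.sg)
  have hdir : (C.nb : ℝ) * 7 * C.L + C.nb * (7 * S) ≤ C.sg * (1267 * (4 / 2 ^ 17 * C.n + S)) := by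
    have h1 : 7 * (C.L : ℝ) + 7 * S ≤ C.sg * (1267 * S) := by
      have i1 : S ≤ C.sg * S := le_mul_of_one_le_left (by linarith only [hS1R]) hsgR
      have i2 : (C.sg : ℝ) ≤ C.sg * S := le_mul_of_one_le_right (by linarith only [hsgR]) hS1R
      linarith only [i1, i2, hLle, hS'sg]
    have h2 : (C.nb : ℝ) * (7 * C.L + 7 * S) ≤ C.nb * (C.sg * (1267 * S)) := by gcongr
    have h3 : (C.sg : ℝ) * (1267 * (C.nb * S)) ≤ C.sg * (1267 * (4 / 2 ^ 17 * C.n + S)) := by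
      gcongr
    linarith only [h2, h3]
  have hfl : (C.n : ℝ) * C.phi ≤ C.sg * C.n := by
    rw [mul_comm]; gcongr
  have hbr : (C.sg : ℝ) * (C.n * logb 2 C.n - 1.44 * C.n + C.R * (2 * logb 2 C.n + 4.44) +
      (C.n + C.R) / 4 + C.n + 1267 * (4 / 2 ^ 17 * C.n + S)) ≤
      C.sg * ((C.n - 1) * logb 2 C.n) := by
    have i1 : (C.R : ℝ) * (2 * logb 2 C.n + 4.69) ≤ 2 ^ 17 * S * (2 * S + 4.69 * S) := by
      gcongr
      linarith only [hS1R]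
    gcongr
    have i2 : 2 ^ 17 * S * (2 * S + 4.69 * S) = 876871.68 * S ^ 2 := by ring
    rw [i2] at i1
    linarith only [i1, hSsq, hbig, hlgS, hn1, hS1R]
  have h0 := Nat.cast_le (α := ℝ).2 (aBlock_le h)
  rw [Nat.cast_add, Nat.cast_add, Nat.cast_add (C.nb * C.R + C.n)] at h0
  push_cast at h0 hT hG
  have hy3 : y ≤ y ^ 3 := le_self_pow₀ hy1 (by norm_num)
  have hy31 : 1 ≤ y ^ 3 := one_le_pow₀ hy1
  have hrest : 1 + 13 * (C.L : ℝ) + C.R ≤ 780 * logb 2 (C.sg + 1) ^ 2 +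
      (781 + 5 * (780 + 2 ^ 17)) * y ^ 3 := by
    linarith only [hLle, hRS, hS', hSy, hy3, hy31]
  linarith only [h0, hT, hG, hdir, hfl, hbr, hrest, hM2]

end Code

namespace Code

open WordRAM

/-! ### The code determines the automaton -/

/-- The program recovers the tables from the bits, so that codes with equal bits have equal
tables. -/
theorem eq_of_bits_eq {C D : Code} {K : ℕ} (hC : C.IsValid K) (hD : D.IsValid K)
    (hn : D.n = C.n) (hsg : D.sg = C.sg) (h : D.bits = C.bits) :
    D.start = C.start ∧ ∀ i < C.n, D.acc i = C.acc i ∧ ∀ a ≤ C.sg, D.next i a = C.next i a := by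
  set w := 100 * (C.L + D.L) with hw
  have hwC : 100 * C.L ≤ w := by omega
  have hwD : 100 * D.L ≤ w := by omega
  obtain ⟨c1, c2⟩ := eval_header hC hwC fun _ => 0
  obtain ⟨d1, d2⟩ := eval_header hD hwD fun _ => 0
  rw [h] at d1 d2
  refine ⟨d2.symm.trans c2, fun i hi => ?_⟩
  set ρ₀ := headerBlock.eval C.bits fun _ : Fin 16 => (0 : BitVec w)
  have hlt : ∀ j < 2 ^ C.L, (BitVec.ofNat w j).toNat = j := fun j hj => by
    rw [BitVec.toNat_ofNat, Nat.mod_eq_of_lt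
      (hj.trans_le (Nat.pow_le_pow_right (by norm_num) (by omega)))]
  set ρ₁ := Function.update ρ₀ vState (BitVec.ofNat w i) with hρ₁
  have hi₁ : (ρ₁ vState).toNat = i := by
    rw [hρ₁, Function.update_self, hlt _ (hi.trans (n_lt hC))]
  have c3 : C.HasHeader ρ₁ := c1.of_eq fun v _ hv _ _ _ => Function.update_of_ne hv _ _
  have d3 : D.HasHeader ρ₁ := d1.of_eq fun v _ hv _ _ _ => Function.update_of_ne hv _ _
  have hi' : i < D.n := hn.symm ▸ hi
  constructor
  · have c4 := eval_accept hC hwC c3 hi hi₁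
    have d4 := eval_accept hD hwD d3 hi' hi₁
    rw [h] at d4
    exact Bool.eq_iff_iff.2 (d4.symm.trans c4)
  · intro a ha
    set ρ₂ := Function.update ρ₁ vLetter (BitVec.ofNat w a) with hρ₂
    have ha₂ : (ρ₂ vLetter).toNat = a := by
      rw [hρ₂, Function.update_self, hlt _ (ha.trans_lt hC.sg_lt)]
    have hi₂ : (ρ₂ vState).toNat = i := by
      rw [hρ₂, Function.update_of_ne (by decide), hi₁]
    have c4 := eval_step hC hwC (ρ := ρ₂)
      (c3.of_eq fun v hv _ _ _ _ => Function.update_of_ne hv _ _) hi hi₂ ha ha₂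
    have d4 := eval_step hD hwD (ρ := ρ₂)
      (d3.of_eq fun v hv _ _ _ _ => Function.update_of_ne hv _ _) hi' hi₂ (hsg.symm ▸ ha) ha₂
    rw [h] at d4
    exact d4.2.symm.trans c4.2

/-! ### The code of an automaton -/

/-- The number of states from which on the blocks consist of more than one row. It is so large that
the terms of order `(log n) ^ 2` per letter are negligible. -/
def threshold : ℕ := (2 * 10 ^ 8) ^ 2

/-- The term of lower order in the length of the code of an automaton with `n` states. -/
noncomputable def lowerOrder (n : ℕ) : ℝ :=
  (800 * 2 ^ 34 + 781 + 5 * (780 + 2 ^ 17)) * ((n : ℝ) ^ (1 / 4 : ℝ)) ^ 3 +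
    if n < threshold then 1 + 4 * (threshold : ℝ) + 3 * (threshold : ℝ) ^ 2 +
      60 * threshold * (13 + 7 * threshold) else 0

theorem lowerOrder_isLittleO : lowerOrder =o[Filter.atTop] fun n : ℕ => (n : ℝ) := by
  refine .add (.const_mul_left ?_ _) ?_
  · have h1 := (tendsto_rpow_neg_atTop (y := 1 / 4) (by norm_num)).comp
      (tendsto_natCast_atTop_atTop (R := ℝ))
    refine Asymptotics.isLittleO_of_tendsto' ?_ (h1.congr' ?_)
    · filter_upwards [Filter.eventually_ge_atTop 1] with n hn h0
      exact absurd h0 (by positivity)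
    · filter_upwards [Filter.eventually_ge_atTop 1] with n hn
      have hn0 : (0 : ℝ) < n := by exact_mod_cast hn
      rw [Function.comp_apply, eq_div_iff hn0.ne', ← Real.rpow_natCast, ← Real.rpow_mul hn0.le]
      nth_rw 2 [← Real.rpow_one (n : ℝ)]
      rw [← Real.rpow_add hn0]
      norm_num
  · refine (Asymptotics.isLittleO_zero _ _).congr' ?_ .rfl
    filter_upwards [Filter.eventually_ge_atTop threshold] with n hn
    rw [if_neg (by omega)]

open Classical in
/-- The tables of a sorted automaton with `sg + 1` letters. Since the last block may extend beyond
the last row, all rows from the last one on are equal. -/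
noncomputable def ofDFA {sg n : ℕ} (A : DFA (Fin (sg + 1)) (Fin n)) (fl : Fin n → Fin (sg + 1)) :
    Code :=
  let row (i : ℕ) : Fin n := ⟨min i (n - 1), by have := A.start.pos; omega⟩
  { n := n
    sg := sg
    start := A.start
    acc := fun i => decide (row i ∈ A.accept)
    fl := fun i => fl (row i)
    c := fun i => A.step (row i) (fl (row i))
    ent := fun i b => A.step (row i) (Fin.ofNat (sg + 1) (if b < fl (row i) then b else b + 1))
    R := if n < threshold then 1 else 2 ^ 17 * (Nat.size n / 4 + 1)
    s := Nat.size n / 4 + 1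
    L := 60 * Nat.size (n * (sg + 1)) }

section OfDFA

variable {sg n : ℕ} {A : DFA (Fin (sg + 1)) (Fin n)} {fl : Fin n → Fin (sg + 1)}

theorem isTable_ofDFA (h : A.IsSorted fl) : (ofDFA A fl).IsTable where
  R_pos := by
    simp only [ofDFA]
    split_ifs <;> omega
  monotone := fun i j hij => h.monotone (Fin.mk_le_mk.2 (by omega))
  c_lt := fun i => (A.step _ _).isLt
  fl_le := fun i => Nat.lt_succ_iff.1 (fl _).isLt
  ent_lt := fun i b => by
    have key : ∀ (q : Fin n) (a), (A.step q a).val < max 1 q.val := fun q a => by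
      rcases Nat.eq_zero_or_pos q.val with h0 | h0
      · rw [h.step_zero q h0, h0]
        omega
      · have := Fin.lt_def.1 (h.step_lt q h0 a)
        omega
    exact (key _ _).trans_le (max_le_max le_rfl (min_le_left _ _))
  start_lt := A.start.isLt

theorem isValid_ofDFA (h : A.IsSorted fl) : (ofDFA A fl).IsValid (2 ^ 17) := by
  refine isValid_of_size (isTable_ofDFA h) rfl rfl rfl ?_
  simp only [ofDFA]
  split_ifs <;> omega

theorem acc_ofDFA (i : Fin n) : (ofDFA A fl).acc i = true ↔ i ∈ A.accept := by
  have hi : min i.val (n - 1) = i := by have := i.isLt; omega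
  simp only [ofDFA, decide_eq_true_eq, hi]

theorem next_ofDFA (h : A.IsSorted fl) (hA : A.IsInitiallyConnected) (i : Fin n)
    (a : Fin (sg + 1)) : (ofDFA A fl).next i a = A.step i a := by
  have hi : min i.val (n - 1) = i := by have := i.isLt; omega
  rw [next]
  split_ifs with h0 h1 h2
  · change sg = 0 at h0
    subst h0
    exact (h.step_eq_pred hA i a).symm
  · simp only [ofDFA, hi] at h1 ⊢
    rw [Fin.ext h1]
  · simp only [ofDFA, hi] at h2 ⊢
    rw [if_neg (by omega), Nat.sub_add_cancel (by omega), Fin.ofNat_eq_cast, Fin.cast_val_eq_self]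
  · simp only [ofDFA, hi] at h1 h2 ⊢
    rw [Nat.sub_zero, if_pos (by omega), Fin.ofNat_eq_cast, Fin.cast_val_eq_self]

theorem foldl_next_ofDFA (h : A.IsSorted fl) (hA : A.IsInitiallyConnected)
    (x : List (Fin (sg + 1))) (i : Fin n) :
    x.foldl (fun i a => (ofDFA A fl).next i a.val) i = (A.evalFrom i x).val := by
  induction x generalizing i with
  | nil => rfl
  | cons a x ih => rw [List.foldl_cons, next_ofDFA h hA, ih]; rfl

theorem eq_of_bits_ofDFA_eq {B : DFA (Fin (sg + 1)) (Fin n)} {fl' : Fin n → Fin (sg + 1)}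
    (hA : A.IsSorted fl) (hB : B.IsSorted fl') (hA' : A.IsInitiallyConnected)
    (hB' : B.IsInitiallyConnected) (h : (ofDFA B fl').bits = (ofDFA A fl).bits) : B = A := by
  obtain ⟨h1, h2⟩ := eq_of_bits_eq (isValid_ofDFA hA) (isValid_ofDFA hB) rfl rfl h
  have hstep : B.step = A.step := by
    funext i a
    have := (h2 i i.isLt).2 a (Nat.lt_succ_iff.1 a.isLt)
    rw [next_ofDFA hA hA', next_ofDFA hB hB'] at this
    exact Fin.ext this
  have hstart : B.start = A.start := Fin.ext h1
  have haccept : B.accept = A.accept := by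
    ext i
    rw [← acc_ofDFA (fl := fl'), ← acc_ofDFA (fl := fl), (h2 i i.isLt).1]
  cases A
  cases B
  simp_all

theorem length_bits_ofDFA_le (h : A.IsSorted fl) : ((ofDFA A fl).bits.length : ℝ) ≤
    (((sg + 1 : ℕ) : ℝ) - 1) * ((n : ℝ) - 1) * Real.logb 2 n + 3 * n +
      (2 * (threshold + 60 * (13 + 7 * threshold)) + 780) * Real.logb 2 ((sg + 1 : ℕ) : ℝ) ^ 2 +
      lowerOrder n := by
  have ht := isTable_ofDFA h
  have hn : 1 ≤ n := A.start.pos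
  have hn1 : (1 : ℝ) ≤ n := by exact_mod_cast hn
  obtain ⟨hy1, hSy, -⟩ := natSize_le_fourth_root n hn
  have hsq : 0 ≤ Real.logb 2 ((sg : ℝ) + 1) ^ 2 := sq_nonneg _
  have hth : (0 : ℝ) ≤ threshold := Nat.cast_nonneg _
  rw [length_bits]
  push_cast
  rw [add_sub_cancel_right, mul_assoc, lowerOrder]
  set y := (n : ℝ) ^ (1 / 4 : ℝ)
  have hy3 : y ≤ y ^ 3 := le_self_pow₀ hy1 (by norm_num)
  have hthr : 0 ≤ (threshold : ℝ) * Real.logb 2 ((sg : ℝ) + 1) ^ 2 := by positivity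
  have hn0 : (0 : ℝ) ≤ n := by linarith
  have hif : (0 : ℝ) ≤ if n < threshold then 1 + 4 * (threshold : ℝ) + 3 * (threshold : ℝ) ^ 2 +
      60 * threshold * (13 + 7 * threshold) else 0 := by
    split_ifs <;> positivity
  rcases Nat.eq_zero_or_pos sg with h0 | h0
  · have e1 : (ofDFA A fl).L = 60 * Nat.size n := by
      change 60 * Nat.size (n * (sg + 1)) = _
      rw [h0, zero_add, mul_one]
    rw [if_pos (show (ofDFA A fl).sg = 0 from h0), e1, show (ofDFA A fl).n = n from rfl,
      show (sg : ℝ) = 0 by exact_mod_cast h0]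
    push_cast
    rw [zero_add, Real.logb_one]
    linarith
  · rw [if_neg (show ¬(ofDFA A fl).sg = 0 from h0.ne')]
    by_cases hth' : n < threshold
    · have h1 := aBlock_le_of_small ht h0 (n₀ := threshold) hth'.le rfl rfl (if_pos hth')
      change _ ≤ (sg : ℝ) * ((n - 1) * Real.logb 2 n) +
        2 * (threshold + 60 * (13 + 7 * threshold)) * Real.logb 2 (sg + 1) ^ 2 +
        (800 * 2 ^ 34 * y ^ 3 + _) at h1
      rw [if_pos hth']
      linarith
    · have h1 := aBlock_le_of_large ht h0 (not_lt.1 hth') rfl rfl (if_neg hth')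
      change _ ≤ (sg : ℝ) * ((n - 1) * Real.logb 2 n) + 3 * n +
        780 * Real.logb 2 (sg + 1) ^ 2 +
        (800 * 2 ^ 34 + 781 + 5 * (780 + 2 ^ 17)) * y ^ 3 at h1
      rw [if_neg hth']
      linarith

end OfDFA

end Code

open Classical in
/-- The code of an acyclic automaton: the bits of the code of a sorted automaton that is obtained
by renaming its states. -/
noncomputable def Code.encode : (σ n : ℕ) → DFA (Fin σ) (Fin n) → List Bool
  | 0, _, _ => []
  | _ + 1, _, A =>
    if h : A.IsAcyclic then
      (Code.ofDFA (DFA.reindex (DFA.exists_isSorted h).choose A)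
        (DFA.exists_isSorted h).choose_spec.choose).bits
    else []

theorem Code.encode_eq {sg n : ℕ} {A : DFA (Fin (sg + 1)) (Fin n)} (h : A.IsAcyclic) :
    ∃ (e : Fin n ≃ Fin n) (fl : Fin n → Fin (sg + 1)), (DFA.reindex e A).IsSorted fl ∧
      Code.encode (sg + 1) n A = (Code.ofDFA (DFA.reindex e A) fl).bits :=
  ⟨_, _, (DFA.exists_isSorted h).choose_spec.choose_spec, by rw [encode, dif_pos h]⟩

theorem DFA.IsAcyclic.exists_eq_succ {σ n : ℕ} {A : DFA (Fin σ) (Fin n)} (h : A.IsAcyclic) :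
    ∃ sg, σ = sg + 1 := by
  obtain ⟨d, ⟨x, hx, -⟩, -⟩ := h
  cases x with
  | nil => exact absurd rfl hx
  | cons a x => exact Nat.exists_eq_succ_of_ne_zero fun h0 => absurd a.isLt (by omega)

theorem theorem2 :
    -- the transitions on the last letter form a spanning tree rooted at the dead state
    (∀ (σ n : ℕ) (A : DFA (Fin σ) (Fin n)), A.IsInitiallyConnected → A.IsAcyclic →
      ∃ d : Fin n, (∀ q : Fin n, A.IsRecurrent q ↔ q = d) ∧ (∀ a : Fin σ, A.step d a = d) ∧
        ∃ l : Fin σ, l.val + 1 = σ ∧ (A.letterGraph l).IsTree ∧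
          ∀ q : Fin n, ∃ j : ℕ, (fun p => A.step p l)^[j] q = d) ∧
    -- the encoding, and the program that decides acceptance on it
    ∃ (k : ℕ) (P : WordRAM.Program k) (c T : ℕ) (C : ℝ) (f : ℕ → ℝ)
      (enc : (σ n : ℕ) → DFA (Fin σ) (Fin n) → List Bool),
      f =o[Filter.atTop] (fun n : ℕ => (n : ℝ)) ∧
      ∀ (σ n : ℕ) (A : DFA (Fin σ) (Fin n)), A.IsInitiallyConnected → A.IsAcyclic →
        -- the code of `A` determines `A` up to the names of its states
        (∀ B : DFA (Fin σ) (Fin n), B.IsInitiallyConnected → B.IsAcyclic →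
          enc σ n B = enc σ n A → ∃ e : Fin n ≃ Fin n, DFA.reindex e A = B) ∧
        -- its length
        ((enc σ n A).length : ℝ) ≤
          ((σ : ℝ) - 1) * ((n : ℝ) - 1) * Real.logb 2 n + 3 * n + C * Real.logb 2 σ ^ 2 + f n ∧
        -- acceptance in linear time, using `k` words of `w` bits
        ∀ w : ℕ, c * Nat.size (n * σ) ≤ w → ∀ x : List (Fin σ),
          WordRAM.DecidesWithin P w (enc σ n A) x (T * (x.length + 1)) (x ∈ A.accepts) := by
  refine ⟨fun σ n A _ hA => ?_, ?_⟩
  · obtain ⟨sg, rfl⟩ := hA.exists_eq_succ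
    obtain ⟨d, hd1, hd2⟩ := hA
    have hd : ∀ q, A.IsRecurrent q ↔ q = d := fun q => ⟨hd2 q, fun h => h ▸ hd1⟩
    exact ⟨d, hd, DFA.step_dead hd, Fin.last sg, rfl, DFA.letterGraph_isTree hd _,
      DFA.exists_iterate_eq_dead hd _⟩
  · obtain ⟨k, P, T, hP⟩ := Code.exists_program (2 ^ 17)
    -- an address takes `60` times the size of `n * σ`, and a word must hold `100` addresses
    refine ⟨k, P, 100 * 60, T,
      2 * (Code.threshold + 60 * (13 + 7 * Code.threshold)) + 780, Code.lowerOrder, Code.encode, Code.lowerOrder_isLittleO,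
      fun σ n A hA hA' => ?_⟩
    obtain ⟨sg, rfl⟩ := hA'.exists_eq_succ
    obtain ⟨e, fl, hs, he⟩ := Code.encode_eq hA'
    refine ⟨fun B hB hB' hBA => ?_, he ▸ Code.length_bits_ofDFA_le hs, fun w hw x => ?_⟩
    · obtain ⟨e', fl', hs', he'⟩ := Code.encode_eq hB'
      rw [he, he'] at hBA
      have h := Code.eq_of_bits_ofDFA_eq hs hs' (hA.reindex e) (hB.reindex e') hBA
      refine ⟨e.trans e'.symm, ?_⟩
      change (DFA.reindex e').symm (DFA.reindex e A) = B
      rw [← h, Equiv.symm_apply_apply]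
    · have hic := hA.reindex e
      have hx := hP w (sg + 1) (Code.ofDFA (DFA.reindex e A) fl) x (Code.isValid_ofDFA hs) rfl
        (by rw [mul_assoc] at hw; exact hw) fun i hi a ha => by
          rw [Code.next_ofDFA hs hic ⟨i, hi⟩ ⟨a, Nat.lt_succ_iff.2 ha⟩]
          exact Fin.isLt _
      have hfold := Code.foldl_next_ofDFA hs hic x (DFA.reindex e A).start
      rw [show (Code.ofDFA (DFA.reindex e A) fl).start = (DFA.reindex e A).start.val from rfl,
        hfold, Code.acc_ofDFA] at hx
      rw [he, ← A.accepts_reindex e]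
      exact hx
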